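/- \textbf{Setting.} Two users exchange data through a half-duplex relay with fixed powers $P_1,P_2,P_r>0$ (users 1, 2, relay) over unit-variance AWGN with block fading. The power gains $(S_1(i),S_2(i))$ in slots $i=1,2,\dots$ form a jointly stationary and ergodic nonnegative process with finite means, and $(S_1,S_2)$ has a continuous (absolutely continuous) one-slot law; $E$ is expectation under it. Let $C(x)=\log_2(1+x)$, $C_{jr}=C(P_jS_j)$, $C_{rj}=C(P_rS_j)$ ($j=1,2$), $C_r=C(P_1S_1+P_2S_2)$, and, for a time-sharing variable $t(i)\in[0,1]$, $C_{12r}=tC(P_1S_1)+(1-t)C\big(\tfrac{P_1S_1}{1+P_2S_2}\big)$, $C_{21r}=(1-t)C(P_2S_2)+tC\big(\tfrac{P_2S_2}{1+P_1S_1}\big)$. In each slot one of six modes is used: $\mathcal M_1$, $\mathcal M_2$ (user 1, resp. 2, to relay at rate $C_{1r}$, resp. $C_{2r}$), $\mathcal M_3$ (multiple access at rates $C_{12r},C_{21r}$), $\mathcal M_4$, $\mathcal M_5$ (relay to user 1, resp. 2), $\mathcal M_6$ (broadcast to both). Data of user $j$ is stored in an infinite relay buffer of content $Q_j$ (finite at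 the start); when the relay transmits to user 1, resp. 2, it does so at rate $\min\{C_{r1}(i),Q_2(i-1)\}$, resp. $\min\{C_{r2}(i),Q_1(i-1)\}$. A policy consists of binary $q_k(i)$ with $\sum_{k=1}^6q_k(i)=1$ and $t(i)\in[0,1]$; $\bar R_{1r},\bar R_{2r},\bar R_{r1},\bar R_{r2}$ are the limits as $N\to\infty$ of the averages over $N$ slots of the rates user 1 to relay, user 2 to relay, relay to user 1, relay to user 2. The sum rate is $\bar R_{r1}+\bar R_{r2}$. Write (C1): $\bar R_{1r}=\bar R_{r2}$ and (C2): $\bar R_{2r}=\bar R_{r1}$. \textbf{Policy.} In each slot select a mode $k$ that maximizes $\mathcal I_k(i)\Lambda_k(i)$, where $\Lambda_1=(1-\mu_1)C_{1r}$, $\Lambda_2=(1-\mu_2)C_{2r}$, $\Lambda_3=(1-\mu_1)C_{12r}+(1-\mu_2)C_{21r}$, $\Lambda_4=\mu_2C_{r1}$, $\Lambda_5=\mu_1C_{r2}$, $\Lambda_6=\mu_1C_{r2}+\mu_2C_{r1}$. The constants $\mu_1,\mu_2\in[0,1]$, the variable $t(i)$ and the indicators $\mathcal I_k(i)\in\{0,1\}$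 are given below. $X_n(i)\in\{0,1\}$ ($n=1,\dots,5$) are coin flips, independent of each other and of the channel, with $\Pr\{X_n(i)=1\}=p_n$. Indicators not mentioned are $0$. \emph{Region $\mathcal R_1$.} Let $q=1$ if ($P_2>P_r$ and $\Lambda_3\le\Lambda_6$ at $t=0,\mu_1=1,\mu_2=\mu_2^*$) or ($P_2<P_r$ and $\Lambda_3\ge\Lambda_6$ at $t=0,\mu_1=\mu_1^*,\mu_2=0$), and $q=0$ otherwise. Here, if $P_2>P_r$, $\mu_2^*\in[0,1]$ is chosen such that $E\{(1-q)C_{2r}\}=E\{qC_{r1}\}$, and if $P_2<P_r$, $\mu_1^*\in[0,1]$ is chosen such that $E\{q(C_r-C_{2r})\}=E\{(1-q)C_{r2}\}$. Put $\omega_1=\frac{E\{qC_{r2}\}}{E\{(1-q)(C_r-C_{2r})\}}$, $\omega_2=\frac{E\{qC_{2r}\}}{E\{(1-q)C_{r1}\}}$, $\omega_3^l=\frac{E\{C_{r2}\}}{E\{C_r\}}$, $\omega_3^u=\frac{E\{C_{r1}\}}{E\{C_{r1}+C_{2r}\}}$. The region is $\mathcal R_1$ iff ($P_2>P_r$ and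 $\omega_1<1$) or ($P_2<P_r$ and $\omega_2<1$) or ($P_2=P_r$ and $\omega_3^l<\omega_3^u$). In it $t(i)=0$ for all $i$, and: if $P_2>P_r$: $\mu_1=1$, $\mu_2=\mu_2^*$, $\mathcal I_3=1-\mathcal I_2=X_1$, $\mathcal I_6=1$, $p_1=\omega_1$; if $P_2<P_r$: $\mu_1=\mu_1^*$, $\mu_2=0$, $\mathcal I_3=1$, $\mathcal I_6=1-\mathcal I_5=X_2$, $p_2=\omega_2$; if $P_2=P_r$: $\mu_1=1$, $\mu_2=0$, $\mathcal I_2=X_3(1-X_4)$, $\mathcal I_3=X_3X_4$, $\mathcal I_5=(1-X_3)(1-X_5)$, $\mathcal I_6=(1-X_3)X_5$, with any $p_3\in[\omega_3^l,\omega_3^u]$, $p_4=\frac{(1-p_3)\omega_3^l}{p_3(1-\omega_3^l)}$, $p_5=\frac{p_3(1-\omega_3^u)}{(1-p_3)\omega_3^u}$. \emph{Region $\mathcal R_2$.} As $\mathcal R_1$ with the users interchanged. Let $q=1$ if ($P_1>P_r$ and $\Lambda_3\le\Lambda_6$ at $t=1,\mu_1=\mu_1^*,\mu_2=1$) or ($P_1<P_r$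 and $\Lambda_3\ge\Lambda_6$ at $t=1,\mu_1=0,\mu_2=\mu_2^*$), and $q=0$ otherwise, where, if $P_1>P_r$, $\mu_1^*\in[0,1]$ is chosen such that $E\{(1-q)C_{1r}\}=E\{qC_{r2}\}$ and, if $P_1<P_r$, $\mu_2^*\in[0,1]$ such that $E\{q(C_r-C_{1r})\}=E\{(1-q)C_{r1}\}$. Put $\omega_1=\frac{E\{qC_{r1}\}}{E\{(1-q)(C_r-C_{1r})\}}$, $\omega_2=\frac{E\{qC_{1r}\}}{E\{(1-q)C_{r2}\}}$, $\omega_3^l=\frac{E\{C_{r1}\}}{E\{C_r\}}$, $\omega_3^u=\frac{E\{C_{r2}\}}{E\{C_{r2}+C_{1r}\}}$. The region is $\mathcal R_2$ iff ($P_1>P_r$ and $\omega_1<1$) or ($P_1<P_r$ and $\omega_2<1$) or ($P_1=P_r$ and $\omega_3^l<\omega_3^u$). In it $t(i)=1$ for all $i$, and: if $P_1>P_r$: $\mu_1=\mu_1^*$, $\mu_2=1$, $\mathcal I_3=1-\mathcal I_1=X_1$, $\mathcal I_6=1$, $p_1=\omega_1$; if $P_1<P_r$: $\mu_1=0$, $\mu_2=\mu_2^*$,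 $\mathcal I_3=1$, $\mathcal I_6=1-\mathcal I_4=X_2$, $p_2=\omega_2$; if $P_1=P_r$: $\mu_1=0$, $\mu_2=1$, $\mathcal I_1=X_3(1-X_4)$, $\mathcal I_3=X_3X_4$, $\mathcal I_4=(1-X_3)(1-X_5)$, $\mathcal I_6=(1-X_3)X_5$, with $p_3,p_4,p_5$ given by the same formulas as in $\mathcal R_1$. \emph{Region $\mathcal R_0$} is the remaining case. Then $\mathcal I_3=\mathcal I_6=1$. Let $q=1$ if $\frac{C_r}{C_{r1}+C_{r2}}\ge\frac{\mu^*}{1-\mu^*}$ and $q=0$ otherwise, with $\mu^*\in(0,1)$ such that $E\{qC_r\}=E\{(1-q)(C_{r1}+C_{r2})\}$, and let $t=\frac{E\{q(C_r-C_{2r})\}-E\{(1-q)C_{r2}\}}{E\{q(C_r-C_{1r}-C_{2r})\}}$. If $0<t<1$, then $t(i)=t$ and $\mu_1=\mu_2=\mu^*$. If $t\le0$, then $t(i)=0$ and $\mu_1\ge\mu_2$; if $t\ge1$, then $t(i)=1$ and $\mu_1\le\mu_2$; in these two cases $\mu_1,\mu_2\in[0,1]$ (and, if the maximizing mode is not almost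 surely unique, the tie-breaking rule, a measurable function of the channel state) are chosen such that (C1) and (C2) hold in the mean. \textbf{Theorem (Mode Selection Policy).} The thresholds $\mu_1^*,\mu_2^*,\mu^*$ above exist, $\mathcal R_1$ and $\mathcal R_2$ are mutually exclusive (so exactly one of $\mathcal R_0,\mathcal R_1,\mathcal R_2$ applies), and in the region that applies the prescribed choices are possible. For every such choice, all $p_n$ used lie in $[0,1]$, and almost surely the policy has deterministic average rates with $\bar R_{1r}=\bar R_{r2}=\lim_N\frac1N\sum_{i\le N}[q_5(i)+q_6(i)]C_{r2}(i)$ and $\bar R_{2r}=\bar R_{r1}=\lim_N\frac1N\sum_{i\le N}[q_4(i)+q_6(i)]C_{r1}(i)$, and it maximizes the average sum rate $\bar R_{r1}+\bar R_{r2}$ over all policies whose average sum rate exists. Relaxing $q_k(i)\in\{0,1\}$ to $0\le q_k(i)\le1$ in the maximization of $\bar R_{1r}+\bar R_{2r}$ subject to (C1) and (C2), with $\bar R_{r2},\bar R_{r1}$ given by the last two limits, does not increase the maximum. In every slot, $\mathcal M_3$ and $\mathcal M_6$ are each selected with positive probability. -/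

import Mathlib

open MeasureTheory ProbabilityTheory Filter Topology

noncomputable section

namespace TwoWayRelay

/-- The six transmission modes: `M1`, `M2` user 1 / user 2 to relay, `M3` multiple access,
`M4`, `M5` relay to user 1 / user 2, `M6` broadcast. -/
inductive Mode
  | M1 | M2 | M3 | M4 | M5 | M6
  deriving DecidableEq

instance : Fintype Mode :=
  ⟨{.M1, .M2, .M3, .M4, .M5, .M6}, fun x => by cases x <;> decide⟩

/-- The five coins. -/
inductive Coin
  | X1 | X2 | X3 | X4 | X5
  deriving DecidableEq

/-- The function on modes with the listed values. -/
def modeVec (a₁ a₂ a₃ a₄ a₅ a₆ : ℝ) : Mode → ℝ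
  | .M1 => a₁ | .M2 => a₂ | .M3 => a₃ | .M4 => a₄ | .M5 => a₅ | .M6 => a₆

/-- The function on coins with the listed values. -/
def coinVec (a₁ a₂ a₃ a₄ a₅ : ℝ) : Coin → ℝ
  | .X1 => a₁ | .X2 => a₂ | .X3 => a₃ | .X4 => a₄ | .X5 => a₅

/-- The fixed transmit powers of user 1, user 2 and the relay. -/
structure Powers where
  P₁ : ℝ
  P₂ : ℝ
  Pr : ℝ
  P₁_pos : 0 < P₁
  P₂_pos : 0 < P₂
  Pr_pos : 0 < Pr

/-! ### Instantaneous capacities; a channel state is `s = (S₁, S₂)` -/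

/-- `C(x) = log₂ (1 + x)`. -/
def cap (x : ℝ) : ℝ := Real.logb 2 (1 + x)

def C1r (P : Powers) (s : ℝ × ℝ) : ℝ := cap (P.P₁ * s.1)
def C2r (P : Powers) (s : ℝ × ℝ) : ℝ := cap (P.P₂ * s.2)
def Cr (P : Powers) (s : ℝ × ℝ) : ℝ := cap (P.P₁ * s.1 + P.P₂ * s.2)
def Cr1 (P : Powers) (s : ℝ × ℝ) : ℝ := cap (P.Pr * s.1)
def Cr2 (P : Powers) (s : ℝ × ℝ) : ℝ := cap (P.Pr * s.2)

/-- User 1's multiple-access rate under time sharing `t`. -/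
def C12r (P : Powers) (t : ℝ) (s : ℝ × ℝ) : ℝ :=
  t * cap (P.P₁ * s.1) + (1 - t) * cap (P.P₁ * s.1 / (1 + P.P₂ * s.2))

/-- User 2's multiple-access rate under time sharing `t`. -/
def C21r (P : Powers) (t : ℝ) (s : ℝ × ℝ) : ℝ :=
  (1 - t) * cap (P.P₂ * s.2) + t * cap (P.P₂ * s.2 / (1 + P.P₁ * s.1))

/-! ### The channel and the coins -/

/-- Block fading: `(S₁(i), S₂(i))` is a jointly stationary and ergodic process of nonnegative
gains with finite means and a continuous (i.e. absolutely continuous) one-slot law. -/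
structure IsFading {Ω : Type*} [MeasurableSpace Ω] (ρ : Measure Ω)
    (S : ℕ → Ω → ℝ × ℝ) : Prop where
  measurable : ∀ i, Measurable (S i)
  nonneg : ∀ i, ∀ᵐ ω ∂ρ, 0 ≤ (S i ω).1 ∧ 0 ≤ (S i ω).2
  integrable₁ : Integrable (fun ω => (S 0 ω).1) ρ
  integrable₂ : Integrable (fun ω => (S 0 ω).2) ρ
  /-- The shift is measure preserving (stationarity) and ergodic for the law of the process. -/
  ergodic : Ergodic (fun (x : ℕ → ℝ × ℝ) i => x (i + 1)) (ρ.map (fun ω i => S i ω))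
  continuous_law : ρ.map (S 0) ≪ volume

/-- `X n i` is the outcome of the `n`-th coin in slot `i`: all flips are independent, and
independent of the channel, and `X n i` equals `1` with probability `p n` and `0` otherwise. -/
structure IsCoinFlips {Ω : Type*} [MeasurableSpace Ω] (ρ : Measure Ω)
    (S : ℕ → Ω → ℝ × ℝ) (p : Coin → ℝ) (X : Coin → ℕ → Ω → ℝ) : Prop where
  measurable : ∀ n i, Measurable (X n i)
  prob_one : ∀ n i, ρ {ω | X n i ω = 1} = ENNReal.ofReal (p n)
  prob_zero : ∀ n i, ρ {ω | X n i ω = 0} = ENNReal.ofReal (1 - p n)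
  indep : iIndepFun (fun (k : Coin × ℕ) => X k.1 k.2) ρ
  indep_channel : IndepFun (fun ω (k : Coin × ℕ) => X k.1 k.2 ω) (fun ω (i : ℕ) => S i ω) ρ

/-! ### Long-term rates along a realization

`s i` is the channel state, `q i k` the selection variable of mode `k` and `t i` the time-sharing
variable in the `i`-th slot (`i = 0, 1, 2, …`). -/

/-- The long-term average of `f` is `L`. -/
def HasMean (f : ℕ → ℝ) (L : ℝ) : Prop :=
  Tendsto (fun N : ℕ => (∑ i ∈ Finset.range N, f i) / (N : ℝ)) atTop (𝓝 L)

/-- Rate user 1 to relay. -/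
def in₁ (P : Powers) (s : ℕ → ℝ × ℝ) (q : ℕ → Mode → ℝ) (t : ℕ → ℝ) (i : ℕ) : ℝ :=
  q i .M1 * C1r P (s i) + q i .M3 * C12r P (t i) (s i)

/-- Rate user 2 to relay. -/
def in₂ (P : Powers) (s : ℕ → ℝ × ℝ) (q : ℕ → Mode → ℝ) (t : ℕ → ℝ) (i : ℕ) : ℝ :=
  q i .M2 * C2r P (s i) + q i .M3 * C21r P (t i) (s i)

/-- Content of buffer `B₁` (data for user 2) at the beginning of slot `i`; `b` is the initial
content. -/
def queue₁ (P : Powers) (s : ℕ → ℝ × ℝ) (q : ℕ → Mode → ℝ) (t : ℕ → ℝ) (b : ℝ) : ℕ → ℝ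
  | 0 => b
  | i + 1 => queue₁ P s q t b i + in₁ P s q t i
      - (q i .M5 + q i .M6) * min (Cr2 P (s i)) (queue₁ P s q t b i)

/-- Content of buffer `B₂` (data for user 1) at the beginning of slot `i`. -/
def queue₂ (P : Powers) (s : ℕ → ℝ × ℝ) (q : ℕ → Mode → ℝ) (t : ℕ → ℝ) (b : ℝ) : ℕ → ℝ
  | 0 => b
  | i + 1 => queue₂ P s q t b i + in₂ P s q t i
      - (q i .M4 + q i .M6) * min (Cr1 P (s i)) (queue₂ P s q t b i)

/-- Rate relay to user 1, limited by the content of `B₂`. -/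
def out₁ (P : Powers) (s : ℕ → ℝ × ℝ) (q : ℕ → Mode → ℝ) (t : ℕ → ℝ) (b : ℝ) (i : ℕ) : ℝ :=
  (q i .M4 + q i .M6) * min (Cr1 P (s i)) (queue₂ P s q t b i)

/-- Rate relay to user 2, limited by the content of `B₁`. -/
def out₂ (P : Powers) (s : ℕ → ℝ × ℝ) (q : ℕ → Mode → ℝ) (t : ℕ → ℝ) (b : ℝ) (i : ℕ) : ℝ :=
  (q i .M5 + q i .M6) * min (Cr2 P (s i)) (queue₁ P s q t b i)

/-- Capacity offered to user 1. -/
def cout₁ (P : Powers) (s : ℕ → ℝ × ℝ) (q : ℕ → Mode → ℝ) (i : ℕ) : ℝ :=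
  (q i .M4 + q i .M6) * Cr1 P (s i)

/-- Capacity offered to user 2. -/
def cout₂ (P : Powers) (s : ℕ → ℝ × ℝ) (q : ℕ → Mode → ℝ) (i : ℕ) : ℝ :=
  (q i .M5 + q i .M6) * Cr2 P (s i)

/-- Exactly one mode per slot, and a time-sharing variable in `[0,1]`. -/
def Admissible (q : ℕ → Mode → ℝ) (t : ℕ → ℝ) : Prop :=
  ∀ i, ∑ k, q i k = 1 ∧ (∀ k, q i k * (1 - q i k) = 0) ∧ t i ∈ Set.Icc (0 : ℝ) 1

/-- The same with the binary condition relaxed to `0 ≤ q i k ≤ 1`. -/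
def RelaxedAdmissible (q : ℕ → Mode → ℝ) (t : ℕ → ℝ) : Prop :=
  ∀ i, ∑ k, q i k = 1 ∧ (∀ k, q i k ∈ Set.Icc (0 : ℝ) 1) ∧ t i ∈ Set.Icc (0 : ℝ) 1

/-- Along the realization `s`, and with initial buffer contents `b₁`, `b₂`, the policy `(q, t)`
has average rates `R̄_{1r} = R̄_{r2} = R₁` and `R̄_{2r} = R̄_{r1} = R₂`, the buffers being at the edge
of non-absorption, and its sum rate `R₁ + R₂` is maximal
* among the sum rates `R̄_{r1} + R̄_{r2}` of all policies, balanced or not, causal or not;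
* among all solutions of the binary-relaxed problem, in which the rates out of the relay are the
  offered capacities and have to balance the rates into the relay. -/
structure IsOptimal (P : Powers) (s : ℕ → ℝ × ℝ) (b₁ b₂ : ℝ) (q : ℕ → Mode → ℝ) (t : ℕ → ℝ)
    (R₁ R₂ : ℝ) : Prop where
  admissible : Admissible q t
  mean_in₁ : HasMean (in₁ P s q t) R₁
  mean_in₂ : HasMean (in₂ P s q t) R₂
  mean_out₂ : HasMean (out₂ P s q t b₁) R₁
  mean_out₁ : HasMean (out₁ P s q t b₂) R₂
  mean_cout₂ : HasMean (cout₂ P s q) R₁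
  mean_cout₁ : HasMean (cout₁ P s q) R₂
  maximal : ∀ q' t', Admissible q' t' → ∀ R,
    HasMean (fun i => out₁ P s q' t' b₂ i + out₂ P s q' t' b₁ i) R → R ≤ R₁ + R₂
  maximal_relaxed : ∀ q' t', RelaxedAdmissible q' t' → ∀ R₁' R₂',
    HasMean (in₁ P s q' t') R₁' → HasMean (in₂ P s q' t') R₂' →
    HasMean (cout₂ P s q') R₁' → HasMean (cout₁ P s q') R₂' → R₁' + R₂' ≤ R₁ + R₂

/-! ### Selection metrics and SNR regions; `ν` is the law of `(S₁, S₂)` in one slot -/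

/-- The selection metrics `Λ_k`. -/
def metric (P : Powers) (μ₁ μ₂ t : ℝ) (s : ℝ × ℝ) : Mode → ℝ :=
  modeVec
    ((1 - μ₁) * C1r P s)
    ((1 - μ₂) * C2r P s)
    ((1 - μ₁) * C12r P t s + (1 - μ₂) * C21r P t s)
    (μ₂ * Cr1 P s)
    (μ₁ * Cr2 P s)
    (μ₁ * Cr2 P s + μ₂ * Cr1 P s)

namespace R1

/-- `q`, with `μ` in the place of `μ₂*` if `P₂ > Pr` and of `μ₁*` if `P₂ < Pr`. -/
def q (P : Powers) (μ : ℝ) (s : ℝ × ℝ) : ℝ :=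
  if (P.P₂ > P.Pr ∧ metric P 1 μ 0 s .M3 ≤ metric P 1 μ 0 s .M6) ∨
      (P.P₂ < P.Pr ∧ metric P μ 0 0 s .M3 ≥ metric P μ 0 0 s .M6) then 1 else 0

/-- The equation that defines `μ₂*` if `P₂ > Pr` and `μ₁*` if `P₂ < Pr`. -/
def Balanced (P : Powers) (ν : Measure (ℝ × ℝ)) (μ : ℝ) : Prop :=
  (P.P₂ > P.Pr → ∫ s, (1 - q P μ s) * C2r P s ∂ν = ∫ s, q P μ s * Cr1 P s ∂ν) ∧
  (P.P₂ < P.Pr → ∫ s, q P μ s * (Cr P s - C2r P s) ∂ν = ∫ s, (1 - q P μ s) * Cr2 P s ∂ν)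

def ω₁ (P : Powers) (ν : Measure (ℝ × ℝ)) (μ : ℝ) : ℝ :=
  (∫ s, q P μ s * Cr2 P s ∂ν) / ∫ s, (1 - q P μ s) * (Cr P s - C2r P s) ∂ν

def ω₂ (P : Powers) (ν : Measure (ℝ × ℝ)) (μ : ℝ) : ℝ :=
  (∫ s, q P μ s * C2r P s ∂ν) / ∫ s, (1 - q P μ s) * Cr1 P s ∂ν

def ω₃l (P : Powers) (ν : Measure (ℝ × ℝ)) : ℝ := (∫ s, Cr2 P s ∂ν) / ∫ s, Cr P s ∂ν

def ω₃u (P : Powers) (ν : Measure (ℝ × ℝ)) : ℝ :=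
  (∫ s, Cr1 P s ∂ν) / ∫ s, (Cr1 P s + C2r P s) ∂ν

end R1

namespace R2

/-- `q`, with `μ` in the place of `μ₁*` if `P₁ > Pr` and of `μ₂*` if `P₁ < Pr`. -/
def q (P : Powers) (μ : ℝ) (s : ℝ × ℝ) : ℝ :=
  if (P.P₁ > P.Pr ∧ metric P μ 1 1 s .M3 ≤ metric P μ 1 1 s .M6) ∨
      (P.P₁ < P.Pr ∧ metric P 0 μ 1 s .M3 ≥ metric P 0 μ 1 s .M6) then 1 else 0

/-- The equation that defines `μ₁*` if `P₁ > Pr` and `μ₂*` if `P₁ < Pr`. -/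
def Balanced (P : Powers) (ν : Measure (ℝ × ℝ)) (μ : ℝ) : Prop :=
  (P.P₁ > P.Pr → ∫ s, (1 - q P μ s) * C1r P s ∂ν = ∫ s, q P μ s * Cr2 P s ∂ν) ∧
  (P.P₁ < P.Pr → ∫ s, q P μ s * (Cr P s - C1r P s) ∂ν = ∫ s, (1 - q P μ s) * Cr1 P s ∂ν)

def ω₁ (P : Powers) (ν : Measure (ℝ × ℝ)) (μ : ℝ) : ℝ :=
  (∫ s, q P μ s * Cr1 P s ∂ν) / ∫ s, (1 - q P μ s) * (Cr P s - C1r P s) ∂ν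

def ω₂ (P : Powers) (ν : Measure (ℝ × ℝ)) (μ : ℝ) : ℝ :=
  (∫ s, q P μ s * C1r P s ∂ν) / ∫ s, (1 - q P μ s) * Cr2 P s ∂ν

def ω₃l (P : Powers) (ν : Measure (ℝ × ℝ)) : ℝ := (∫ s, Cr1 P s ∂ν) / ∫ s, Cr P s ∂ν

def ω₃u (P : Powers) (ν : Measure (ℝ × ℝ)) : ℝ :=
  (∫ s, Cr2 P s ∂ν) / ∫ s, (Cr2 P s + C1r P s) ∂ν

end R2

namespace R0

def q (P : Powers) (μ : ℝ) (s : ℝ × ℝ) : ℝ :=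
  if Cr P s / (Cr1 P s + Cr2 P s) ≥ μ / (1 - μ) then 1 else 0

/-- The equation that defines `μ*`. -/
def Balanced (P : Powers) (ν : Measure (ℝ × ℝ)) (μ : ℝ) : Prop :=
  ∫ s, q P μ s * Cr P s ∂ν = ∫ s, (1 - q P μ s) * (Cr1 P s + Cr2 P s) ∂ν

/-- The unclipped time-sharing value. -/
def t (P : Powers) (ν : Measure (ℝ × ℝ)) (μ : ℝ) : ℝ :=
  ((∫ s, q P μ s * (Cr P s - C2r P s) ∂ν) - ∫ s, (1 - q P μ s) * Cr2 P s ∂ν) /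
    ∫ s, q P μ s * (Cr P s - C1r P s - C2r P s) ∂ν

end R0

/-- SNR region `R₁`. -/
def InR1 (P : Powers) (ν : Measure (ℝ × ℝ)) : Prop :=
  ∃ μ ∈ Set.Icc (0 : ℝ) 1, R1.Balanced P ν μ ∧
    ((P.P₂ > P.Pr ∧ R1.ω₁ P ν μ < 1) ∨ (P.P₂ < P.Pr ∧ R1.ω₂ P ν μ < 1) ∨
      (P.P₂ = P.Pr ∧ R1.ω₃l P ν < R1.ω₃u P ν))

/-- SNR region `R₂`. -/
def InR2 (P : Powers) (ν : Measure (ℝ × ℝ)) : Prop :=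
  ∃ μ ∈ Set.Icc (0 : ℝ) 1, R2.Balanced P ν μ ∧
    ((P.P₁ > P.Pr ∧ R2.ω₁ P ν μ < 1) ∨ (P.P₁ < P.Pr ∧ R2.ω₂ P ν μ < 1) ∨
      (P.P₁ = P.Pr ∧ R2.ω₃l P ν < R2.ω₃u P ν))

/-- SNR region `R₀`. -/
def InR0 (P : Powers) (ν : Measure (ℝ × ℝ)) : Prop := ¬ InR1 P ν ∧ ¬ InR2 P ν

/-! ### The proposed policy -/

/-- What determines the policy: the thresholds, the (constant) time-sharing variable, the coin
probabilities, and the indicators `I_k` as functions of the coin outcomes of the slot. -/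
structure Params where
  μ₁ : ℝ
  μ₂ : ℝ
  t : ℝ
  p : Coin → ℝ
  ind : (Coin → ℝ) → Mode → ℝ

/-- A rule that picks, for given indicators `I` and channel state `s`, a mode `k` that maximizes
`I_k Λ_k`. -/
structure IsArgmaxRule (P : Powers) (d : Params) (sel : (Mode → ℝ) → ℝ × ℝ → Mode) : Prop where
  measurable : ∀ I k, MeasurableSet {s | sel I s = k}
  argmax : ∀ I s k, I k * metric P d.μ₁ d.μ₂ d.t s k
    ≤ I (sel I s) * metric P d.μ₁ d.μ₂ d.t s (sel I s)

/-- Prescription in region `R₁`. Coins that are not used get probability `0`. -/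
def PrescribedR1 (P : Powers) (ν : Measure (ℝ × ℝ)) (d : Params) : Prop :=
  d.t = 0 ∧
  ((P.P₂ > P.Pr ∧ d.μ₁ = 1 ∧ d.μ₂ ∈ Set.Icc (0 : ℝ) 1 ∧ R1.Balanced P ν d.μ₂ ∧
      d.p = coinVec (R1.ω₁ P ν d.μ₂) 0 0 0 0 ∧
      d.ind = fun x => modeVec 0 (1 - x .X1) (x .X1) 0 0 1) ∨
    (P.P₂ < P.Pr ∧ d.μ₁ ∈ Set.Icc (0 : ℝ) 1 ∧ R1.Balanced P ν d.μ₁ ∧ d.μ₂ = 0 ∧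
      d.p = coinVec 0 (R1.ω₂ P ν d.μ₁) 0 0 0 ∧
      d.ind = fun x => modeVec 0 0 1 0 (1 - x .X2) (x .X2)) ∨
    (P.P₂ = P.Pr ∧ d.μ₁ = 1 ∧ d.μ₂ = 0 ∧
      (∃ p₃ ∈ Set.Icc (R1.ω₃l P ν) (R1.ω₃u P ν),
        d.p = coinVec 0 0 p₃
          ((1 - p₃) * R1.ω₃l P ν / (p₃ * (1 - R1.ω₃l P ν)))
          (p₃ * (1 - R1.ω₃u P ν) / ((1 - p₃) * R1.ω₃u P ν))) ∧
      d.ind = fun x => modeVec 0 (x .X3 * (1 - x .X4)) (x .X3 * x .X4) 0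
        ((1 - x .X3) * (1 - x .X5)) ((1 - x .X3) * x .X5)))

/-- Prescription in region `R₂`. -/
def PrescribedR2 (P : Powers) (ν : Measure (ℝ × ℝ)) (d : Params) : Prop :=
  d.t = 1 ∧
  ((P.P₁ > P.Pr ∧ d.μ₁ ∈ Set.Icc (0 : ℝ) 1 ∧ R2.Balanced P ν d.μ₁ ∧ d.μ₂ = 1 ∧
      d.p = coinVec (R2.ω₁ P ν d.μ₁) 0 0 0 0 ∧
      d.ind = fun x => modeVec (1 - x .X1) 0 (x .X1) 0 0 1) ∨
    (P.P₁ < P.Pr ∧ d.μ₁ = 0 ∧ d.μ₂ ∈ Set.Icc (0 : ℝ) 1 ∧ R2.Balanced P ν d.μ₂ ∧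
      d.p = coinVec 0 (R2.ω₂ P ν d.μ₂) 0 0 0 ∧
      d.ind = fun x => modeVec 0 0 1 (1 - x .X2) 0 (x .X2)) ∨
    (P.P₁ = P.Pr ∧ d.μ₁ = 0 ∧ d.μ₂ = 1 ∧
      (∃ p₃ ∈ Set.Icc (R2.ω₃l P ν) (R2.ω₃u P ν),
        d.p = coinVec 0 0 p₃
          ((1 - p₃) * R2.ω₃l P ν / (p₃ * (1 - R2.ω₃l P ν)))
          (p₃ * (1 - R2.ω₃u P ν) / ((1 - p₃) * R2.ω₃u P ν))) ∧
      d.ind = fun x => modeVec (x .X3 * (1 - x .X4)) 0 (x .X3 * x .X4)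
        ((1 - x .X3) * (1 - x .X5)) 0 ((1 - x .X3) * x .X5)))

/-- The selection variable of mode `k` if mode `m` is selected. -/
def pick (m k : Mode) : ℝ := if k = m then 1 else 0

/-- The constraints `R̄_{1r} = R̄_{r2}` and `R̄_{2r} = R̄_{r1}` in the mean, for a policy that selects
mode `κ s` in channel state `s` and uses time sharing `t`. -/
def MeanBalanced (P : Powers) (ν : Measure (ℝ × ℝ)) (t : ℝ) (κ : ℝ × ℝ → Mode) : Prop :=
  (∫ s, (pick (κ s) .M1 * C1r P s + pick (κ s) .M3 * C12r P t s) ∂ν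
    = ∫ s, (pick (κ s) .M5 + pick (κ s) .M6) * Cr2 P s ∂ν) ∧
  (∫ s, (pick (κ s) .M2 * C2r P s + pick (κ s) .M3 * C21r P t s) ∂ν
    = ∫ s, (pick (κ s) .M4 + pick (κ s) .M6) * Cr1 P s ∂ν)

/-- The indicators of region `R₀`: only `M3` and `M6` are candidates. -/
def indR0 : Mode → ℝ := modeVec 0 0 1 0 0 1

/-- Prescription in region `R₀`. If the unclipped time-sharing value is outside `(0,1)`, the
thresholds are chosen such that the two balance constraints hold for the selection rule. -/
def PrescribedR0 (P : Powers) (ν : Measure (ℝ × ℝ)) (d : Params)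
    (sel : (Mode → ℝ) → ℝ × ℝ → Mode) : Prop :=
  d.p = coinVec 0 0 0 0 0 ∧ (d.ind = fun _ => indR0) ∧
  ∃ μ ∈ Set.Ioo (0 : ℝ) 1, R0.Balanced P ν μ ∧
    ((0 < R0.t P ν μ ∧ R0.t P ν μ < 1 ∧ d.t = R0.t P ν μ ∧ d.μ₁ = μ ∧ d.μ₂ = μ) ∨
      (R0.t P ν μ ≤ 0 ∧ d.t = 0 ∧ 0 ≤ d.μ₂ ∧ d.μ₂ ≤ d.μ₁ ∧ d.μ₁ ≤ 1 ∧
        MeanBalanced P ν d.t (sel indR0)) ∨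
      (1 ≤ R0.t P ν μ ∧ d.t = 1 ∧ 0 ≤ d.μ₁ ∧ d.μ₁ ≤ d.μ₂ ∧ d.μ₂ ≤ 1 ∧
        MeanBalanced P ν d.t (sel indR0)))

/-- The parameters and the argmax rule are those that the proposed policy prescribes for the SNR
region that applies. -/
def Prescribed (P : Powers) (ν : Measure (ℝ × ℝ)) (d : Params)
    (sel : (Mode → ℝ) → ℝ × ℝ → Mode) : Prop :=
  IsArgmaxRule P d sel ∧
  ((InR1 P ν ∧ PrescribedR1 P ν d) ∨ (InR2 P ν ∧ PrescribedR2 P ν d) ∨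
    (InR0 P ν ∧ PrescribedR0 P ν d sel))

/-- The mode selected in slot `i`, for the channel process `S` and the coin flips `X`. -/
def selected {Ω : Type*} (d : Params) (sel : (Mode → ℝ) → ℝ × ℝ → Mode) (S : ℕ → Ω → ℝ × ℝ)
    (X : Coin → ℕ → Ω → ℝ) (i : ℕ) (ω : Ω) : Mode :=
  sel (d.ind (fun n => X n i ω)) (S i ω)

end TwoWayRelay

end

open MeasureTheory ProbabilityTheory TwoWayRelay

/-! Optimality is Lagrangian duality carried out along a single realization. With multipliers μ₁, μ₂
for the two balance constraints, the Lagrangian of a slot is the metric of the selected mode. Hence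
a rule that maximizes the metric over all modes and all time sharing in every slot, and whose
average rates balance, cannot be beaten: as μ₁, μ₂ ∈ [0,1], the departures of any policy are at most
a convex combination of (arrivals + initial content) and offered capacity. The same bound covers
relaxed selection variables (`isOptimal_of_balanced`). Balance also makes the queues o(N), so real
departures average to the offered capacity (`hasMean_departures`).

If μ₂ ≤ μ₁, only M3 at t = 0 and M6 can be maximal (`metric_le_max`); the other half of the square
follows by interchanging the users. The difference of these two metrics is `gap`, and the regions
are described by the net flows `flow₁`, `flow₂` through the two buffers under the rule that compares
them. Ties are negligible except at the corner (1,0) with equal powers (`IsGainLaw.ae_gap_ne`), so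
the flows are continuous in the thresholds and the intermediate value theorem supplies the starred
thresholds. Flows are monotone along the relevant lines, which makes the selection rule unique up to
null sets even if the threshold is not.

In region R₁ with unequal powers one flow vanishes and the condition ω < 1 is the sign of the other.
At these multipliers two modes have the same metric and differ only in whether the unbalanced data
is moved, so a coin removes the surplus at no cost; with equal powers four modes tie and coins do
everything. In region R₀ with 0 < t < 1 the time share moves rate from one buffer to the other while
the sum stays balanced. For t ≤ 0 the dual function is minimized over the triangle 0 ≤ μ₂ ≤ μ₁ ≤ 1;
its gradient is minus the pair of flows, and outside R₁ the optimality conditions force both flows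
to vanish (`IsGainLaw.flow_eq_zero_of_dual_min`). At the degenerate corner a convexity argument in
the spirit of Lyapunov's theorem produces a tie-breaking set (`exists_set_of_support`).

R₁ and R₂ exclude each other because each makes some dual value on its own side of the diagonal
strictly smaller than all dual values on the other side.

Means become long-term averages through Birkhoff's theorem for the channel, and through a variance
estimate for the coins; finite means of the gains suffice because capacities grow more slowly than
square roots. -/

namespace TwoWayRelay

/-! ### Birkhoff's pointwise ergodic theorem for ergodic maps -/

section Birkhoff

variable {α : Type*} {T : α → α} {f : α → ℝ}

/-- The running maximum of `0` and the Birkhoff sums of `f` of length at most `n`. -/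
def maxBirkhoffSum (T : α → α) (f : α → ℝ) : ℕ → α → ℝ
  | 0 => fun _ => 0
  | n + 1 => fun x => max 0 (f x + maxBirkhoffSum T f n (T x))

lemma maxBirkhoffSum_nonneg (n : ℕ) (x : α) : 0 ≤ maxBirkhoffSum T f n x := by
  cases n with
  | zero => exact le_rfl
  | succ n => exact le_max_left _ _

lemma maxBirkhoffSum_le_succ (n : ℕ) : ∀ x : α,
    maxBirkhoffSum T f n x ≤ maxBirkhoffSum T f (n + 1) x := by
  induction n with
  | zero => exact fun x => maxBirkhoffSum_nonneg 1 x
  | succ n ih => exact fun x => max_le_max le_rfl (by have := ih (T x); linarith)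

lemma monotone_maxBirkhoffSum (x : α) : Monotone fun n => maxBirkhoffSum T f n x :=
  monotone_nat_of_le_succ fun n => maxBirkhoffSum_le_succ n x

lemma birkhoffSum_le_maxBirkhoffSum (n : ℕ) : ∀ x : α,
    birkhoffSum T f n x ≤ maxBirkhoffSum T f n x := by
  induction n with
  | zero => intro x; simp [maxBirkhoffSum]
  | succ n ih =>
    intro x
    rw [birkhoffSum_succ']
    exact le_max_of_le_right (by have := ih (T x); linarith)

variable [MeasurableSpace α] {μ : Measure α}

lemma measurable_maxBirkhoffSum (hT : Measurable T) (hf : Measurable f) (n : ℕ) :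
    Measurable (maxBirkhoffSum T f n) := by
  induction n with
  | zero => exact measurable_const
  | succ n ih => exact measurable_const.max (hf.add (ih.comp hT))

lemma integrable_maxBirkhoffSum (hT : MeasurePreserving T μ μ) (hf : Integrable f μ) (n : ℕ) :
    Integrable (maxBirkhoffSum T f n) μ := by
  induction n with
  | zero => exact integrable_zero _ _ _
  | succ n ih => exact (integrable_zero _ _ _).sup (hf.add (hT.integrable_comp_of_integrable ih))

/-- Write M n for the running maxima. Since M (n+1) = max 0 (f + M n ∘ T), boundedness is an
invariant property, so it holds almost everywhere or almost nowhere. In the second case M (n+1) - M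
n ∘ T is eventually equal to f and is dominated by |f|, so its integrals tend to ∫ f < 0; by
invariance of the measure they equal ∫ (M (n+1) - M n) ≥ 0. -/
lemma ae_bddAbove_maxBirkhoffSum [IsProbabilityMeasure μ] (hT : Ergodic T μ) (hfm : Measurable f)
    (hf : Integrable f μ) (hneg : ∫ x, f x ∂μ < 0) :
    ∀ᵐ x ∂μ, BddAbove (Set.range fun n => maxBirkhoffSum T f n x) := by
  set B : Set α := {x | BddAbove (Set.range fun n => maxBirkhoffSum T f n x)} with hB
  have hBm : MeasurableSet B :=
    measurableSet_bddAbove_range (measurable_maxBirkhoffSum hT.measurable hfm)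
  have hinv : T ⁻¹' B = B := by
    ext x
    simp only [hB, Set.mem_preimage, Set.mem_ofPred_eq, bddAbove_def, Set.forall_mem_range]
    constructor
    · rintro ⟨c, hc⟩
      refine ⟨max 0 (f x + c), fun n => (maxBirkhoffSum_le_succ n x).trans ?_⟩
      exact max_le_max le_rfl (by have := hc n; linarith)
    · rintro ⟨c, hc⟩
      refine ⟨c - f x, fun n => ?_⟩
      have := (le_max_right 0 _).trans (hc (n + 1))
      linarith
  rcases hT.toPreErgodic.ae_mem_or_ae_notMem hBm hinv with h | h
  · exact h
  exfalso
  have hlim : Tendsto (fun n => ∫ x, (maxBirkhoffSum T f (n + 1) x - maxBirkhoffSum T f n (T x)) ∂μ)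
      atTop (𝓝 (∫ x, f x ∂μ)) := by
    have hT' := (measurable_maxBirkhoffSum hT.measurable hfm)
    refine tendsto_integral_of_dominated_convergence (fun x => |f x|) (fun n => ?_) hf.abs
      (fun n => Eventually.of_forall fun x => ?_) ?_
    · exact ((hT' (n + 1)).sub ((hT' n).comp hT.measurable)).aestronglyMeasurable
    · have h0 := maxBirkhoffSum_nonneg (T := T) (f := f) n (T x)
      simp only [maxBirkhoffSum, Real.norm_eq_abs]
      rcases max_cases 0 (f x + maxBirkhoffSum T f n (T x)) with ⟨h1, h2⟩ | ⟨h1, h2⟩ <;> rw [h1]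
      · rw [abs_of_nonpos (by linarith), abs_of_nonpos (by linarith)]; linarith
      · rw [add_sub_cancel_right]
    · filter_upwards [h] with x hx
      have hTx : ¬ BddAbove (Set.range fun n => maxBirkhoffSum T f n (T x)) := by
        have : T x ∉ B := fun hm => hx (hinv ▸ hm : x ∈ B)
        exact this
      have htop := tendsto_atTop_atTop_of_monotone' (monotone_maxBirkhoffSum (T x)) hTx
      refine tendsto_const_nhds.congr' ?_
      filter_upwards [htop.eventually_ge_atTop (-f x)] with n hn
      simp only [maxBirkhoffSum]
      rw [max_eq_right (by linarith), add_sub_cancel_right]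
  refine absurd (ge_of_tendsto' hlim fun n => ?_) (not_le.2 hneg)
  have hi := integrable_maxBirkhoffSum hT.toMeasurePreserving hf
  have hcomp : ∫ x, maxBirkhoffSum T f n (T x) ∂μ = ∫ x, maxBirkhoffSum T f n x ∂μ := by
    conv_rhs => rw [← hT.toMeasurePreserving.map_eq]
    rw [integral_map hT.measurable.aemeasurable
      (measurable_maxBirkhoffSum hT.measurable hfm n).aestronglyMeasurable]
  have hiT : Integrable (fun x => maxBirkhoffSum T f n (T x)) μ :=
    hT.toMeasurePreserving.integrable_comp_of_integrable (hi n)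
  rw [integral_sub (hi _) hiT, hcomp,
    sub_nonneg]
  exact integral_mono (hi _) (hi _) (maxBirkhoffSum_le_succ n)

/-- The function f - c has negative mean, so its Birkhoff sums are bounded above. -/
lemma ae_eventually_birkhoffSum_le [IsProbabilityMeasure μ] (hT : Ergodic T μ) (hfm : Measurable f)
    (hf : Integrable f μ) {c : ℝ} (hc : ∫ x, f x ∂μ < c) :
    ∀ᵐ x ∂μ, ∃ K, ∀ n : ℕ, birkhoffSum T f n x ≤ K + n * c := by
  have h := ae_bddAbove_maxBirkhoffSum (f := fun x => f x - c) hT (hfm.sub_const c)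
    (hf.sub (integrable_const c)) (by
      rw [integral_sub hf (integrable_const c)]; simpa using hc)
  filter_upwards [h] with x ⟨K, hK⟩
  refine ⟨K, fun n => ?_⟩
  have h1 := (birkhoffSum_le_maxBirkhoffSum n x).trans (hK ⟨n, rfl⟩)
  have h2 : birkhoffSum T (fun x => f x - c) n x = birkhoffSum T f n x - n * c := by
    simp [birkhoffSum, Finset.sum_sub_distrib]
  linarith

/-- **Birkhoff's pointwise ergodic theorem** for an ergodic map. -/
theorem ae_tendsto_birkhoffSum_div [IsProbabilityMeasure μ] (hT : Ergodic T μ)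
    (hfm : Measurable f) (hf : Integrable f μ) :
    ∀ᵐ x ∂μ, Tendsto (fun n : ℕ => birkhoffSum T f n x / n) atTop (𝓝 (∫ x, f x ∂μ)) := by
  -- Countably many slacks 1/(k+1) keep the exceptional set null; the lower bounds are the upper
  -- bounds for -f.
  have hup : ∀ᵐ x ∂μ, ∀ k : ℕ, ∃ K, ∀ n : ℕ,
      birkhoffSum T f n x ≤ K + n * (∫ x, f x ∂μ + 1 / (k + 1)) :=
    ae_all_iff.2 fun k => ae_eventually_birkhoffSum_le hT hfm hf
      (lt_add_of_pos_right _ (by positivity))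
  have hlo : ∀ᵐ x ∂μ, ∀ k : ℕ, ∃ K, ∀ n : ℕ,
      birkhoffSum T (-f) n x ≤ K + n * (∫ x, (-f) x ∂μ + 1 / (k + 1)) :=
    ae_all_iff.2 fun k => ae_eventually_birkhoffSum_le hT hfm.neg hf.neg
      (lt_add_of_pos_right _ (by positivity))
  filter_upwards [hup, hlo] with x hu hl
  rw [Metric.tendsto_atTop]
  intro ε hε
  obtain ⟨k, hk⟩ := exists_nat_one_div_lt (half_pos hε)
  obtain ⟨K, hK⟩ := hu k
  obtain ⟨L, hL⟩ := hl k
  obtain ⟨N, hN⟩ := exists_nat_gt (max 0 (max K L) / (ε / 2))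
  refine ⟨N + 1, fun n hn => ?_⟩
  have hn0 : (0 : ℝ) < n := by exact_mod_cast (by omega : 0 < n)
  have hnN : (N : ℝ) ≤ n := by exact_mod_cast (by omega : N ≤ n)
  rw [div_lt_iff₀ (half_pos hε)] at hN
  have hKn : max 0 (max K L) < n * (ε / 2) := hN.trans_le (by gcongr)
  have h1 := hK n
  have h2 := hL n
  simp only [birkhoffSum_neg, Pi.neg_apply, integral_neg] at h2
  have hK' : K < n * (ε / 2) := (le_max_of_le_right (le_max_left _ _)).trans_lt hKn
  have hL' : L < n * (ε / 2) := (le_max_of_le_right (le_max_right _ _)).trans_lt hKn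
  have hmul : (n : ℝ) * (1 / (k + 1)) < n * (ε / 2) := by gcongr
  rw [Real.dist_eq, abs_lt, lt_sub_iff_add_lt, sub_lt_iff_lt_add, lt_div_iff₀ hn0, div_lt_iff₀ hn0]
  constructor <;> nlinarith

end Birkhoff

/-! ### Long-term averages of functions of the channel state and the coins -/

section Averages

variable {Ω : Type*} [MeasurableSpace Ω] {ρ : Measure Ω}

/-- The averages of uncorrelated random variables with bounded second moments tend to `0` along
the squares. -/
lemma ae_tendsto_sum_sq_div_of_uncorrelated {Y : ℕ → Ω → ℝ} (hY : ∀ i, MemLp (Y i) 2 ρ)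
    (horth : ∀ i j, i ≠ j → ∫ ω, Y i ω * Y j ω ∂ρ = 0) {B : ℝ}
    (hB : ∀ i, ∫ ω, Y i ω ^ 2 ∂ρ ≤ B) :
    ∀ᵐ ω ∂ρ, Tendsto (fun n : ℕ => (∑ i ∈ Finset.range (n ^ 2), Y i ω) / ((n ^ 2 : ℕ) : ℝ))
      atTop (𝓝 0) := by
  have hint : ∀ i j, Integrable (fun ω => Y i ω * Y j ω) ρ := fun i j =>
    (hY i).integrable_mul (hY j)
  -- Only the diagonal survives, so the second moment of a sum grows at most linearly.
  have hvar : ∀ N : ℕ, ∫ ω, (∑ i ∈ Finset.range N, Y i ω) ^ 2 ∂ρ ≤ N * B := by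
    intro N
    have h1 : ∀ ω, (∑ i ∈ Finset.range N, Y i ω) ^ 2 =
        ∑ i ∈ Finset.range N, ∑ j ∈ Finset.range N, Y i ω * Y j ω := fun ω => by
      rw [sq, Finset.sum_mul_sum]
    simp_rw [h1]
    rw [integral_finsetSum _ fun i _ => integrable_finsetSum _ fun j _ => hint i j]
    calc _ ≤ ∑ i ∈ Finset.range N, B := Finset.sum_le_sum fun i hi => ?_
      _ = N * B := by simp
    rw [integral_finsetSum _ fun j _ => hint i j, Finset.sum_eq_single i
      (fun j _ hj => horth i j hj.symm) (fun h => absurd hi h)]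
    simpa [sq] using hB i
  set g : ℕ → Ω → ℝ := fun n ω =>
    ((∑ i ∈ Finset.range (n ^ 2), Y i ω) / ((n ^ 2 : ℕ) : ℝ)) ^ 2 with hg
  have hsumLp : ∀ N : ℕ, MemLp (fun ω => ∑ i ∈ Finset.range N, Y i ω) 2 ρ := fun N =>
    memLp_finsetSum _ fun i _ => hY i
  have hgint : ∀ n, Integrable (g n) ρ := fun n => by
    simp only [hg, div_pow]
    exact (hsumLp _).integrable_sq.div_const _
  have hgle : ∀ n, ∫ ω, g n ω ∂ρ ≤ B * (1 / (n : ℝ) ^ 2) := by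
    intro n
    simp only [hg, div_pow]
    rw [integral_div]
    rcases Nat.eq_zero_or_pos n with rfl | hn
    · simp
    have hn' : (0 : ℝ) < n := by exact_mod_cast hn
    refine (div_le_div_of_nonneg_right (hvar _) (by positivity)).trans (le_of_eq ?_)
    push_cast
    field_simp
  -- Along n² the second moments of the averages are at most B / n², which is summable; a series of
  -- nonnegative functions with finite integral has terms tending to zero almost surely.
  have hsum : ∑' n, ∫⁻ ω, ENNReal.ofReal (g n ω) ∂ρ ≠ ⊤ := by
    have hs : Summable fun n : ℕ => B * (1 / (n : ℝ) ^ 2) :=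
      (Real.summable_one_div_nat_pow.2 one_lt_two).mul_left B
    refine ne_top_of_le_ne_top hs.tsum_ofReal_ne_top (ENNReal.tsum_le_tsum fun n => ?_)
    rw [← ofReal_integral_eq_lintegral_ofReal (hgint n) (ae_of_all _ fun ω => sq_nonneg _)]
    exact ENNReal.ofReal_le_ofReal (hgle n)
  have hmeas : ∀ n, AEMeasurable (fun ω => ENNReal.ofReal (g n ω)) ρ := fun n =>
    (hgint n).aestronglyMeasurable.aemeasurable.ennreal_ofReal
  rw [← lintegral_tsum hmeas] at hsum
  filter_upwards [ae_lt_top' (AEMeasurable.tsum hmeas) hsum] with ω hω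
  have h0 := ENNReal.tendsto_atTop_zero_of_tsum_ne_top hω.ne
  have h1 : Tendsto (fun n => g n ω) atTop (𝓝 0) := by
    have := (ENNReal.tendsto_toReal ENNReal.zero_ne_top).comp h0
    refine this.congr fun n => ?_
    simp [ENNReal.toReal_ofReal (sq_nonneg _), hg]
  have h2 := (Real.continuous_sqrt.tendsto 0).comp h1
  rw [Real.sqrt_zero] at h2
  refine (tendsto_zero_iff_abs_tendsto_zero _).2 (h2.congr fun n => ?_)
  simp [hg, Real.sqrt_sq_eq_abs]

/-- Partial sums of nonnegative terms are monotone, and consecutive squares have ratio tending to 1,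
so the averages between two squares are controlled by those at the squares. -/
lemma tendsto_sum_div_of_tendsto_sq {z : ℕ → ℝ} (hz : ∀ i, 0 ≤ z i) {l : ℝ}
    (h : Tendsto (fun n : ℕ => (∑ i ∈ Finset.range (n ^ 2), z i) / ((n ^ 2 : ℕ) : ℝ)) atTop (𝓝 l)) :
    HasMean z l := by
  refine tendsto_div_of_monotone_of_exists_subseq_tendsto_div
    (fun N => ∑ i ∈ Finset.range N, z i) l ?_ fun a ha => ?_
  · exact monotone_nat_of_le_succ fun n => by
      rw [Finset.sum_range_succ]; linarith [hz n]
  refine ⟨fun n => (n + 1) ^ 2, ?_, ?_, h.comp (tendsto_add_atTop_nat 1)⟩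
  · have hlim : Tendsto (fun n : ℕ => (1 + 1 / ((n : ℝ) + 1)) ^ 2) atTop (𝓝 ((1 + 0) ^ 2)) :=
      (tendsto_const_nhds.add tendsto_one_div_add_atTop_nhds_zero_nat).pow 2
    filter_upwards [hlim.eventually (gt_mem_nhds (by simpa using ha))] with n hn
    have hn' : (0 : ℝ) < (n : ℝ) + 1 := by positivity
    push_cast
    calc ((n : ℝ) + 1 + 1) ^ 2 = (1 + 1 / ((n : ℝ) + 1)) ^ 2 * ((n : ℝ) + 1) ^ 2 := by
          field_simp
      _ ≤ a * ((n : ℝ) + 1) ^ 2 := by gcongr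
  · exact (tendsto_pow_atTop two_ne_zero).comp (tendsto_add_atTop_nat 1)

/-! ### Ergodic averages of functions of the channel state -/

variable {S : ℕ → Ω → ℝ × ℝ}

/-- The shift preserves the law of the whole path; iterate it i times and project to coordinate 0.
-/
lemma IsFading.map_eq (hS : IsFading ρ S) (i : ℕ) : ρ.map (S i) = ρ.map (S 0) := by
  have hm : Measurable (fun ω i => S i ω) := measurable_pi_lambda _ hS.measurable
  have h := (hS.ergodic.toMeasurePreserving.iterate i).map_eq
  have hit : ∀ i, (fun (x : ℕ → ℝ × ℝ) j => x (j + 1))^[i] = fun x j => x (j + i) := by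
    intro i
    induction i with
    | zero => rfl
    | succ n ih => rw [Function.iterate_succ, ih]; funext x j; simp [Nat.add_assoc]
  rw [hit i, Measure.map_map (by fun_prop) hm] at h
  have h2 := congrArg (Measure.map fun x : ℕ → ℝ × ℝ => x 0) h
  have hm' : Measurable ((fun (x : ℕ → ℝ × ℝ) j => x (j + i)) ∘ fun ω i => S i ω) :=
    measurable_pi_lambda _ fun j => hS.measurable (j + i)
  rw [Measure.map_map (by fun_prop) hm', Measure.map_map (by fun_prop) hm] at h2
  simpa [Function.comp_def] using h2

lemma IsFading.ae_of_ae_law (hS : IsFading ρ S) {p : ℝ × ℝ → Prop}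
    (h : ∀ᵐ s ∂(ρ.map (S 0)), p s) : ∀ᵐ ω ∂ρ, ∀ i, p (S i ω) :=
  ae_all_iff.2 fun i => ae_of_ae_map (hS.measurable i).aemeasurable (hS.map_eq i ▸ h)

/-- Birkhoff's theorem on path space, applied to f of the zeroth coordinate. -/
lemma IsFading.ae_hasMean [IsProbabilityMeasure ρ] (hS : IsFading ρ S) {f : ℝ × ℝ → ℝ}
    (hfm : Measurable f) (hf : Integrable f (ρ.map (S 0))) :
    ∀ᵐ ω ∂ρ, HasMean (fun i => f (S i ω)) (∫ s, f s ∂(ρ.map (S 0))) := by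
  have hm : Measurable (fun ω i => S i ω) := measurable_pi_lambda _ hS.measurable
  have : IsProbabilityMeasure (ρ.map fun ω i => S i ω) :=
    Measure.isProbabilityMeasure_map hm.aemeasurable
  have hmap : (ρ.map fun ω i => S i ω).map (fun x : ℕ → ℝ × ℝ => x 0) = ρ.map (S 0) := by
    rw [Measure.map_map (by fun_prop) hm]; rfl
  have h0 : Measurable fun x : ℕ → ℝ × ℝ => x 0 := by fun_prop
  rw [← hmap] at hf ⊢
  have hB := ae_tendsto_birkhoffSum_div hS.ergodic (hfm.comp h0)
    ((integrable_map_measure hfm.aestronglyMeasurable h0.aemeasurable).1 hf)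
  filter_upwards [ae_of_ae_map hm.aemeasurable hB] with ω hω
  rw [integral_map h0.aemeasurable hfm.aestronglyMeasurable]
  have hit : ∀ i, (fun (x : ℕ → ℝ × ℝ) j => x (j + 1))^[i] = fun x j => x (j + i) := by
    intro i
    induction i with
    | zero => rfl
    | succ n ih => rw [Function.iterate_succ, ih]; funext x j; simp [Nat.add_assoc]
  simpa [birkhoffSum, hit, HasMean] using hω

/-! ### Coin flips and coin-weighted averages -/

instance : Fintype Coin :=
  ⟨{.X1, .X2, .X3, .X4, .X5}, fun x => by cases x <;> decide⟩

variable {p : Coin → ℝ} {X : Coin → ℕ → Ω → ℝ}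

lemma IsCoinFlips.ae_zero_or_one [IsProbabilityMeasure ρ] (hX : IsCoinFlips ρ S p X) :
    ∀ᵐ ω ∂ρ, ∀ i n, X n i ω = 0 ∨ X n i ω = 1 := by
  refine ae_all_iff.2 fun i => ae_all_iff.2 fun n => ?_
  have hm0 : MeasurableSet {ω | X n i ω = 0} := hX.measurable n i (measurableSet_singleton 0)
  have hm1 : MeasurableSet {ω | X n i ω = 1} := hX.measurable n i (measurableSet_singleton 1)
  have hd : Disjoint {ω | X n i ω = 0} {ω | X n i ω = 1} :=
    Set.disjoint_left.2 fun ω (h : X n i ω = 0) (h' : X n i ω = 1) => by simp [h] at h'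
  have hu := measure_union (μ := ρ) hd hm1
  rw [hX.prob_zero, hX.prob_one] at hu
  -- Nothing is assumed about `p n`; subadditivity of `ENNReal.ofReal` gives total mass at least 1
  -- in any case.
  have h1 : (1 : ENNReal) ≤ ρ ({ω | X n i ω = 0} ∪ {ω | X n i ω = 1}) := by
    rw [hu, ← ENNReal.ofReal_one]
    refine le_trans (ENNReal.ofReal_le_ofReal ?_) (ENNReal.ofReal_add_le (p := 1 - p n) (q := p n))
    linarith
  exact (mem_ae_iff_prob_eq_one (hm0.union hm1)).2 (le_antisymm prob_le_one h1)

/-- The law of a coin does not depend on the slot. -/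
lemma IsCoinFlips.map_eq [IsProbabilityMeasure ρ] (hX : IsCoinFlips ρ S p X) (n : Coin) (i : ℕ) :
    ρ.map (X n i) = ρ.map (X n 0) := by
  have key : ∀ i, ρ.map (X n i) = ENNReal.ofReal (p n) • Measure.dirac 1
      + ENNReal.ofReal (1 - p n) • Measure.dirac 0 := by
    intro i
    ext A hA
    rw [Measure.map_apply (hX.measurable n i) hA]
    have hm0 : MeasurableSet {ω | X n i ω = 0} := hX.measurable n i (measurableSet_singleton 0)
    have hd : Disjoint ({ω | X n i ω = 1 ∧ (1 : ℝ) ∈ A}) {ω | X n i ω = 0 ∧ (0 : ℝ) ∈ A} :=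
      Set.disjoint_left.2 fun ω h h' => by simp [h.1] at h'
    have he : X n i ⁻¹' A =ᵐ[ρ]
        ({ω | X n i ω = 1 ∧ (1 : ℝ) ∈ A} ∪ {ω | X n i ω = 0 ∧ (0 : ℝ) ∈ A} : Set Ω) := by
      filter_upwards [hX.ae_zero_or_one] with ω hω
      refine propext ?_
      change X n i ω ∈ A ↔ (X n i ω = 1 ∧ (1 : ℝ) ∈ A) ∨ (X n i ω = 0 ∧ (0 : ℝ) ∈ A)
      rcases hω i n with h | h <;> simp [h]
    rw [measure_congr he, measure_union hd (by by_cases h : (0 : ℝ) ∈ A <;> simp [h, hm0])]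
    simp only [Measure.add_apply, Measure.smul_apply, Measure.dirac_apply' _ hA, smul_eq_mul]
    by_cases h0 : (0 : ℝ) ∈ A <;> by_cases h1 : (1 : ℝ) ∈ A <;>
      simp [h0, h1, hX.prob_zero, hX.prob_one]
  rw [key i, key 0]

lemma IsCoinFlips.map_slot_eq [IsProbabilityMeasure ρ] (hX : IsCoinFlips ρ S p X) (i : ℕ) :
    ρ.map (fun ω n => X n i ω) = ρ.map (fun ω n => X n 0 ω) := by
  have h : ∀ i, ρ.map (fun ω n => X n i ω) = Measure.pi fun n => ρ.map (X n i) := fun i =>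
    (hX.indep.precomp (g := fun n : Coin => (n, i))
      fun a b hab => congrArg Prod.fst hab).map_fun_eq_pi_map
      fun n => (hX.measurable n i).aemeasurable
  rw [h i, h 0]
  simp_rw [hX.map_eq _ i]

lemma IsCoinFlips.indepFun_slot (hX : IsCoinFlips ρ S p X) {i j : ℕ} (hij : i ≠ j) :
    IndepFun (fun ω n => X n i ω) (fun ω n => X n j ω) ρ := by
  have h := hX.indep.indepFun_finset (Finset.univ ×ˢ {i}) (Finset.univ ×ˢ {j})
    (by
      rw [Finset.disjoint_left]
      rintro ⟨n, k⟩ hk hk'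
      simp only [Finset.mem_product, Finset.mem_univ, Finset.mem_singleton, true_and] at hk hk'
      exact hij (hk.symm.trans hk')) fun k => hX.measurable k.1 k.2
  have hm : ∀ i : ℕ, Measurable fun (x : ((Finset.univ ×ˢ {i} : Finset (Coin × ℕ)) : Type) → ℝ)
      (n : Coin) => x ⟨(n, i), by simp⟩ := fun i => by fun_prop
  exact h.comp (hm i) (hm j)

/-- The strong law for a weight that depends on the coins times a function of the channel state. -/
lemma IsCoinFlips.ae_hasMean_mul [IsProbabilityMeasure ρ] (hS : IsFading ρ S)
    (hX : IsCoinFlips ρ S p X) {w : (Coin → ℝ) → ℝ} (hw : Measurable w)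
    (hw01 : ∀ x : Coin → ℝ, (∀ n, x n = 0 ∨ x n = 1) → w x ∈ Set.Icc (0 : ℝ) 1)
    {f : ℝ × ℝ → ℝ} (hfm : Measurable f) (hf0 : ∀ᵐ s ∂(ρ.map (S 0)), 0 ≤ f s)
    (hf2 : MemLp f 2 (ρ.map (S 0))) :
    ∀ᵐ ω ∂ρ, HasMean (fun i => w (fun n => X n i ω) * f (S i ω))
      ((∫ ω, w (fun n => X n 0 ω) ∂ρ) * ∫ s, f s ∂(ρ.map (S 0))) := by
  have hprob : IsProbabilityMeasure (ρ.map (S 0)) :=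
    Measure.isProbabilityMeasure_map (hS.measurable 0).aemeasurable
  have hXm : ∀ i, Measurable fun ω n => X n i ω := fun i =>
    measurable_pi_lambda _ fun n => hX.measurable n i
  have hWm : ∀ i, Measurable fun ω => w (fun n => X n i ω) := fun i => hw.comp (hXm i)
  have hWb : ∀ i, ∀ᵐ ω ∂ρ, w (fun n => X n i ω) ∈ Set.Icc (0 : ℝ) 1 := fun i => by
    filter_upwards [hX.ae_zero_or_one] with ω hω using hw01 _ (hω i)
  have hWi : ∀ i, Integrable (fun ω => w (fun n => X n i ω)) ρ := fun i =>
    Integrable.of_mem_Icc 0 1 (hWm i).aemeasurable (hWb i)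
  set c := ∫ ω, w (fun n => X n 0 ω) ∂ρ with hc
  have hWc : ∀ i, ∫ ω, w (fun n => X n i ω) ∂ρ = c := fun i => by
    rw [hc, ← integral_map (hXm i).aemeasurable hw.aestronglyMeasurable, hX.map_slot_eq i,
      integral_map (hXm 0).aemeasurable hw.aestronglyMeasurable]
  have hc01 : c ∈ Set.Icc (0 : ℝ) 1 := by
    constructor
    · exact integral_nonneg_of_ae ((hWb 0).mono fun ω h => h.1)
    · have := integral_mono_ae (hWi 0) (integrable_const 1) ((hWb 0).mono fun ω h => h.2)
      simpa using this
  have hfS : ∀ i, MemLp (fun ω => f (S i ω)) 2 ρ := fun i =>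
    (memLp_map_measure_iff hfm.aestronglyMeasurable (hS.measurable i).aemeasurable).1
      ((hS.map_eq i).symm ▸ hf2)
  set Y : ℕ → Ω → ℝ := fun i ω => (w (fun n => X n i ω) - c) * f (S i ω) with hYdef
  have hYabs : ∀ i, ∀ᵐ ω ∂ρ, |w (fun n => X n i ω) - c| ≤ 1 := fun i => by
    filter_upwards [hWb i] with ω hω
    rw [abs_le]; constructor <;> linarith [hω.1, hω.2, hc01.1, hc01.2]
  have hY : ∀ i, MemLp (Y i) 2 ρ := fun i => by
    refine (hfS i).mono (((hWm i).sub_const c).mul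
      (hfm.comp (hS.measurable i))).aestronglyMeasurable ?_
    filter_upwards [hYabs i] with ω hω
    rw [hYdef, norm_mul, Real.norm_eq_abs]
    exact mul_le_of_le_one_left (norm_nonneg _) hω
  have hSm : Measurable fun ω i => S i ω := measurable_pi_lambda _ hS.measurable
  have hCm : Measurable fun ω (k : Coin × ℕ) => X k.1 k.2 ω :=
    measurable_pi_lambda _ fun k => hX.measurable _ _
  -- Channel states of different slots may be dependent. It suffices that the coins are independent
  -- of the channel and between slots: the product of the two centred weights factors out and has
  -- mean zero.
  have horth : ∀ i j, i ≠ j → ∫ ω, Y i ω * Y j ω ∂ρ = 0 := by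
    intro i j hij
    have hind := hX.indep_channel.integral_fun_comp_mul_comp hCm.aemeasurable hSm.aemeasurable
      (f := fun x => (w (fun n => x (n, i)) - c) * (w (fun n => x (n, j)) - c))
      (g := fun s => f (s i) * f (s j))
      (by fun_prop) (by fun_prop)
    have hzero := (hX.indepFun_slot hij).integral_fun_comp_mul_comp (hXm i).aemeasurable
      (hXm j).aemeasurable (f := fun x => w x - c) (g := fun x => w x - c)
      (hw.sub_const c).aestronglyMeasurable (hw.sub_const c).aestronglyMeasurable
    have h0 : ∫ ω, (w (fun n => X n i ω) - c) ∂ρ = 0 := by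
      rw [integral_sub (hWi i) (integrable_const c), hWc i]; simp
    rw [h0, zero_mul] at hzero
    rw [hzero, zero_mul] at hind
    rw [← hind]
    exact integral_congr_ae (ae_of_all _ fun ω => by simp only [hYdef]; ring)
  have hB : ∀ i, ∫ ω, Y i ω ^ 2 ∂ρ ≤ ∫ s, f s ^ 2 ∂(ρ.map (S 0)) := by
    intro i
    rw [← hS.map_eq i, integral_map (hS.measurable i).aemeasurable
      (hfm.pow_const 2).aestronglyMeasurable]
    refine integral_mono_ae (hY i).integrable_sq (hfS i).integrable_sq ?_
    filter_upwards [hYabs i] with ω hω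
    simp only [hYdef, mul_pow]
    exact mul_le_of_le_one_left (sq_nonneg _) ((sq_le_one_iff_abs_le_one _).2 hω)
  filter_upwards [ae_tendsto_sum_sq_div_of_uncorrelated hY horth hB,
    hS.ae_hasMean hfm (hf2.integrable one_le_two), hS.ae_of_ae_law hf0, hX.ae_zero_or_one]
    with ω h1 h2 h3 h4
  refine tendsto_sum_div_of_tendsto_sq
    (fun i => mul_nonneg (hw01 _ (h4 i)).1 (h3 i)) ?_
  -- The weighted sum splits into the centred part, which averages to zero along squares, and c
  -- times the channel average. Nonnegativity then permits the passage from squares to all N.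
  have h5 := h1.add ((h2.comp (tendsto_pow_atTop two_ne_zero)).const_mul c)
  rw [zero_add] at h5
  refine h5.congr fun n => ?_
  simp only [hYdef, Function.comp_apply, ← mul_div_assoc, ← add_div, Finset.mul_sum,
    ← Finset.sum_add_distrib]
  congr 1
  exact Finset.sum_congr rfl fun i _ => by ring

end Averages

/-! ### Capacities -/

lemma cap_lt_cap {x y : ℝ} (hx : 0 ≤ x) (hxy : x < y) : cap x < cap y :=
  Real.logb_lt_logb one_lt_two (by linarith) (by linarith)

lemma cap_le_cap {x y : ℝ} (hx : 0 ≤ x) (hxy : x ≤ y) : cap x ≤ cap y :=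
  Real.logb_le_logb_of_le one_lt_two (by linarith) (by linarith)

lemma cap_nonneg {x : ℝ} (hx : 0 ≤ x) : 0 ≤ cap x :=
  Real.logb_nonneg one_lt_two (by linarith)

lemma cap_pos {x : ℝ} (hx : 0 < x) : 0 < cap x :=
  Real.logb_pos one_lt_two (by linarith)

lemma cap_div {x y : ℝ} (hx : 0 ≤ x) (hy : 0 ≤ y) : cap (x / (1 + y)) = cap (x + y) - cap y := by
  have hy' : (1 + y) ≠ 0 := by positivity
  rw [cap, cap, cap, ← Real.logb_div (by positivity) hy']
  congr 1
  field_simp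
  ring

lemma cap_add_lt {x y : ℝ} (hx : 0 < x) (hy : 0 < y) : cap (x + y) < cap x + cap y := by
  rw [cap, cap, cap, ← Real.logb_mul (by positivity) (by positivity)]
  exact Real.logb_lt_logb one_lt_two (by positivity) (by nlinarith [mul_pos hx hy])

lemma cap_add_le {x y : ℝ} (hx : 0 ≤ x) (hy : 0 ≤ y) : cap (x + y) ≤ cap x + cap y := by
  rw [cap, cap, cap, ← Real.logb_mul (by positivity) (by positivity)]
  exact Real.logb_le_logb_of_le one_lt_two (by positivity) (by nlinarith [mul_nonneg hx hy])

section

variable {P : Powers} {s : ℝ × ℝ}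

lemma C1r_nonneg (h : 0 ≤ s.1) : 0 ≤ C1r P s := cap_nonneg (mul_nonneg P.P₁_pos.le h)
lemma C2r_nonneg (h : 0 ≤ s.2) : 0 ≤ C2r P s := cap_nonneg (mul_nonneg P.P₂_pos.le h)
lemma Cr1_nonneg (h : 0 ≤ s.1) : 0 ≤ Cr1 P s := cap_nonneg (mul_nonneg P.Pr_pos.le h)
lemma Cr2_nonneg (h : 0 ≤ s.2) : 0 ≤ Cr2 P s := cap_nonneg (mul_nonneg P.Pr_pos.le h)
lemma C1r_pos (h : 0 < s.1) : 0 < C1r P s := cap_pos (mul_pos P.P₁_pos h)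
lemma C2r_pos (h : 0 < s.2) : 0 < C2r P s := cap_pos (mul_pos P.P₂_pos h)
lemma Cr1_pos (h : 0 < s.1) : 0 < Cr1 P s := cap_pos (mul_pos P.Pr_pos h)
lemma Cr2_pos (h : 0 < s.2) : 0 < Cr2 P s := cap_pos (mul_pos P.Pr_pos h)

lemma C1r_le_Cr (h1 : 0 ≤ s.1) (h2 : 0 ≤ s.2) : C1r P s ≤ Cr P s :=
  cap_le_cap (mul_nonneg P.P₁_pos.le h1) (by linarith [mul_nonneg P.P₂_pos.le h2])

lemma C2r_le_Cr (h1 : 0 ≤ s.1) (h2 : 0 ≤ s.2) : C2r P s ≤ Cr P s :=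
  cap_le_cap (mul_nonneg P.P₂_pos.le h2) (by linarith [mul_nonneg P.P₁_pos.le h1])

lemma C2r_lt_Cr (h1 : 0 < s.1) (h2 : 0 < s.2) : C2r P s < Cr P s :=
  cap_lt_cap (mul_pos P.P₂_pos h2).le (by linarith [mul_pos P.P₁_pos h1])

lemma Cr_lt_add (h1 : 0 < s.1) (h2 : 0 < s.2) : Cr P s < C1r P s + C2r P s :=
  cap_add_lt (mul_pos P.P₁_pos h1) (mul_pos P.P₂_pos h2)

lemma Cr_le_add (h1 : 0 ≤ s.1) (h2 : 0 ≤ s.2) : Cr P s ≤ C1r P s + C2r P s :=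
  cap_add_le (mul_nonneg P.P₁_pos.le h1) (mul_nonneg P.P₂_pos.le h2)

/-- Successive decoding: `cap (x / (1 + y)) = cap (x + y) - cap y`. The multiple-access rates become
affine in t, with a sum `Cr` that does not depend on t. -/
lemma C12r_eq (t : ℝ) (h1 : 0 ≤ s.1) (h2 : 0 ≤ s.2) :
    C12r P t s = t * C1r P s + (1 - t) * (Cr P s - C2r P s) := by
  rw [C12r, cap_div (mul_nonneg P.P₁_pos.le h1) (mul_nonneg P.P₂_pos.le h2)]; rfl

lemma C21r_eq (t : ℝ) (h1 : 0 ≤ s.1) (h2 : 0 ≤ s.2) :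
    C21r P t s = (1 - t) * C2r P s + t * (Cr P s - C1r P s) := by
  rw [C21r, cap_div (mul_nonneg P.P₂_pos.le h2) (mul_nonneg P.P₁_pos.le h1), add_comm (P.P₂ * s.2)]
  rfl

lemma C12r_nonneg {t : ℝ} (ht : t ∈ Set.Icc (0 : ℝ) 1) (h1 : 0 ≤ s.1) (h2 : 0 ≤ s.2) :
    0 ≤ C12r P t s := by
  rw [C12r_eq t h1 h2]
  exact add_nonneg (mul_nonneg ht.1 (C1r_nonneg h1))
    (mul_nonneg (sub_nonneg.2 ht.2) (sub_nonneg.2 (C2r_le_Cr h1 h2)))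

lemma C21r_nonneg {t : ℝ} (ht : t ∈ Set.Icc (0 : ℝ) 1) (h1 : 0 ≤ s.1) (h2 : 0 ≤ s.2) :
    0 ≤ C21r P t s := by
  rw [C21r_eq t h1 h2]
  exact add_nonneg (mul_nonneg (sub_nonneg.2 ht.2) (C2r_nonneg h2))
    (mul_nonneg ht.1 (sub_nonneg.2 (C1r_le_Cr h1 h2)))

end

/-! ### Optimality along a realization -/

lemma sum_mode (f : Mode → ℝ) :
    ∑ k, f k = f .M1 + f .M2 + f .M3 + f .M4 + f .M5 + f .M6 := by
  have h : (Finset.univ : Finset Mode) = {.M1, .M2, .M3, .M4, .M5, .M6} := rfl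
  rw [h]
  simp [add_assoc]

lemma HasMean.add {f g : ℕ → ℝ} {a b : ℝ} (hf : HasMean f a) (hg : HasMean g b) :
    HasMean (fun i => f i + g i) (a + b) := by
  simpa [HasMean, Finset.sum_add_distrib, add_div] using Tendsto.add hf hg

lemma HasMean.const_mul {f : ℕ → ℝ} {a : ℝ} (hf : HasMean f a) (c : ℝ) :
    HasMean (fun i => c * f i) (c * a) := by
  simpa [HasMean, ← Finset.mul_sum, mul_div_assoc] using Tendsto.const_mul c hf

lemma HasMean.le_of_sum_le {f g : ℕ → ℝ} {a b K : ℝ} (hf : HasMean f a) (hg : HasMean g b)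
    (h : ∀ N, ∑ i ∈ Finset.range N, f i ≤ K + ∑ i ∈ Finset.range N, g i) : a ≤ b := by
  have hK : Tendsto (fun N : ℕ => K / (N : ℝ)) atTop (𝓝 0) :=
    tendsto_const_nhds.div_atTop tendsto_natCast_atTop_atTop
  have h2 := hK.add hg
  rw [zero_add] at h2
  refine le_of_tendsto_of_tendsto' hf h2 fun N => ?_
  rw [← add_div]
  exact div_le_div_of_nonneg_right (h N) (Nat.cast_nonneg N)

/-- A queue with arrivals `a` and services `c` of the same average is `o(N)`. -/
lemma hasMean_departures {a c o Q : ℕ → ℝ} {R : ℝ} (ha : HasMean a R) (hc : HasMean c R)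
    (hQ : ∀ i, 0 ≤ Q i) (hstep : ∀ i, Q (i + 1) = Q i + a i - o i)
    (hmax : ∀ i, Q (i + 1) ≤ max (Q i + a i - c i) 0) : HasMean o R := by
  have hD : HasMean (fun i => a i - c i) 0 := by
    have := ha.add (hc.const_mul (-1))
    simpa [sub_eq_add_neg] using this
  have hQlim : Tendsto (fun N : ℕ => Q N / (N : ℝ)) atTop (𝓝 0) := by
    have hbound : ∀ ε > 0, ∃ K, ∀ n, Q n ≤ K + 2 * ε * n := by
      intro ε hε
      obtain ⟨N₀, hN₀⟩ := Metric.tendsto_atTop.1 hD ε hε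
      set D : ℕ → ℝ := fun n => ∑ i ∈ Finset.range n, (a i - c i) with hDdef
      -- K absorbs the finitely many initial partial sums, so that |D n| ≤ K + ε n holds for every
      -- n.
      set K := ∑ i ∈ Finset.range N₀, |D i| with hK
      have hK0 : 0 ≤ K := Finset.sum_nonneg fun i _ => abs_nonneg _
      have hDK : ∀ n, |D n| ≤ K + ε * n := by
        intro n
        rcases lt_or_ge n N₀ with h | h
        · have h1 := Finset.single_le_sum (f := fun i => |D i|) (fun i _ => abs_nonneg _)
            (Finset.mem_range.2 h)
          have h2 : 0 ≤ ε * n := by positivity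
          linarith
        · rcases Nat.eq_zero_or_pos n with rfl | hn
          · simp [hDdef, hK0]
          · have hn' : (0 : ℝ) < n := by exact_mod_cast hn
            have h1 := hN₀ n h
            rw [dist_zero_right, norm_div, Real.norm_natCast, div_lt_iff₀ hn', Real.norm_eq_abs] at h1
            linarith
      refine ⟨Q 0 + 2 * K, fun n => ?_⟩
      -- Either the queue changes by at most the increment of D, or it is empty; in the latter case
      -- the right-hand side is nonnegative by the lower bound on D.
      have hind : ∀ n, Q n ≤ Q 0 + D n + K + ε * n := by
        intro n
        induction n with
        | zero => simp [hDdef, hK0]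
        | succ n ih =>
          have h1 : D (n + 1) = D n + (a n - c n) := Finset.sum_range_succ _ _
          have h2 := (abs_le.1 (hDK (n + 1))).1
          refine (hmax n).trans (max_le ?_ ?_)
          · push_cast; linarith
          · linarith [hQ 0]
      have := (abs_le.1 (hDK n)).2
      linarith [hind n]
    rw [Metric.tendsto_atTop]
    intro ε hε
    obtain ⟨K, hK⟩ := hbound (ε / 4) (by positivity)
    obtain ⟨N, hN⟩ := exists_nat_gt (|K| / (ε / 2))
    refine ⟨N + 1, fun n hn => ?_⟩
    have hn0 : (0 : ℝ) < n := by exact_mod_cast (by omega : 0 < n)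
    have hnN : (N : ℝ) ≤ n := by exact_mod_cast (by omega : N ≤ n)
    rw [div_lt_iff₀ (by positivity)] at hN
    rw [dist_zero_right, Real.norm_of_nonneg (div_nonneg (hQ n) hn0.le), div_lt_iff₀ hn0]
    nlinarith [hK n, le_abs_self K]
  have hsum : ∀ N, ∑ i ∈ Finset.range N, o i = Q 0 + ∑ i ∈ Finset.range N, a i - Q N := by
    intro N
    induction N with
    | zero => simp
    | succ n ih => rw [Finset.sum_range_succ, Finset.sum_range_succ, ih, hstep n]; ring
  have h0 : Tendsto (fun N : ℕ => Q 0 / (N : ℝ)) atTop (𝓝 0) :=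
    tendsto_const_nhds.div_atTop tendsto_natCast_atTop_atTop
  have h := (h0.add ha).sub hQlim
  simp only [zero_add, sub_zero] at h
  refine h.congr fun N => ?_
  rw [hsum, sub_div, add_div]

lemma Admissible.exists_eq_pick {q : ℕ → Mode → ℝ} {t : ℕ → ℝ} (h : Admissible q t) (i : ℕ) :
    ∃ m, q i = pick m := by
  obtain ⟨hsum, hbin, -⟩ := h i
  have h01 : ∀ k, q i k = 0 ∨ q i k = 1 := fun k =>
    (mul_eq_zero.1 (hbin k)).imp_right fun h => by linarith
  have hex : ∃ m, q i m = 1 := by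
    by_contra hne
    push Not at hne
    have h0 : ∀ k, q i k = 0 := fun k => (h01 k).resolve_right (hne k)
    simp [h0] at hsum
  obtain ⟨m, hm⟩ := hex
  refine ⟨m, funext fun k => ?_⟩
  by_cases hk : k = m
  · subst hk; simp [pick, hm]
  · have h1 : q i m + q i k ≤ ∑ k, q i k := by
      rw [← Finset.sum_pair (Ne.symm hk)]
      exact Finset.sum_le_sum_of_subset_of_nonneg (Finset.subset_univ _) fun j _ _ => by
        rcases h01 j with h | h <;> simp [h]
    rcases h01 k with h | h
    · simp [pick, hk, h]
    · rw [hsum] at h1; linarith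

lemma admissible_pick (m : ℕ → Mode) {t : ℝ} (ht : t ∈ Set.Icc (0 : ℝ) 1) :
    Admissible (fun i => pick (m i)) (fun _ => t) := by
  refine fun i => ⟨by simp [pick], fun k => ?_, ht⟩
  by_cases h : k = m i <;> simp [pick, h]

lemma Admissible.relaxed {q : ℕ → Mode → ℝ} {t : ℕ → ℝ} (h : Admissible q t) :
    RelaxedAdmissible q t := by
  refine fun i => ⟨(h i).1, fun k => ?_, (h i).2.2⟩
  obtain ⟨m, hm⟩ := h.exists_eq_pick i
  by_cases hk : k = m <;> simp [hm, pick, hk]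

/-! ### Queues and the Lagrangian bound along one realization -/

section Realization

variable {P : Powers} {s : ℕ → ℝ × ℝ} {q : ℕ → Mode → ℝ} {t : ℕ → ℝ} {b : ℝ}

lemma in₁_nonneg (hs : ∀ i, 0 ≤ (s i).1 ∧ 0 ≤ (s i).2) (h : RelaxedAdmissible q t) (i : ℕ) :
    0 ≤ in₁ P s q t i :=
  add_nonneg (mul_nonneg ((h i).2.1 _).1 (C1r_nonneg (hs i).1))
    (mul_nonneg ((h i).2.1 _).1 (C12r_nonneg (h i).2.2 (hs i).1 (hs i).2))

lemma in₂_nonneg (hs : ∀ i, 0 ≤ (s i).1 ∧ 0 ≤ (s i).2) (h : RelaxedAdmissible q t) (i : ℕ) :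
    0 ≤ in₂ P s q t i :=
  add_nonneg (mul_nonneg ((h i).2.1 _).1 (C2r_nonneg (hs i).2))
    (mul_nonneg ((h i).2.1 _).1 (C21r_nonneg (h i).2.2 (hs i).1 (hs i).2))

lemma sub_mul_min_nonneg {x c w : ℝ} (hw : w ∈ Set.Icc (0 : ℝ) 1) (hx : 0 ≤ x) :
    0 ≤ x - w * min c x := by
  have h1 : w * min c x ≤ w * x := mul_le_mul_of_nonneg_left (min_le_right _ _) hw.1
  nlinarith [hw.1, hw.2]

lemma RelaxedAdmissible.add_mem (h : RelaxedAdmissible q t) (i : ℕ) :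
    q i .M5 + q i .M6 ∈ Set.Icc (0 : ℝ) 1 ∧ q i .M4 + q i .M6 ∈ Set.Icc (0 : ℝ) 1 := by
  have hsum := (h i).1
  have h0 := fun k => ((h i).2.1 k).1
  rw [sum_mode] at hsum
  refine ⟨⟨add_nonneg (h0 _) (h0 _), ?_⟩, ⟨add_nonneg (h0 _) (h0 _), ?_⟩⟩ <;>
    linarith [h0 .M1, h0 .M2, h0 .M3, h0 .M4, h0 .M5, h0 .M6]

lemma queue₁_nonneg (hs : ∀ i, 0 ≤ (s i).1 ∧ 0 ≤ (s i).2) (h : RelaxedAdmissible q t) (hb : 0 ≤ b)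
    (i : ℕ) : 0 ≤ queue₁ P s q t b i := by
  induction i with
  | zero => exact hb
  | succ i ih =>
    simp only [queue₁]
    linarith [sub_mul_min_nonneg (c := Cr2 P (s i)) (h.add_mem i).1 ih, in₁_nonneg (P := P) hs h i]

lemma queue₂_nonneg (hs : ∀ i, 0 ≤ (s i).1 ∧ 0 ≤ (s i).2) (h : RelaxedAdmissible q t) (hb : 0 ≤ b)
    (i : ℕ) : 0 ≤ queue₂ P s q t b i := by
  induction i with
  | zero => exact hb
  | succ i ih =>
    simp only [queue₂]
    linarith [sub_mul_min_nonneg (c := Cr1 P (s i)) (h.add_mem i).2 ih, in₂_nonneg (P := P) hs h i]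

/-- The queue recursion telescopes: departures are initial content plus arrivals minus the final
content, which is nonnegative. -/
lemma sum_out₂_le (hs : ∀ i, 0 ≤ (s i).1 ∧ 0 ≤ (s i).2) (h : RelaxedAdmissible q t) (hb : 0 ≤ b)
    (N : ℕ) : ∑ i ∈ Finset.range N, out₂ P s q t b i ≤ b + ∑ i ∈ Finset.range N, in₁ P s q t i := by
  have hsum : ∑ i ∈ Finset.range N, out₂ P s q t b i =
      b + ∑ i ∈ Finset.range N, in₁ P s q t i - queue₁ P s q t b N := by
    induction N with
    | zero => simp [queue₁]
    | succ n ih =>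
      rw [Finset.sum_range_succ, Finset.sum_range_succ, ih, queue₁, out₂]; ring
  linarith [queue₁_nonneg (P := P) hs h hb N]

lemma sum_out₁_le (hs : ∀ i, 0 ≤ (s i).1 ∧ 0 ≤ (s i).2) (h : RelaxedAdmissible q t) (hb : 0 ≤ b)
    (N : ℕ) : ∑ i ∈ Finset.range N, out₁ P s q t b i ≤ b + ∑ i ∈ Finset.range N, in₂ P s q t i := by
  have hsum : ∑ i ∈ Finset.range N, out₁ P s q t b i =
      b + ∑ i ∈ Finset.range N, in₂ P s q t i - queue₂ P s q t b N := by
    induction N with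
    | zero => simp [queue₂]
    | succ n ih =>
      rw [Finset.sum_range_succ, Finset.sum_range_succ, ih, queue₂, out₁]; ring
  linarith [queue₂_nonneg (P := P) hs h hb N]

/-- This identifies the metrics as the per-slot Lagrangian of the balanced problem, with relay
output counted as offered capacity. -/
lemma sum_mul_metric (μ₁ μ₂ : ℝ) (i : ℕ) :
    ∑ k, q i k * metric P μ₁ μ₂ (t i) (s i) k = (1 - μ₁) * in₁ P s q t i
      + (1 - μ₂) * in₂ P s q t i + μ₁ * cout₂ P s q i + μ₂ * cout₁ P s q i := by
  rw [sum_mode]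
  simp only [metric, modeVec, in₁, in₂, cout₁, cout₂]
  ring

/-- A policy with balanced average rates that maximizes the Lagrangian in every slot is optimal. -/
theorem isOptimal_of_balanced (hs : ∀ i, 0 ≤ (s i).1 ∧ 0 ≤ (s i).2) {b₁ b₂ : ℝ} (hb₁ : 0 ≤ b₁)
    (hb₂ : 0 ≤ b₂) (h : Admissible q t) {μ₁ μ₂ R₁ R₂ : ℝ} (hμ₁ : μ₁ ∈ Set.Icc (0 : ℝ) 1)
    (hμ₂ : μ₂ ∈ Set.Icc (0 : ℝ) 1) (hin₁ : HasMean (in₁ P s q t) R₁)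
    (hin₂ : HasMean (in₂ P s q t) R₂) (hout₂ : HasMean (cout₂ P s q) R₁)
    (hout₁ : HasMean (cout₁ P s q) R₂)
    (hmax : ∀ i k, ∀ t' ∈ Set.Icc (0 : ℝ) 1, metric P μ₁ μ₂ t' (s i) k
      ≤ ∑ k', q i k' * metric P μ₁ μ₂ (t i) (s i) k') :
    IsOptimal P s b₁ b₂ q t R₁ R₂ := by
  set G : ℕ → ℝ := fun i => ∑ k', q i k' * metric P μ₁ μ₂ (t i) (s i) k' with hG
  have hGmean : HasMean G (R₁ + R₂) := by
    have h1 := (((hin₁.const_mul (1 - μ₁)).add (hin₂.const_mul (1 - μ₂))).add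
      (hout₂.const_mul μ₁)).add (hout₁.const_mul μ₂)
    simp only [hG, sum_mul_metric]
    convert! h1 using 1
    ring
  -- The Lagrangian is linear in the selection variables, so its maximum over the simplex is
  -- attained at a single mode; hence relaxation gains nothing.
  have hdual : ∀ q' t', RelaxedAdmissible q' t' → ∀ i, (1 - μ₁) * in₁ P s q' t' i
      + (1 - μ₂) * in₂ P s q' t' i + μ₁ * cout₂ P s q' i + μ₂ * cout₁ P s q' i ≤ G i := by
    intro q' t' h' i
    rw [← sum_mul_metric]
    calc ∑ k, q' i k * metric P μ₁ μ₂ (t' i) (s i) k ≤ ∑ k, q' i k * G i :=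
          Finset.sum_le_sum fun k _ =>
            mul_le_mul_of_nonneg_left (hmax i k _ (h' i).2.2) ((h' i).2.1 k).1
      _ = G i := by rw [← Finset.sum_mul, (h' i).1, one_mul]
  refine ⟨h, hin₁, hin₂, ?_, ?_, hout₂, hout₁, ?_, ?_⟩
  -- In each slot a buffer is either fed or served, never both, so its content satisfies the
  -- reflected recursion max (Q + a - c) 0.
  · refine hasMean_departures hin₁ hout₂ (queue₁_nonneg (P := P) hs h.relaxed hb₁)
      (fun i => by simp only [queue₁, out₂]) fun i => ?_
    obtain ⟨m, hm⟩ := h.exists_eq_pick i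
    simp only [queue₁, in₁, cout₂, hm]
    rcases le_total (Cr2 P (s i)) (queue₁ P s q t b₁ i) with hle | hle <;>
      cases m <;> simp [pick, hle]
  · refine hasMean_departures hin₂ hout₁ (queue₂_nonneg (P := P) hs h.relaxed hb₂)
      (fun i => by simp only [queue₂, out₁]) fun i => ?_
    obtain ⟨m, hm⟩ := h.exists_eq_pick i
    simp only [queue₂, in₂, cout₁, hm]
    rcases le_total (Cr1 P (s i)) (queue₂ P s q t b₂ i) with hle | hle <;>
      cases m <;> simp [pick, hle]
  · intro q' t' h' R hR
    -- Of each output a share 1 - μ is bounded by arrivals plus initial content, and a share μ by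
    -- offered capacity. The initial contents enter only as a constant.
    refine hR.le_of_sum_le (K := (1 - μ₁) * b₁ + (1 - μ₂) * b₂) hGmean fun N => ?_
    have h1 := mul_le_mul_of_nonneg_left (sum_out₂_le (P := P) hs h'.relaxed hb₁ N)
      (sub_nonneg.2 hμ₁.2)
    have h2 := mul_le_mul_of_nonneg_left (sum_out₁_le (P := P) hs h'.relaxed hb₂ N)
      (sub_nonneg.2 hμ₂.2)
    have h3 : ∑ i ∈ Finset.range N, out₂ P s q' t' b₁ i ≤ ∑ i ∈ Finset.range N, cout₂ P s q' i :=
      Finset.sum_le_sum fun i _ =>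
        mul_le_mul_of_nonneg_left (min_le_left _ _) (h'.relaxed.add_mem i).1.1
    have h4 : ∑ i ∈ Finset.range N, out₁ P s q' t' b₂ i ≤ ∑ i ∈ Finset.range N, cout₁ P s q' i :=
      Finset.sum_le_sum fun i _ =>
        mul_le_mul_of_nonneg_left (min_le_left _ _) (h'.relaxed.add_mem i).2.1
    have h5 := mul_le_mul_of_nonneg_left h3 hμ₁.1
    have h6 := mul_le_mul_of_nonneg_left h4 hμ₂.1
    have h7 := Finset.sum_le_sum fun i (_ : i ∈ Finset.range N) => hdual q' t' h'.relaxed i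
    simp only [Finset.sum_add_distrib, ← Finset.mul_sum] at h7 ⊢
    linarith
  · intro q' t' h' R₁' R₂' h1 h2 h3 h4
    have h5 := (((h1.const_mul (1 - μ₁)).add (h2.const_mul (1 - μ₂))).add
      (h3.const_mul μ₁)).add (h4.const_mul μ₂)
    have h6 := h5.le_of_sum_le (K := 0) hGmean fun N => by
      rw [zero_add]; exact Finset.sum_le_sum fun i _ => hdual q' t' h' i
    linarith

end Realization

/-! ### Laws of a pair of gains -/

/-- A probability law of a pair of positive gains with finite means and a density. -/
structure IsGainLaw (ν : Measure (ℝ × ℝ)) : Prop where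
  prob : IsProbabilityMeasure ν
  pos : ∀ᵐ s ∂ν, 0 < s.1 ∧ 0 < s.2
  integrable_fst : Integrable (fun s : ℝ × ℝ => s.1) ν
  integrable_snd : Integrable (fun s : ℝ × ℝ => s.2) ν
  ac : ν ≪ volume

/-- Absolute continuity gives the two coordinate axes probability zero, which improves nonnegative
gains to positive ones. -/
lemma IsFading.isGainLaw {Ω : Type*} [MeasurableSpace Ω] {ρ : Measure Ω} [IsProbabilityMeasure ρ]
    {S : ℕ → Ω → ℝ × ℝ} (hS : IsFading ρ S) : IsGainLaw (ρ.map (S 0)) := by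
  have hm := hS.measurable 0
  refine ⟨Measure.isProbabilityMeasure_map hm.aemeasurable, ?_,
    (integrable_map_measure (by fun_prop) hm.aemeasurable).2 hS.integrable₁,
    (integrable_map_measure (by fun_prop) hm.aemeasurable).2 hS.integrable₂, hS.continuous_law⟩
  have h0 : ∀ᵐ s ∂(ρ.map (S 0)), 0 ≤ s.1 ∧ 0 ≤ s.2 :=
    (ae_map_iff hm.aemeasurable (by measurability)).2 (hS.nonneg 0)
  have h1 : ∀ᵐ s : ℝ × ℝ, s.1 ≠ 0 :=
    (Measure.quasiMeasurePreserving_fst (μ := volume) (ν := volume)).ae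
      (p := fun x : ℝ => x ≠ 0) (Measure.ae_ne volume 0)
  have h2 : ∀ᵐ s : ℝ × ℝ, s.2 ≠ 0 :=
    (Measure.quasiMeasurePreserving_snd (μ := volume) (ν := volume)).ae
      (p := fun x : ℝ => x ≠ 0) (Measure.ae_ne volume 0)
  filter_upwards [h0, hS.continuous_law.ae_le h1, hS.continuous_law.ae_le h2] with s h h1 h2
  exact ⟨lt_of_le_of_ne h.1 h1.symm, lt_of_le_of_ne h.2 h2.symm⟩

lemma measurable_cap : Measurable cap := by
  unfold cap Real.logb; fun_prop

lemma measurable_C1r (P : Powers) : Measurable (C1r P) := by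
  unfold C1r; exact measurable_cap.comp (by fun_prop)
lemma measurable_C2r (P : Powers) : Measurable (C2r P) := by
  unfold C2r; exact measurable_cap.comp (by fun_prop)
lemma measurable_Cr (P : Powers) : Measurable (Cr P) := by
  unfold Cr; exact measurable_cap.comp (by fun_prop)
lemma measurable_Cr1 (P : Powers) : Measurable (Cr1 P) := by
  unfold Cr1; exact measurable_cap.comp (by fun_prop)
lemma measurable_Cr2 (P : Powers) : Measurable (Cr2 P) := by
  unfold Cr2; exact measurable_cap.comp (by fun_prop)
lemma measurable_C12r (P : Powers) (t : ℝ) : Measurable (C12r P t) := by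
  unfold C12r
  exact ((measurable_cap.comp (by fun_prop)).const_mul _).add
    ((measurable_cap.comp (by fun_prop)).const_mul _)
lemma measurable_C21r (P : Powers) (t : ℝ) : Measurable (C21r P t) := by
  unfold C21r
  exact ((measurable_cap.comp (by fun_prop)).const_mul _).add
    ((measurable_cap.comp (by fun_prop)).const_mul _)

attribute [fun_prop] measurable_C1r measurable_C2r measurable_Cr measurable_Cr1 measurable_Cr2
  measurable_C12r measurable_C21r

/-- From log (1 + x) = 2 log √(1 + x) ≤ 2 (√(1 + x) - 1) ≤ 2 √x. Consequently gains with finite mean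
have square-integrable capacities, as the variance estimate for the coins requires. -/
lemma cap_sq_le {x : ℝ} (hx : 0 ≤ x) : cap x ^ 2 ≤ 4 / Real.log 2 ^ 2 * x := by
  have hs : 0 < √(1 + x) := Real.sqrt_pos.2 (by linarith)
  have hl : Real.log (1 + x) ≤ 2 * √x := by
    have h1 : Real.log (1 + x) = 2 * Real.log √(1 + x) := by
      rw [Real.log_sqrt (by linarith)]; ring
    have h2 := Real.log_le_sub_one_of_pos hs
    have h3 : √(1 + x) ≤ 1 + √x := by
      rw [Real.sqrt_le_left (by positivity)]
      nlinarith [Real.sq_sqrt hx, Real.sqrt_nonneg x]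
    linarith
  have hl0 : 0 ≤ Real.log (1 + x) := Real.log_nonneg (by linarith)
  have hsq : Real.log (1 + x) ^ 2 ≤ 4 * x := by
    calc Real.log (1 + x) ^ 2 ≤ (2 * √x) ^ 2 := by gcongr
      _ = 4 * x := by rw [mul_pow, Real.sq_sqrt hx]; norm_num
  have h2 : 0 < Real.log 2 := Real.log_pos one_lt_two
  rw [cap, Real.logb, div_pow, div_mul_eq_mul_div]
  gcongr

lemma memLp_cap {ν : Measure (ℝ × ℝ)} {u : ℝ × ℝ → ℝ} (hum : Measurable u) (hu : Integrable u ν)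
    (hu0 : ∀ᵐ s ∂ν, 0 ≤ u s) : MemLp (fun s => cap (u s)) 2 ν := by
  have hm : Measurable fun s => cap (u s) := measurable_cap.comp hum
  rw [memLp_two_iff_integrable_sq hm.aestronglyMeasurable]
  refine (hu.const_mul (4 / Real.log 2 ^ 2)).mono' (hm.pow_const 2).aestronglyMeasurable ?_
  filter_upwards [hu0] with s hs
  rw [Real.norm_of_nonneg (sq_nonneg _)]
  exact cap_sq_le hs

namespace IsGainLaw

variable {ν : Measure (ℝ × ℝ)} (hν : IsGainLaw ν) (P : Powers)
include hν

lemma memLp_C1r : MemLp (C1r P) 2 ν :=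
  memLp_cap (by fun_prop) (hν.integrable_fst.const_mul _)
    (hν.pos.mono fun s h => mul_nonneg P.P₁_pos.le h.1.le)
lemma memLp_C2r : MemLp (C2r P) 2 ν :=
  memLp_cap (by fun_prop) (hν.integrable_snd.const_mul _)
    (hν.pos.mono fun s h => mul_nonneg P.P₂_pos.le h.2.le)
lemma memLp_Cr : MemLp (Cr P) 2 ν :=
  memLp_cap (by fun_prop) ((hν.integrable_fst.const_mul _).add (hν.integrable_snd.const_mul _))
    (hν.pos.mono fun s h => add_nonneg (mul_nonneg P.P₁_pos.le h.1.le)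
      (mul_nonneg P.P₂_pos.le h.2.le))
lemma memLp_Cr1 : MemLp (Cr1 P) 2 ν :=
  memLp_cap (by fun_prop) (hν.integrable_fst.const_mul _)
    (hν.pos.mono fun s h => mul_nonneg P.Pr_pos.le h.1.le)
lemma memLp_Cr2 : MemLp (Cr2 P) 2 ν :=
  memLp_cap (by fun_prop) (hν.integrable_snd.const_mul _)
    (hν.pos.mono fun s h => mul_nonneg P.Pr_pos.le h.2.le)

lemma integrable_C1r : Integrable (C1r P) ν :=
  have := hν.prob; (hν.memLp_C1r P).integrable one_le_two
lemma integrable_C2r : Integrable (C2r P) ν :=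
  have := hν.prob; (hν.memLp_C2r P).integrable one_le_two
lemma integrable_Cr : Integrable (Cr P) ν :=
  have := hν.prob; (hν.memLp_Cr P).integrable one_le_two
lemma integrable_Cr1 : Integrable (Cr1 P) ν :=
  have := hν.prob; (hν.memLp_Cr1 P).integrable one_le_two
lemma integrable_Cr2 : Integrable (Cr2 P) ν :=
  have := hν.prob; (hν.memLp_Cr2 P).integrable one_le_two

end IsGainLaw

/-! ### Ties between the multiple-access and the broadcast mode have probability zero -/

lemma finite_of_no_three {Z : Set ℝ}
    (h : ∀ x ∈ Z, ∀ y ∈ Z, ∀ z ∈ Z, x < y → y < z → False) : Z.Finite := by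
  by_contra hinf
  obtain ⟨t, ht, hc⟩ := Set.Infinite.exists_subset_card_eq hinf 3
  let e := t.orderEmbOfFin hc
  have he : ∀ i, e i ∈ Z := fun i => ht (t.orderEmbOfFin_mem hc i)
  exact h _ (he 0) _ (he 1) _ (he 2) (e.strictMono (by decide)) (e.strictMono (by decide))

/-- A nontrivial equation between two logarithms of affine functions has at most two solutions. -/
lemma finite_log_eq {A B C D k : ℝ} (hA : 0 < A) (hB : 0 < B) (hC : 0 < C) {a d : ℝ}
    (hD : 0 < D) (hne : ¬ ((a - d) * (A * C) = 0 ∧ a * A * D = d * C * B)) :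
    {x : ℝ | 0 < x ∧ a * Real.log (A * x + B) + k = d * Real.log (C * x + D)}.Finite := by
  refine finite_of_no_three fun x hx y hy z hz hxy hyz => hne ?_
  set g : ℝ → ℝ := fun x => a * Real.log (A * x + B) + k - d * Real.log (C * x + D) with hg
  have hgz : ∀ w, 0 < w ∧ a * Real.log (A * w + B) + k = d * Real.log (C * w + D) → g w = 0 :=
    fun w hw => sub_eq_zero.2 hw.2
  have hderiv : ∀ w, 0 < w → HasDerivAt g (a * (A / (A * w + B)) - d * (C / (C * w + D))) w := by
    intro w hw
    have h1 : HasDerivAt (fun w => A * w + B) A w := by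
      simpa using ((hasDerivAt_id w).const_mul A).add_const B
    have h2 : HasDerivAt (fun w => C * w + D) C w := by
      simpa using ((hasDerivAt_id w).const_mul C).add_const D
    exact (((h1.log (by positivity)).const_mul a).add_const k).sub
      ((h2.log (by positivity)).const_mul d)
  -- Rolle's theorem: between two zeros of g the derivative vanishes, and clearing denominators
  -- leaves an affine equation. Three zeros would give it two distinct roots, so both of its
  -- coefficients vanish.
  have hroot : ∀ u v, 0 < u → u < v → g u = 0 → g v = 0 → ∃ c ∈ Set.Ioo u v,
      (a - d) * (A * C) * c + (a * A * D - d * C * B) = 0 := by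
    intro u v hu huv h1 h2
    obtain ⟨c, hc, hc0⟩ := exists_hasDerivAt_eq_zero huv
      (fun w hw => (hderiv w (hu.trans_le hw.1)).continuousAt.continuousWithinAt)
      (h1.trans h2.symm) (fun w hw => hderiv w (hu.trans hw.1))
    refine ⟨c, hc, ?_⟩
    have hc' : 0 < c := hu.trans hc.1
    have e1 : A * c + B ≠ 0 := by positivity
    have e2 : C * c + D ≠ 0 := by positivity
    field_simp at hc0
    linarith
  obtain ⟨c, hc, hc0⟩ := hroot x y hx.1 hxy (hgz x hx) (hgz y hy)
  obtain ⟨e, he, he0⟩ := hroot y z hy.1 hyz (hgz y hy) (hgz z hz)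
  have hce : c - e ≠ 0 := by linarith [hc.2, he.1]
  have h1 : (a - d) * (A * C) = 0 := by
    have : (a - d) * (A * C) * (c - e) = 0 := by linarith
    exact (mul_eq_zero.1 this).resolve_right hce
  refine ⟨h1, ?_⟩
  rw [h1] at hc0
  linarith

/-- An equation between `Cr` and `Cr1` with a right-hand side that depends on the gain of user 2
holds with probability zero. -/
lemma IsGainLaw.ae_tie_ne {ν : Measure (ℝ × ℝ)} (hν : IsGainLaw ν) (P : Powers) {a d : ℝ}
    (had : a ≠ 0 ∨ d ≠ 0) {k : ℝ → ℝ} (hk : Measurable k) :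
    ∀ᵐ s ∂ν, a * Cr P s + k s.2 ≠ d * Cr1 P s := by
  set Z : Set (ℝ × ℝ) := {s | (0 < s.1 ∧ 0 < s.2) ∧ a * Cr P s + k s.2 = d * Cr1 P s} with hZ
  have hZm : MeasurableSet Z := by
    refine MeasurableSet.inter ?_ (measurableSet_eq_fun (by fun_prop) (by fun_prop))
    exact (measurableSet_lt measurable_const measurable_fst).inter
      (measurableSet_lt measurable_const measurable_snd)
  have hZ0 : volume Z = 0 := by
    rw [Measure.volume_eq_prod, Measure.prod_apply_symm hZm]
    refine (lintegral_congr_ae ?_).trans lintegral_zero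
    -- The excluded y solves P₁ = Pr (1 + P₂ y). There the arguments of the two logarithms are
    -- proportional in x, and the equation could hold identically.
    filter_upwards [Measure.ae_ne volume ((P.P₁ / P.Pr - 1) / P.P₂)] with y hy
    by_cases hy0 : 0 < y
    swap
    · have : (fun x => (x, y)) ⁻¹' Z = ∅ := by
        ext x; simp [hZ, hy0]
      rw [this, measure_empty]
    have hl2 : Real.log 2 ≠ 0 := (Real.log_pos one_lt_two).ne'
    have hfin := finite_log_eq (A := P.P₁) (B := 1 + P.P₂ * y) (C := P.Pr) (D := 1)
      (k := k y * Real.log 2) (a := a) (d := d) P.P₁_pos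
      (by have := mul_pos P.P₂_pos hy0; linarith) P.Pr_pos one_pos (by
        rintro ⟨h1, h2⟩
        have hadeq : a = d := by
          have := (mul_eq_zero.1 h1).resolve_right (mul_pos P.P₁_pos P.Pr_pos).ne'
          linarith
        subst hadeq
        have ha : a ≠ 0 := by tauto
        apply hy
        have h3 : P.P₁ = P.Pr * (1 + P.P₂ * y) := mul_left_cancel₀ ha (by linarith)
        have := P.Pr_pos.ne'
        have := P.P₂_pos.ne'
        rw [h3]
        field_simp
        ring)
    refine (hfin.subset ?_).measure_zero volume
    rintro x ⟨⟨hx, -⟩, h⟩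
    refine ⟨hx, ?_⟩
    simp only [Cr, Cr1, cap, Real.logb] at h
    field_simp at h
    rw [show P.P₁ * x + (1 + P.P₂ * y) = 1 + (P.P₁ * x + P.P₂ * y) by ring,
      show P.Pr * x + 1 = 1 + P.Pr * x by ring]
    linarith [mul_comm x P.Pr ▸ h]
  have hν0 : ν Z = 0 := hν.ac hZ0
  filter_upwards [hν.pos, measure_eq_zero_iff_ae_notMem.1 hν0] with s hs hsZ h
  exact hsZ ⟨hs, h⟩

/-- `Λ₃ - Λ₆` without time sharing, for the thresholds `x = μ₁` and `y = μ₂`. -/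
noncomputable def gap (P : Powers) (x y : ℝ) (s : ℝ × ℝ) : ℝ :=
  (1 - x) * (Cr P s - C2r P s) + (1 - y) * C2r P s - (x * Cr2 P s + y * Cr1 P s)

lemma measurable_gap (P : Powers) (x y : ℝ) : Measurable (gap P x y) := by
  unfold gap; fun_prop

attribute [fun_prop] measurable_gap

/-- Away from (1,0) the gap contains `Cr` or `Cr1` with a nonzero coefficient and the remaining
terms depend only on the gain of user 2. At (1,0) it is `C2r - Cr2`, whose sign is decided by the
powers; with equal powers it vanishes identically. -/
lemma IsGainLaw.ae_gap_ne {ν : Measure (ℝ × ℝ)} (hν : IsGainLaw ν) (P : Powers) {x y : ℝ}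
    (h : x ≠ 1 ∨ y ≠ 0 ∨ P.P₂ ≠ P.Pr) : ∀ᵐ s ∂ν, gap P x y s ≠ 0 := by
  by_cases hxy : x ≠ 1 ∨ y ≠ 0
  · have had : 1 - x ≠ 0 ∨ y ≠ 0 := hxy.imp_left fun h => sub_ne_zero.2 h.symm
    have hk : Measurable fun u : ℝ => (x - y) * cap (P.P₂ * u) - x * cap (P.Pr * u) :=
      ((measurable_cap.comp (by fun_prop)).const_mul _).sub
        ((measurable_cap.comp (by fun_prop)).const_mul _)
    filter_upwards [hν.ae_tie_ne P had hk] with s hs h0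
    apply hs
    have : gap P x y s = (1 - x) * Cr P s + ((x - y) * C2r P s - x * Cr2 P s) - y * Cr1 P s := by
      unfold gap; ring
    rw [this] at h0
    simp only [C2r, Cr2] at h0
    linarith
  · push Not at hxy
    obtain ⟨rfl, rfl⟩ := hxy
    have hP : P.P₂ ≠ P.Pr := by tauto
    filter_upwards [hν.pos] with s hs h0
    have h1 : C2r P s = Cr2 P s := by unfold gap at h0; linarith
    rcases lt_or_gt_of_ne hP with hlt | hlt
    · exact absurd h1 (cap_lt_cap (mul_pos P.P₂_pos hs.2).le (mul_lt_mul_of_pos_right hlt hs.2)).ne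
    · exact absurd h1 (cap_lt_cap (mul_pos P.Pr_pos hs.2).le (mul_lt_mul_of_pos_right hlt hs.2)).ne'

/-! ### Net flows of a selection rule -/

/-- The mean of `f` where the rule `φ` selects reception, minus the mean of `h` elsewhere. -/
noncomputable def net (ν : Measure (ℝ × ℝ)) (φ f h : ℝ × ℝ → ℝ) : ℝ :=
  ∫ s, (φ s * f s - (1 - φ s) * h s) ∂ν

/-- A selection rule: a measurable function with values in `[0,1]`. -/
structure IsRule (φ : ℝ × ℝ → ℝ) : Prop where
  measurable : Measurable φ
  mem : ∀ s, φ s ∈ Set.Icc (0 : ℝ) 1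

section Rule

variable {ν : Measure (ℝ × ℝ)} {φ φ' f g h : ℝ × ℝ → ℝ}

lemma IsRule.compl (hφ : IsRule φ) : IsRule fun s => 1 - φ s :=
  ⟨hφ.measurable.const_sub 1, fun s => ⟨sub_nonneg.2 (hφ.mem s).2, sub_le_self _ (hφ.mem s).1⟩⟩

lemma IsRule.integrable_mul (hφ : IsRule φ) (hf : Integrable f ν) :
    Integrable (fun s => φ s * f s) ν := by
  refine hf.bdd_mul (c := 1) hφ.measurable.aestronglyMeasurable (ae_of_all _ fun s => ?_)
  rw [Real.norm_of_nonneg (hφ.mem s).1]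
  exact (hφ.mem s).2

lemma IsRule.net_eq (hφ : IsRule φ) (hf : Integrable f ν) (hh : Integrable h ν) :
    net ν φ f h = ∫ s, φ s * f s ∂ν - ∫ s, (1 - φ s) * h s ∂ν :=
  integral_sub (hφ.integrable_mul hf) (hφ.compl.integrable_mul hh)

lemma net_congr (hφ : φ =ᵐ[ν] φ') : net ν φ f h = net ν φ' f h :=
  integral_congr_ae (hφ.mono fun s hs => by simp only [hs])

lemma integral_pos_of_ae_pos [NeZero ν] (hf : Integrable f ν) (hpos : ∀ᵐ s ∂ν, 0 < f s) :
    0 < ∫ s, f s ∂ν := by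
  refine lt_of_le_of_ne (integral_nonneg_of_ae (hpos.mono fun s h => h.le)) fun h0 => ?_
  have := (integral_eq_zero_iff_of_nonneg_ae (hpos.mono fun s h => h.le) hf).1 h0.symm
  have hF : ∀ᵐ s ∂ν, False := by
    filter_upwards [hpos, this] with s h1 h2
    exact h1.ne' h2
  simp [NeZero.ne] at hF

lemma IsRule.ae_eq_zero_of_integral_eq_zero (hφ : IsRule φ) (hg : Integrable g ν)
    (hpos : ∀ᵐ s ∂ν, 0 < g s) (h0 : ∫ s, φ s * g s ∂ν = 0) : ∀ᵐ s ∂ν, φ s = 0 := by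
  have h1 := (integral_eq_zero_iff_of_nonneg_ae
    (hpos.mono fun s h => mul_nonneg (hφ.mem s).1 h.le) (hφ.integrable_mul hg)).1 h0
  filter_upwards [h1, hpos] with s h1 h2
  exact (mul_eq_zero.1 h1).resolve_right h2.ne'

/-- A rule that balances positive flows uses both alternatives. -/
lemma IsRule.pos_of_net_eq_zero [NeZero ν] (hφ : IsRule φ) (hf : Integrable f ν)
    (hh : Integrable h ν) (hfpos : ∀ᵐ s ∂ν, 0 < f s) (hhpos : ∀ᵐ s ∂ν, 0 < h s)
    (h0 : net ν φ f h = 0) (hg : Integrable g ν) (hgpos : ∀ᵐ s ∂ν, 0 < g s) :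
    0 < ∫ s, φ s * g s ∂ν ∧ 0 < ∫ s, (1 - φ s) * g s ∂ν := by
  constructor
  · refine lt_of_le_of_ne (integral_nonneg_of_ae (hgpos.mono fun s h =>
      mul_nonneg (hφ.mem s).1 h.le)) fun hz => ?_
    have hz' := hφ.ae_eq_zero_of_integral_eq_zero hg hgpos hz.symm
    have : net ν φ f h = -∫ s, h s ∂ν := by
      rw [← integral_neg]
      exact integral_congr_ae (hz'.mono fun s hs => by simp [hs])
    linarith [integral_pos_of_ae_pos hh hhpos]
  · refine lt_of_le_of_ne (integral_nonneg_of_ae (hgpos.mono fun s h =>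
      mul_nonneg (hφ.compl.mem s).1 h.le)) fun hz => ?_
    have hz' := hφ.compl.ae_eq_zero_of_integral_eq_zero hg hgpos hz.symm
    have : net ν φ f h = ∫ s, f s ∂ν :=
      integral_congr_ae (hz'.mono fun s hs => by simp [show φ s = 1 by linarith])
    linarith [integral_pos_of_ae_pos hf hfpos]

/-- Comparable rules with the same net flow agree. -/
lemma IsRule.ae_eq_of_net_eq (hφ : IsRule φ) (hφ' : IsRule φ') (hle : ∀ᵐ s ∂ν, φ s ≤ φ' s)
    (hf : Integrable f ν) (hh : Integrable h ν) (hfpos : ∀ᵐ s ∂ν, 0 < f s)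
    (hhpos : ∀ᵐ s ∂ν, 0 < h s) (hnet : net ν φ f h = net ν φ' f h) : φ =ᵐ[ν] φ' := by
  have hi : Integrable (fun s => φ s * f s - (1 - φ s) * h s) ν :=
    (hφ.integrable_mul hf).sub (hφ.compl.integrable_mul hh)
  have hi' : Integrable (fun s => φ' s * f s - (1 - φ' s) * h s) ν :=
    (hφ'.integrable_mul hf).sub (hφ'.compl.integrable_mul hh)
  have hd : Integrable (fun s => (φ' s * f s - (1 - φ' s) * h s) -
    (φ s * f s - (1 - φ s) * h s)) ν := hi'.sub hi
  have h0 : ∫ s, ((φ' s * f s - (1 - φ' s) * h s) - (φ s * f s - (1 - φ s) * h s)) ∂ν = 0 :=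
    (integral_sub hi' hi).trans (sub_eq_zero.2 hnet.symm)
  have heq : ∀ s, (φ' s * f s - (1 - φ' s) * h s) - (φ s * f s - (1 - φ s) * h s) =
      (φ' s - φ s) * (f s + h s) := fun s => by ring
  have h1 := (integral_eq_zero_iff_of_nonneg_ae (by
    filter_upwards [hle, hfpos, hhpos] with s h1 h2 h3
    simp only [Pi.zero_apply]
    rw [heq]
    exact mul_nonneg (sub_nonneg.2 h1) (add_pos h2 h3).le) hd).1 h0
  filter_upwards [h1, hfpos, hhpos] with s h1 h2 h3
  simp only [Pi.zero_apply] at h1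
  rw [heq] at h1
  linarith [(mul_eq_zero.1 h1).resolve_right (add_pos h2 h3).ne']

end Rule

/-- The rule that prefers multiple access to broadcast without time sharing. -/
noncomputable def macRule (P : Powers) (x y : ℝ) (s : ℝ × ℝ) : ℝ :=
  if 0 ≤ gap P x y s then 1 else 0

lemma isRule_macRule (P : Powers) (x y : ℝ) : IsRule (macRule P x y) := by
  refine ⟨?_, fun s => ?_⟩
  · exact Measurable.ite (measurableSet_le measurable_const (by fun_prop)) measurable_const
      measurable_const
  · unfold macRule; split_ifs <;> simp

/-- Net flow through the buffer of user 1's data under `macRule`. -/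
noncomputable def flow₁ (P : Powers) (ν : Measure (ℝ × ℝ)) (x y : ℝ) : ℝ :=
  net ν (macRule P x y) (fun s => Cr P s - C2r P s) (Cr2 P)

/-- Net flow through the buffer of user 2's data under `macRule`. -/
noncomputable def flow₂ (P : Powers) (ν : Measure (ℝ × ℝ)) (x y : ℝ) : ℝ :=
  net ν (macRule P x y) (C2r P) (Cr1 P)

/-! ### Continuity, signs and zeros of the flows -/

namespace IsGainLaw

variable {ν : Measure (ℝ × ℝ)} (hν : IsGainLaw ν) (P : Powers)
include hν

lemma neZero : NeZero ν := have := hν.prob; inferInstance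

lemma integrable_Cr_sub : Integrable (fun s => Cr P s - C2r P s) ν :=
  (hν.integrable_Cr P).sub (hν.integrable_C2r P)
lemma ae_Cr_sub_pos : ∀ᵐ s ∂ν, 0 < Cr P s - C2r P s :=
  hν.pos.mono fun _ h => sub_pos.2 (C2r_lt_Cr h.1 h.2)
lemma ae_C1r_pos : ∀ᵐ s ∂ν, 0 < C1r P s := hν.pos.mono fun _ h => C1r_pos h.1
lemma ae_C2r_pos : ∀ᵐ s ∂ν, 0 < C2r P s := hν.pos.mono fun _ h => C2r_pos h.2
lemma ae_Cr1_pos : ∀ᵐ s ∂ν, 0 < Cr1 P s := hν.pos.mono fun _ h => Cr1_pos h.1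
lemma ae_Cr2_pos : ∀ᵐ s ∂ν, 0 < Cr2 P s := hν.pos.mono fun _ h => Cr2_pos h.2
lemma ae_Cr_pos : ∀ᵐ s ∂ν, 0 < Cr P s :=
  hν.pos.mono fun _ h => (C2r_pos h.2).trans (C2r_lt_Cr h.1 h.2)

-- In a state without a tie the rule is locally constant in the thresholds, so dominated convergence
-- applies.
omit hν in
lemma continuousAt_net {x y : ℝ} (hne : ∀ᵐ s ∂ν, gap P x y s ≠ 0) {f h : ℝ × ℝ → ℝ}
    (hf : Integrable f ν) (hh : Integrable h ν) :
    ContinuousAt (fun m : ℝ × ℝ => net ν (macRule P m.1 m.2) f h) (x, y) := by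
  refine continuousAt_of_dominated (bound := fun s => |f s| + |h s|)
    (Eventually.of_forall fun m => ?_) (Eventually.of_forall fun m => ae_of_all _ fun s => ?_)
    (hf.abs.add hh.abs) ?_
  · exact (((isRule_macRule P m.1 m.2).integrable_mul hf).sub
      ((isRule_macRule P m.1 m.2).compl.integrable_mul hh)).aestronglyMeasurable
  · unfold macRule
    split_ifs <;> simp
  · filter_upwards [hne] with s hs
    have hc : Continuous fun m : ℝ × ℝ => gap P m.1 m.2 s := by unfold gap; fun_prop
    have hφ : ContinuousAt (fun m : ℝ × ℝ => macRule P m.1 m.2 s) (x, y) := by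
      rcases lt_or_gt_of_ne hs with hlt | hgt
      · refine (continuousAt_const (y := (0 : ℝ))).congr ?_
        filter_upwards [hc.continuousAt.eventually (gt_mem_nhds hlt)] with m hm
        simp [macRule, not_le.2 hm]
      · refine (continuousAt_const (y := (1 : ℝ))).congr ?_
        filter_upwards [hc.continuousAt.eventually (lt_mem_nhds hgt)] with m hm
        simp [macRule, hm.le]
    exact (hφ.mul continuousAt_const).sub ((continuousAt_const.sub hφ).mul continuousAt_const)

lemma continuousAt_flow₁ {x y : ℝ} (h : x ≠ 1 ∨ y ≠ 0 ∨ P.P₂ ≠ P.Pr) :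
    ContinuousAt (fun m : ℝ × ℝ => flow₁ P ν m.1 m.2) (x, y) :=
  continuousAt_net P (hν.ae_gap_ne P h) (hν.integrable_Cr_sub P) (hν.integrable_Cr2 P)

lemma continuousAt_flow₂ {x y : ℝ} (h : x ≠ 1 ∨ y ≠ 0 ∨ P.P₂ ≠ P.Pr) :
    ContinuousAt (fun m : ℝ × ℝ => flow₂ P ν m.1 m.2) (x, y) :=
  continuousAt_net P (hν.ae_gap_ne P h) (hν.integrable_C2r P) (hν.integrable_Cr1 P)

lemma flow_pos {x y : ℝ} (h : ∀ᵐ s ∂ν, 0 < gap P x y s) :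
    0 < flow₁ P ν x y ∧ 0 < flow₂ P ν x y := by
  have := hν.neZero
  have h1 : macRule P x y =ᵐ[ν] fun _ => 1 := h.mono fun s hs => by simp [macRule, hs.le]
  rw [flow₁, flow₂, net_congr h1, net_congr h1]
  simp only [net, one_mul, sub_self, zero_mul, sub_zero]
  exact ⟨integral_pos_of_ae_pos (hν.integrable_Cr_sub P) (hν.ae_Cr_sub_pos P),
    integral_pos_of_ae_pos (hν.integrable_C2r P) (hν.ae_C2r_pos P)⟩

lemma flow_neg {x y : ℝ} (h : ∀ᵐ s ∂ν, gap P x y s < 0) :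
    flow₁ P ν x y < 0 ∧ flow₂ P ν x y < 0 := by
  have := hν.neZero
  have h1 : macRule P x y =ᵐ[ν] fun _ => 0 := h.mono fun s hs => by simp [macRule, not_le.2 hs]
  rw [flow₁, flow₂, net_congr h1, net_congr h1]
  simp only [net, zero_mul, sub_zero, one_mul, zero_sub, integral_neg, neg_lt_zero]
  exact ⟨integral_pos_of_ae_pos (hν.integrable_Cr2 P) (hν.ae_Cr2_pos P),
    integral_pos_of_ae_pos (hν.integrable_Cr1 P) (hν.ae_Cr1_pos P)⟩

lemma Cr2_lt_C2r {P : Powers} (h : P.Pr < P.P₂) : ∀ᵐ s ∂ν, Cr2 P s < C2r P s :=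
  hν.pos.mono fun _ hs => cap_lt_cap (mul_pos P.Pr_pos hs.2).le (mul_lt_mul_of_pos_right h hs.2)

lemma C2r_lt_Cr2 {P : Powers} (h : P.P₂ < P.Pr) : ∀ᵐ s ∂ν, C2r P s < Cr2 P s :=
  hν.pos.mono fun _ hs => cap_lt_cap (mul_pos P.P₂_pos hs.2).le (mul_lt_mul_of_pos_right h hs.2)

/-- The signs of the gap on the boundary of the threshold triangle serve as end values for the
intermediate value theorem, and later exclude boundary points as minimizers of the dual function. -/
lemma gap_zero_zero_pos : ∀ᵐ s ∂ν, 0 < gap P 0 0 s := by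
  filter_upwards [hν.ae_Cr_pos P] with s hs
  unfold gap; linarith

lemma gap_one_one_neg : ∀ᵐ s ∂ν, gap P 1 1 s < 0 := by
  filter_upwards [hν.ae_Cr1_pos P, hν.ae_Cr2_pos P] with s h1 h2
  unfold gap; linarith

lemma gap_one_neg {P : Powers} (h : P.P₂ ≤ P.Pr) {y : ℝ} (hy : 0 < y) :
    ∀ᵐ s ∂ν, gap P 1 y s < 0 := by
  filter_upwards [hν.ae_Cr1_pos P, hν.ae_C2r_pos P, hν.pos] with s h1 h2 hs
  have h3 : C2r P s ≤ Cr2 P s :=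
    cap_le_cap (mul_pos P.P₂_pos hs.2).le (mul_le_mul_of_nonneg_right h hs.2.le)
  unfold gap
  nlinarith [mul_pos hy h1, mul_pos hy h2]

lemma gap_zero_pos {P : Powers} (h : P.Pr ≤ P.P₂) {x : ℝ} (hx0 : 0 ≤ x) (hx : x < 1) :
    ∀ᵐ s ∂ν, 0 < gap P x 0 s := by
  filter_upwards [hν.ae_Cr_sub_pos P, hν.ae_C2r_pos P, hν.pos] with s h1 h2 hs
  have h3 : Cr2 P s ≤ C2r P s :=
    cap_le_cap (mul_pos P.Pr_pos hs.2).le (mul_le_mul_of_nonneg_right h hs.2.le)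
  unfold gap
  nlinarith [mul_pos (sub_pos.2 hx) h1, mul_pos (sub_pos.2 hx) h2, mul_le_mul_of_nonneg_left h3 hx0]

lemma gap_corner_pos {P : Powers} (h : P.Pr < P.P₂) : ∀ᵐ s ∂ν, 0 < gap P 1 0 s := by
  filter_upwards [hν.Cr2_lt_C2r h] with s hs
  unfold gap; linarith

lemma gap_corner_neg {P : Powers} (h : P.P₂ < P.Pr) : ∀ᵐ s ∂ν, gap P 1 0 s < 0 := by
  filter_upwards [hν.C2r_lt_Cr2 h] with s hs
  unfold gap; linarith

omit hν in
lemma exists_zero_of_sign_change {F : ℝ → ℝ} (hF : ∀ x ∈ Set.Icc (0 : ℝ) 1, ContinuousAt F x)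
    (h0 : 0 < F 0) (h1 : F 1 < 0) : ∃ μ ∈ Set.Ioo (0 : ℝ) 1, F μ = 0 := by
  obtain ⟨μ, hμ, hz⟩ := intermediate_value_Icc' zero_le_one
    (fun x hx => (hF x hx).continuousWithinAt) ⟨h1.le, h0.le⟩
  refine ⟨μ, ⟨lt_of_le_of_ne hμ.1 ?_, lt_of_le_of_ne hμ.2 ?_⟩, hz⟩
  · rintro rfl; exact h0.ne' hz
  · rintro rfl; exact h1.ne hz

/-- On the edge x = 1 the relay only receives at y = 0 and only sends at y = 1; unequal powers make
the flow continuous up to the corner. -/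
lemma exists_flow₂_eq_zero {P : Powers} (h : P.Pr < P.P₂) :
    ∃ μ ∈ Set.Ioo (0 : ℝ) 1, flow₂ P ν 1 μ = 0 :=
  exists_zero_of_sign_change (F := fun μ => flow₂ P ν 1 μ)
    (fun x _ => ContinuousAt.comp (f := fun μ : ℝ => ((1 : ℝ), μ)) (x := x)
      (hν.continuousAt_flow₂ P (Or.inr (Or.inr h.ne'))) (by fun_prop))
    (hν.flow_pos P (hν.gap_corner_pos h)).2 (hν.flow_neg P (hν.gap_one_one_neg P)).2

lemma exists_flow₁_eq_zero {P : Powers} (h : P.P₂ < P.Pr) :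
    ∃ μ ∈ Set.Ioo (0 : ℝ) 1, flow₁ P ν μ 0 = 0 :=
  exists_zero_of_sign_change (F := fun μ => flow₁ P ν μ 0)
    (fun x _ => ContinuousAt.comp (f := fun μ : ℝ => (μ, (0 : ℝ))) (x := x)
      (hν.continuousAt_flow₁ P (Or.inr (Or.inr h.ne))) (by fun_prop))
    (hν.flow_pos P (hν.gap_zero_zero_pos P)).1 (hν.flow_neg P (hν.gap_corner_neg h)).1

/-- The diagonal avoids the degenerate corner (1,0), so no condition on the powers is needed. -/
lemma exists_flow_add_eq_zero :
    ∃ μ ∈ Set.Ioo (0 : ℝ) 1, flow₁ P ν μ μ + flow₂ P ν μ μ = 0 := by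
  have hne : ∀ x : ℝ, x ≠ 1 ∨ x ≠ 0 ∨ P.P₂ ≠ P.Pr := fun x => by
    by_cases h : x = 1 <;> simp [h]
  have hp := hν.flow_pos P (hν.gap_zero_zero_pos P)
  have hn := hν.flow_neg P (hν.gap_one_one_neg P)
  exact exists_zero_of_sign_change (F := fun μ => flow₁ P ν μ μ + flow₂ P ν μ μ)
    (fun x _ => ContinuousAt.add
      (ContinuousAt.comp (f := fun μ : ℝ => (μ, μ)) (x := x)
        (hν.continuousAt_flow₁ P (hne x)) (by fun_prop))
      (ContinuousAt.comp (f := fun μ : ℝ => (μ, μ)) (x := x)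
        (hν.continuousAt_flow₂ P (hne x)) (by fun_prop)))
    (by linarith [hp.1, hp.2]) (by linarith [hn.1, hn.2])

omit hν in
lemma macRule_le_of_gap_le {P : Powers} {x y x' y' : ℝ} {s : ℝ × ℝ}
    (h : gap P x y s ≤ gap P x' y' s) : macRule P x y s ≤ macRule P x' y' s := by
  unfold macRule
  split_ifs with h1 h2 h2
  · exact le_rfl
  · exact absurd (h1.trans h) h2
  · exact zero_le_one
  · exact le_rfl

/-- The gap decreases in the threshold, so the two rules are comparable, and comparable rules with
the same net flow agree. Thus statements about one balancing threshold transfer to every other. -/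
lemma macRule_ae_eq_of_flow₂_eq {μ μ' : ℝ} (h : flow₂ P ν 1 μ = flow₂ P ν 1 μ') :
    macRule P 1 μ =ᵐ[ν] macRule P 1 μ' := by
  wlog hle : μ' ≤ μ generalizing μ μ'
  · exact (this h.symm (le_of_not_ge hle)).symm
  refine (isRule_macRule P 1 μ).ae_eq_of_net_eq (isRule_macRule P 1 μ') ?_ (hν.integrable_C2r P)
    (hν.integrable_Cr1 P) (hν.ae_C2r_pos P) (hν.ae_Cr1_pos P) h
  filter_upwards [hν.ae_C2r_pos P, hν.ae_Cr1_pos P] with s h1 h2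
  refine macRule_le_of_gap_le ?_
  unfold gap
  nlinarith [mul_nonneg (sub_nonneg.2 hle) h1.le, mul_nonneg (sub_nonneg.2 hle) h2.le]

lemma macRule_ae_eq_of_flow₁_eq {μ μ' : ℝ} (h : flow₁ P ν μ 0 = flow₁ P ν μ' 0) :
    macRule P μ 0 =ᵐ[ν] macRule P μ' 0 := by
  wlog hle : μ' ≤ μ generalizing μ μ'
  · exact (this h.symm (le_of_not_ge hle)).symm
  refine (isRule_macRule P μ 0).ae_eq_of_net_eq (isRule_macRule P μ' 0) ?_ (hν.integrable_Cr_sub P)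
    (hν.integrable_Cr2 P) (hν.ae_Cr_sub_pos P) (hν.ae_Cr2_pos P) h
  filter_upwards [hν.ae_Cr_sub_pos P, hν.ae_Cr2_pos P] with s h1 h2
  refine macRule_le_of_gap_le ?_
  unfold gap
  nlinarith [mul_nonneg (sub_nonneg.2 hle) h1.le, mul_nonneg (sub_nonneg.2 hle) h2.le]

lemma flow_add (x y : ℝ) : flow₁ P ν x y + flow₂ P ν x y =
    net ν (macRule P x y) (Cr P) (fun s => Cr1 P s + Cr2 P s) := by
  have h := isRule_macRule P x y
  rw [flow₁, flow₂, net, net, net, ← integral_add]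
  · exact integral_congr_ae (ae_of_all _ fun s => by ring)
  · exact (h.integrable_mul (hν.integrable_Cr_sub P)).sub
      (h.compl.integrable_mul (hν.integrable_Cr2 P))
  · exact (h.integrable_mul (hν.integrable_C2r P)).sub
      (h.compl.integrable_mul (hν.integrable_Cr1 P))

lemma macRule_ae_eq_of_flow_add_eq {μ μ' : ℝ}
    (h : flow₁ P ν μ μ + flow₂ P ν μ μ = flow₁ P ν μ' μ' + flow₂ P ν μ' μ') :
    macRule P μ μ =ᵐ[ν] macRule P μ' μ' := by
  wlog hle : μ' ≤ μ generalizing μ μ'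
  · exact (this h.symm (le_of_not_ge hle)).symm
  rw [hν.flow_add P, hν.flow_add P] at h
  refine (isRule_macRule P μ μ).ae_eq_of_net_eq (isRule_macRule P μ' μ') ?_ (hν.integrable_Cr P)
    ((hν.integrable_Cr1 P).add (hν.integrable_Cr2 P)) (hν.ae_Cr_pos P) ?_ h
  · filter_upwards [hν.ae_Cr_pos P, hν.ae_Cr1_pos P, hν.ae_Cr2_pos P] with s h1 h2 h3
    refine macRule_le_of_gap_le ?_
    unfold gap
    nlinarith [mul_nonneg (sub_nonneg.2 hle) h1.le, mul_nonneg (sub_nonneg.2 hle) h2.le,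
      mul_nonneg (sub_nonneg.2 hle) h3.le]
  · filter_upwards [hν.ae_Cr1_pos P, hν.ae_Cr2_pos P] with s h2 h3 using add_pos h2 h3

end IsGainLaw

/-! ### The quantities of the regions in terms of net flows -/

lemma metric_M3_zero (P : Powers) (x y : ℝ) {s : ℝ × ℝ} (h1 : 0 ≤ s.1) (h2 : 0 ≤ s.2) :
    metric P x y 0 s .M3 = (1 - x) * (Cr P s - C2r P s) + (1 - y) * C2r P s := by
  simp only [metric, modeVec, C12r_eq 0 h1 h2, C21r_eq 0 h1 h2]
  ring

lemma metric_M6 (P : Powers) (x y t : ℝ) (s : ℝ × ℝ) :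
    metric P x y t s .M6 = x * Cr2 P s + y * Cr1 P s := rfl

lemma gap_eq (P : Powers) (x y : ℝ) {s : ℝ × ℝ} (h1 : 0 ≤ s.1) (h2 : 0 ≤ s.2) :
    gap P x y s = metric P x y 0 s .M3 - metric P x y 0 s .M6 := by
  rw [metric_M3_zero P x y h1 h2, metric_M6, gap]

lemma metric_diag_M3 (P : Powers) (x t : ℝ) {s : ℝ × ℝ} (h1 : 0 ≤ s.1) (h2 : 0 ≤ s.2) :
    metric P x x t s .M3 = metric P x x 0 s .M3 := by
  simp only [metric, modeVec, C12r_eq _ h1 h2, C21r_eq _ h1 h2]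
  ring

/-- If the threshold of user 1 is the larger one, no mode and no time sharing beat both the
multiple-access mode without time sharing and the broadcast mode. -/
lemma metric_le_max (P : Powers) {x y t : ℝ} (hy : 0 ≤ y) (hyx : y ≤ x) (hx : x ≤ 1)
    (ht : t ∈ Set.Icc (0 : ℝ) 1) {s : ℝ × ℝ} (h1 : 0 ≤ s.1) (h2 : 0 ≤ s.2) (k : Mode) :
    metric P x y t s k ≤ max (metric P x y 0 s .M3) (metric P x y 0 s .M6) := by
  have c1 := C1r_nonneg (P := P) h1
  have c2 := C2r_nonneg (P := P) h2
  have e1 := Cr1_nonneg (P := P) h1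
  have e2 := Cr2_nonneg (P := P) h2
  have l1 := C1r_le_Cr (P := P) h1 h2
  have l2 := C2r_le_Cr (P := P) h1 h2
  have l3 := Cr_le_add (P := P) h1 h2
  have hx' : 0 ≤ 1 - x := sub_nonneg.2 hx
  have hxy : 0 ≤ x - y := sub_nonneg.2 hyx
  rw [metric_M3_zero P x y h1 h2, metric_M6]
  cases k <;> simp only [metric, modeVec]
  · refine le_max_of_le_left ?_
    nlinarith [mul_le_mul_of_nonneg_left l1 hx', mul_nonneg hxy c2]
  · refine le_max_of_le_left ?_
    nlinarith [mul_nonneg hx' (sub_nonneg.2 l2)]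
  · refine le_max_of_le_left ?_
    rw [C12r_eq t h1 h2, C21r_eq t h1 h2]
    -- Time sharing t lowers the multiple-access metric by t (x - y) (C1r + C2r - Cr).
    nlinarith [mul_nonneg (mul_nonneg ht.1 hxy) (sub_nonneg.2 l3)]
  · exact le_max_of_le_right (by nlinarith [mul_nonneg (hy.trans hyx) e2])
  · exact le_max_of_le_right (by nlinarith [mul_nonneg hy e1])
  · exact le_max_right _ _

namespace IsGainLaw

variable {ν : Measure (ℝ × ℝ)} (hν : IsGainLaw ν) {P : Powers}
include hν

/-- For P₂ > Pr the indicator q marks broadcast, whereas `macRule` marks reception; both include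
ties, hence agreement only up to a null set. -/
lemma R1_q_ae_eq_of_gt (h : P.Pr < P.P₂) (μ : ℝ) :
    R1.q P μ =ᵐ[ν] fun s => 1 - macRule P 1 μ s := by
  filter_upwards [hν.pos, hν.ae_gap_ne P (x := 1) (y := μ) (Or.inr (Or.inr h.ne'))] with s hs hg
  have hge := gap_eq P 1 μ hs.1.le hs.2.le
  unfold R1.q macRule
  rcases lt_or_gt_of_ne hg with hlt | hlt
  · rw [if_pos (Or.inl ⟨h, by linarith⟩), if_neg (not_le.2 hlt), sub_zero]
  · rw [if_neg, if_pos hlt.le, sub_self]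
    rintro (⟨-, h'⟩ | ⟨h', -⟩) <;> linarith

omit hν in
lemma R1_q_eq_of_lt (h : P.P₂ < P.Pr) (μ : ℝ) {s : ℝ × ℝ} (h1 : 0 ≤ s.1) (h2 : 0 ≤ s.2) :
    R1.q P μ s = macRule P μ 0 s := by
  have hge := gap_eq P μ 0 h1 h2
  unfold R1.q macRule
  refine if_congr ⟨?_, fun h' => Or.inr ⟨h, by linarith⟩⟩ rfl rfl
  rintro (⟨h', -⟩ | ⟨-, h'⟩) <;> linarith

lemma R1_q_ae_eq_of_lt (h : P.P₂ < P.Pr) (μ : ℝ) : R1.q P μ =ᵐ[ν] macRule P μ 0 := by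
  filter_upwards [hν.pos] with s hs using R1_q_eq_of_lt h μ hs.1.le hs.2.le

lemma R0_q_ae_eq {μ : ℝ} (hμ : μ ∈ Set.Ioo (0 : ℝ) 1) : R0.q P μ =ᵐ[ν] macRule P μ μ := by
  filter_upwards [hν.ae_Cr1_pos P, hν.ae_Cr2_pos P] with s h1 h2
  unfold R0.q macRule gap
  refine if_congr ?_ rfl rfl
  rw [ge_iff_le, div_le_div_iff₀ (sub_pos.2 hμ.2) (add_pos h1 h2)]
  constructor <;> intro h <;> linarith

lemma R1_balanced_iff_of_gt (h : P.Pr < P.P₂) (μ : ℝ) :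
    R1.Balanced P ν μ ↔ flow₂ P ν 1 μ = 0 := by
  have hφ := isRule_macRule P 1 μ
  have hq := hν.R1_q_ae_eq_of_gt h μ
  have e1 : ∫ s, (1 - R1.q P μ s) * C2r P s ∂ν = ∫ s, macRule P 1 μ s * C2r P s ∂ν :=
    integral_congr_ae (hq.mono fun s hs => by simp [hs])
  have e2 : ∫ s, R1.q P μ s * Cr1 P s ∂ν = ∫ s, (1 - macRule P 1 μ s) * Cr1 P s ∂ν :=
    integral_congr_ae (hq.mono fun s hs => by simp [hs])
  rw [R1.Balanced, flow₂, hφ.net_eq (hν.integrable_C2r P) (hν.integrable_Cr1 P), e1, e2, sub_eq_zero]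
  exact ⟨fun hb => hb.1 h, fun hb => ⟨fun _ => hb, fun h' => absurd h' h.not_gt⟩⟩

lemma R1_balanced_iff_of_lt (h : P.P₂ < P.Pr) (μ : ℝ) :
    R1.Balanced P ν μ ↔ flow₁ P ν μ 0 = 0 := by
  have hφ := isRule_macRule P μ 0
  have hq := hν.R1_q_ae_eq_of_lt h μ
  have e1 : ∫ s, R1.q P μ s * (Cr P s - C2r P s) ∂ν =
      ∫ s, macRule P μ 0 s * (Cr P s - C2r P s) ∂ν :=
    integral_congr_ae (hq.mono fun s hs => by simp only [hs])
  have e2 : ∫ s, (1 - R1.q P μ s) * Cr2 P s ∂ν = ∫ s, (1 - macRule P μ 0 s) * Cr2 P s ∂ν :=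
    integral_congr_ae (hq.mono fun s hs => by simp only [hs])
  rw [R1.Balanced, flow₁, hφ.net_eq (hν.integrable_Cr_sub P) (hν.integrable_Cr2 P), e1, e2,
    sub_eq_zero]
  exact ⟨fun hb => hb.2 h, fun hb => ⟨fun h' => absurd h' h.not_gt, fun _ => hb⟩⟩

lemma exists_R1_balanced (P : Powers) : ∃ μ ∈ Set.Icc (0 : ℝ) 1, R1.Balanced P ν μ := by
  rcases lt_trichotomy P.P₂ P.Pr with h | h | h
  · obtain ⟨μ, hμ, h0⟩ := hν.exists_flow₁_eq_zero h
    exact ⟨μ, Set.Ioo_subset_Icc_self hμ, (hν.R1_balanced_iff_of_lt h μ).2 h0⟩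
  · exact ⟨0, by simp, fun h' => absurd h h'.ne', fun h' => absurd h h'.ne⟩
  · obtain ⟨μ, hμ, h0⟩ := hν.exists_flow₂_eq_zero h
    exact ⟨μ, Set.Ioo_subset_Icc_self hμ, (hν.R1_balanced_iff_of_gt h μ).2 h0⟩

lemma R1_ω₁_eq (h : P.Pr < P.P₂) (μ : ℝ) : R1.ω₁ P ν μ =
    (∫ s, (1 - macRule P 1 μ s) * Cr2 P s ∂ν) /
      ∫ s, macRule P 1 μ s * (Cr P s - C2r P s) ∂ν := by
  have hq := hν.R1_q_ae_eq_of_gt h μ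
  rw [R1.ω₁]
  congr 1 <;> exact integral_congr_ae (hq.mono fun s hs => by simp [hs])

lemma R1_ω₂_eq (h : P.P₂ < P.Pr) (μ : ℝ) : R1.ω₂ P ν μ =
    (∫ s, macRule P μ 0 s * C2r P s ∂ν) / ∫ s, (1 - macRule P μ 0 s) * Cr1 P s ∂ν := by
  have hq := hν.R1_q_ae_eq_of_lt h μ
  rw [R1.ω₂]
  congr 1 <;> exact integral_congr_ae (hq.mono fun s hs => by simp only [hs])

/-- Positive flows in both directions under a rule that balances user 2's data. -/
lemma pos_of_flow₂_eq_zero {x y : ℝ} (h0 : flow₂ P ν x y = 0) {g : ℝ × ℝ → ℝ}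
    (hg : Integrable g ν) (hgpos : ∀ᵐ s ∂ν, 0 < g s) :
    0 < ∫ s, macRule P x y s * g s ∂ν ∧ 0 < ∫ s, (1 - macRule P x y s) * g s ∂ν :=
  have := hν.neZero
  (isRule_macRule P x y).pos_of_net_eq_zero (hν.integrable_C2r P) (hν.integrable_Cr1 P)
    (hν.ae_C2r_pos P) (hν.ae_Cr1_pos P) h0 hg hgpos

/-- Positive flows in both directions under a rule that balances user 1's data. -/
lemma pos_of_flow₁_eq_zero {x y : ℝ} (h0 : flow₁ P ν x y = 0) {g : ℝ × ℝ → ℝ}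
    (hg : Integrable g ν) (hgpos : ∀ᵐ s ∂ν, 0 < g s) :
    0 < ∫ s, macRule P x y s * g s ∂ν ∧ 0 < ∫ s, (1 - macRule P x y s) * g s ∂ν :=
  have := hν.neZero
  (isRule_macRule P x y).pos_of_net_eq_zero (hν.integrable_Cr_sub P) (hν.integrable_Cr2 P)
    (hν.ae_Cr_sub_pos P) (hν.ae_Cr2_pos P) h0 hg hgpos

lemma R1_ω₁_pos (h : P.Pr < P.P₂) {μ : ℝ} (h0 : flow₂ P ν 1 μ = 0) : 0 < R1.ω₁ P ν μ := by
  rw [hν.R1_ω₁_eq h μ]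
  exact div_pos (hν.pos_of_flow₂_eq_zero h0 (hν.integrable_Cr2 P) (hν.ae_Cr2_pos P)).2
    (hν.pos_of_flow₂_eq_zero h0 (hν.integrable_Cr_sub P) (hν.ae_Cr_sub_pos P)).1

/-- The ratio ω₁ compares what the relay can send of user 1's data with what it would receive. It is
below 1 exactly if reception exceeds service, and then it is the fraction of receptions to keep. -/
lemma R1_ω₁_lt_one_iff (h : P.Pr < P.P₂) {μ : ℝ} (h0 : flow₂ P ν 1 μ = 0) :
    R1.ω₁ P ν μ < 1 ↔ 0 < flow₁ P ν 1 μ := by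
  rw [hν.R1_ω₁_eq h μ, div_lt_one
    (hν.pos_of_flow₂_eq_zero h0 (hν.integrable_Cr_sub P) (hν.ae_Cr_sub_pos P)).1, flow₁,
    (isRule_macRule P 1 μ).net_eq (hν.integrable_Cr_sub P) (hν.integrable_Cr2 P), sub_pos]

lemma R1_ω₂_pos (h : P.P₂ < P.Pr) {μ : ℝ} (h0 : flow₁ P ν μ 0 = 0) : 0 < R1.ω₂ P ν μ := by
  rw [hν.R1_ω₂_eq h μ]
  exact div_pos (hν.pos_of_flow₁_eq_zero h0 (hν.integrable_C2r P) (hν.ae_C2r_pos P)).1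
    (hν.pos_of_flow₁_eq_zero h0 (hν.integrable_Cr1 P) (hν.ae_Cr1_pos P)).2

/-- Here the surplus is on the sending side: the relay could send more of user 2's data than it
receives, and ω₂ is the fraction of service to keep. -/
lemma R1_ω₂_lt_one_iff (h : P.P₂ < P.Pr) {μ : ℝ} (h0 : flow₁ P ν μ 0 = 0) :
    R1.ω₂ P ν μ < 1 ↔ flow₂ P ν μ 0 < 0 := by
  rw [hν.R1_ω₂_eq h μ, div_lt_one
    (hν.pos_of_flow₁_eq_zero h0 (hν.integrable_Cr1 P) (hν.ae_Cr1_pos P)).2, flow₂,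
    (isRule_macRule P μ 0).net_eq (hν.integrable_C2r P) (hν.integrable_Cr1 P), sub_neg]

omit hν in
lemma C2r_eq_Cr2 (h : P.P₂ = P.Pr) (s : ℝ × ℝ) : C2r P s = Cr2 P s := by
  rw [C2r, Cr2, h]

lemma R1_ω₃l_mem (h : P.P₂ = P.Pr) : R1.ω₃l P ν ∈ Set.Ioo (0 : ℝ) 1 := by
  have := hν.neZero
  have h1 := integral_pos_of_ae_pos (hν.integrable_Cr2 P) (hν.ae_Cr2_pos P)
  have h2 := integral_pos_of_ae_pos (hν.integrable_Cr_sub P) (hν.ae_Cr_sub_pos P)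
  rw [integral_sub (hν.integrable_Cr P) (hν.integrable_C2r P), integral_congr_ae
    (ae_of_all _ fun s => C2r_eq_Cr2 h s)] at h2
  refine ⟨div_pos h1 (by linarith), (div_lt_one (by linarith)).2 (by linarith)⟩

lemma R1_ω₃u_mem (P : Powers) : R1.ω₃u P ν ∈ Set.Ioo (0 : ℝ) 1 := by
  have := hν.neZero
  have h1 := integral_pos_of_ae_pos (hν.integrable_Cr1 P) (hν.ae_Cr1_pos P)
  have h2 := integral_pos_of_ae_pos (hν.integrable_C2r P) (hν.ae_C2r_pos P)
  rw [R1.ω₃u, integral_add (hν.integrable_Cr1 P) (hν.integrable_C2r P)]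
  refine ⟨div_pos h1 (by linarith), (div_lt_one (by linarith)).2 (by linarith)⟩

lemma integrable_relay (P : Powers) : Integrable (fun s => Cr1 P s + Cr2 P s) ν :=
  (hν.integrable_Cr1 P).add (hν.integrable_Cr2 P)

lemma R0_balanced_iff {μ : ℝ} (hμ : μ ∈ Set.Ioo (0 : ℝ) 1) :
    R0.Balanced P ν μ ↔ flow₁ P ν μ μ + flow₂ P ν μ μ = 0 := by
  have hq := hν.R0_q_ae_eq (P := P) hμ
  rw [hν.flow_add P, (isRule_macRule P μ μ).net_eq (hν.integrable_Cr P)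
    (hν.integrable_relay P), sub_eq_zero, R0.Balanced]
  have e1 : ∫ s, R0.q P μ s * Cr P s ∂ν = ∫ s, macRule P μ μ s * Cr P s ∂ν :=
    integral_congr_ae (hq.mono fun s hs => by simp only [hs])
  have e2 : ∫ s, (1 - R0.q P μ s) * (Cr1 P s + Cr2 P s) ∂ν =
      ∫ s, (1 - macRule P μ μ s) * (Cr1 P s + Cr2 P s) ∂ν :=
    integral_congr_ae (hq.mono fun s hs => by simp only [hs])
  rw [e1, e2]

lemma exists_R0_balanced (P : Powers) : ∃ μ ∈ Set.Ioo (0 : ℝ) 1, R0.Balanced P ν μ := by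
  obtain ⟨μ, hμ, h0⟩ := hν.exists_flow_add_eq_zero P
  exact ⟨μ, hμ, (hν.R0_balanced_iff hμ).2 h0⟩

/-- The loss of multiple access against separate transmissions, where `macRule` selects it. -/
lemma R0_t_eq {μ : ℝ} (hμ : μ ∈ Set.Ioo (0 : ℝ) 1) : R0.t P ν μ =
    flow₁ P ν μ μ / ∫ s, macRule P μ μ s * (Cr P s - C1r P s - C2r P s) ∂ν := by
  have hq := hν.R0_q_ae_eq (P := P) hμ
  rw [flow₁, (isRule_macRule P μ μ).net_eq (hν.integrable_Cr_sub P) (hν.integrable_Cr2 P), R0.t]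
  congr 1
  · congr 1 <;> exact integral_congr_ae (hq.mono fun s hs => by simp only [hs])
  · exact integral_congr_ae (hq.mono fun s hs => by simp only [hs])

/-- Pointwise `Cr < C1r + C2r`, and a balanced rule selects reception with positive probability. -/
lemma R0_loss_neg {μ : ℝ} (h0 : flow₁ P ν μ μ + flow₂ P ν μ μ = 0) :
    ∫ s, macRule P μ μ s * (Cr P s - C1r P s - C2r P s) ∂ν < 0 := by
  have := hν.neZero
  rw [hν.flow_add P] at h0
  have h := ((isRule_macRule P μ μ).pos_of_net_eq_zero (hν.integrable_Cr P)
    (hν.integrable_relay P) (hν.ae_Cr_pos P)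
    (by filter_upwards [hν.ae_Cr1_pos P, hν.ae_Cr2_pos P] with s h2 h3 using add_pos h2 h3) h0
    (g := fun s => C1r P s + C2r P s - Cr P s)
    (((hν.integrable_C1r P).add (hν.integrable_C2r P)).sub (hν.integrable_Cr P))
    (hν.pos.mono fun s hs => sub_pos.2 (Cr_lt_add hs.1 hs.2))).1
  rw [← neg_pos, ← integral_neg]
  refine h.trans_eq (integral_congr_ae (ae_of_all _ fun s => ?_))
  ring

end IsGainLaw

/-! ### From the flows of one slot to the long-term rates -/

/-- A weight determined by the coins of the slot. -/
structure IsWeight (w : (Coin → ℝ) → ℝ) : Prop where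
  measurable : Measurable w
  mem : ∀ x : Coin → ℝ, (∀ n, x n = 0 ∨ x n = 1) → w x ∈ Set.Icc (0 : ℝ) 1

lemma IsWeight.one : IsWeight fun _ => 1 := ⟨measurable_const, fun _ _ => by simp⟩

lemma IsWeight.coin (n : Coin) : IsWeight fun x => x n :=
  ⟨by fun_prop, fun x hx => by rcases hx n with h | h <;> simp [h]⟩

lemma IsWeight.compl {w : (Coin → ℝ) → ℝ} (hw : IsWeight w) : IsWeight fun x => 1 - w x :=
  ⟨hw.measurable.const_sub 1, fun x hx =>
    ⟨sub_nonneg.2 (hw.mem x hx).2, sub_le_self _ (hw.mem x hx).1⟩⟩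

lemma IsWeight.mul {w w' : (Coin → ℝ) → ℝ} (hw : IsWeight w) (hw' : IsWeight w') :
    IsWeight fun x => w x * w' x :=
  ⟨hw.measurable.mul hw'.measurable, fun x hx => ⟨mul_nonneg (hw.mem x hx).1 (hw'.mem x hx).1,
    mul_le_one₀ (hw.mem x hx).2 (hw'.mem x hx).1 (hw'.mem x hx).2⟩⟩

/-- A nonnegative square-integrable function of the channel state. -/
structure IsFlow (ν : Measure (ℝ × ℝ)) (f : ℝ × ℝ → ℝ) : Prop where
  measurable : Measurable f
  nonneg : ∀ᵐ s ∂ν, 0 ≤ f s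
  memLp : MemLp f 2 ν

lemma IsRule.isFlow_mul {ν : Measure (ℝ × ℝ)} {φ f : ℝ × ℝ → ℝ} (hφ : IsRule φ) (hf : IsFlow ν f) :
    IsFlow ν fun s => φ s * f s := by
  have hm := hφ.measurable.mul hf.measurable
  refine ⟨hm, hf.nonneg.mono fun s hs => mul_nonneg (hφ.mem s).1 hs,
    hf.memLp.mono hm.aestronglyMeasurable (ae_of_all _ fun s => ?_)⟩
  rw [norm_mul, Real.norm_of_nonneg (hφ.mem s).1]
  exact mul_le_of_le_one_left (norm_nonneg _) (hφ.mem s).2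

namespace IsGainLaw

variable {ν : Measure (ℝ × ℝ)} (hν : IsGainLaw ν) (P : Powers)
include hν

lemma isFlow_C2r : IsFlow ν (C2r P) :=
  ⟨by fun_prop, (hν.ae_C2r_pos P).mono fun _ h => h.le, hν.memLp_C2r P⟩
lemma isFlow_Cr1 : IsFlow ν (Cr1 P) :=
  ⟨by fun_prop, (hν.ae_Cr1_pos P).mono fun _ h => h.le, hν.memLp_Cr1 P⟩
lemma isFlow_Cr2 : IsFlow ν (Cr2 P) :=
  ⟨by fun_prop, (hν.ae_Cr2_pos P).mono fun _ h => h.le, hν.memLp_Cr2 P⟩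
lemma isFlow_Cr_sub : IsFlow ν fun s => Cr P s - C2r P s :=
  ⟨by fun_prop, (hν.ae_Cr_sub_pos P).mono fun _ h => h.le, (hν.memLp_Cr P).sub (hν.memLp_C2r P)⟩

lemma isFlow_C12r {t : ℝ} (ht : t ∈ Set.Icc (0 : ℝ) 1) : IsFlow ν (C12r P t) := by
  refine ⟨by fun_prop, hν.pos.mono fun s h => C12r_nonneg ht h.1.le h.2.le, ?_⟩
  refine (memLp_congr_ae ?_).2 (((hν.memLp_C1r P).const_mul t).add
    (((hν.memLp_Cr P).sub (hν.memLp_C2r P)).const_mul (1 - t)))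
  exact hν.pos.mono fun s h => C12r_eq t h.1.le h.2.le

lemma isFlow_C21r {t : ℝ} (ht : t ∈ Set.Icc (0 : ℝ) 1) : IsFlow ν (C21r P t) := by
  refine ⟨by fun_prop, hν.pos.mono fun s h => C21r_nonneg ht h.1.le h.2.le, ?_⟩
  refine (memLp_congr_ae ?_).2 (((hν.memLp_C2r P).const_mul (1 - t)).add
    (((hν.memLp_Cr P).sub (hν.memLp_C1r P)).const_mul t))
  exact hν.pos.mono fun s h => C21r_eq t h.1.le h.2.le

end IsGainLaw

/-- The parameters are feasible and the policy is optimal and uses `M3` and `M6`, for every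
realization of the coins. -/
def Achieves {Ω : Type*} [MeasurableSpace Ω] (ρ : Measure Ω) (P : Powers) (S : ℕ → Ω → ℝ × ℝ)
    (b₁ b₂ : ℝ) (d : Params) (sel : (Mode → ℝ) → ℝ × ℝ → Mode) : Prop :=
  d.μ₁ ∈ Set.Icc (0 : ℝ) 1 ∧ d.μ₂ ∈ Set.Icc (0 : ℝ) 1 ∧ d.t ∈ Set.Icc (0 : ℝ) 1 ∧
  (∀ n, d.p n ∈ Set.Icc (0 : ℝ) 1) ∧
  ∀ X : Coin → ℕ → Ω → ℝ, IsCoinFlips ρ S d.p X →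
    (∃ R₁ R₂ : ℝ, ∀ᵐ ω ∂ρ, IsOptimal P (fun i => S i ω) b₁ b₂
      (fun i => pick (selected d sel S X i ω)) (fun _ => d.t) R₁ R₂) ∧
    (∀ i, 0 < ρ {ω | selected d sel S X i ω = .M3}) ∧
    (∀ i, 0 < ρ {ω | selected d sel S X i ω = .M6})

section Slots

variable {Ω : Type*} [MeasurableSpace Ω] {ρ : Measure Ω} [IsProbabilityMeasure ρ]
  {S : ℕ → Ω → ℝ × ℝ} {p : Coin → ℝ} {X : Coin → ℕ → Ω → ℝ}

lemma IsCoinFlips.integral_coin (hX : IsCoinFlips ρ S p X) {n : Coin} (hp : 0 ≤ p n) :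
    ∫ ω, X n 0 ω ∂ρ = p n := by
  have h1 : X n 0 =ᵐ[ρ] Set.indicator {ω | X n 0 ω = 1} 1 := by
    filter_upwards [hX.ae_zero_or_one] with ω hω
    rcases hω 0 n with h | h <;> simp [Set.indicator, h]
  have hm : MeasurableSet {ω | X n 0 ω = 1} := hX.measurable n 0 (measurableSet_singleton 1)
  rw [integral_congr_ae h1, integral_indicator_one hm, measureReal_def, hX.prob_one, ENNReal.toReal_ofReal hp]

lemma IsCoinFlips.integrable_coin (hX : IsCoinFlips ρ S p X) (n : Coin) :
    Integrable (X n 0) ρ :=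
  Integrable.of_mem_Icc 0 1 (hX.measurable n 0).aemeasurable (by
    filter_upwards [hX.ae_zero_or_one] with ω hω
    rcases hω 0 n with h | h <;> simp [h])

omit [IsProbabilityMeasure ρ] in
lemma IsCoinFlips.indepFun_coin (hX : IsCoinFlips ρ S p X) {m n : Coin} (hmn : m ≠ n) :
    IndepFun (X m 0) (X n 0) ρ :=
  hX.indep.indepFun (i := (m, 0)) (j := (n, 0)) fun h => hmn (congrArg Prod.fst h)

lemma IsCoinFlips.integral_coin_mul (hX : IsCoinFlips ρ S p X) {m n : Coin} (hmn : m ≠ n)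
    (hm : 0 ≤ p m) (hn : 0 ≤ p n) : ∫ ω, X m 0 ω * X n 0 ω ∂ρ = p m * p n := by
  rw [(hX.indepFun_coin hmn).integral_fun_mul_eq_mul_integral
    (hX.measurable m 0).aestronglyMeasurable (hX.measurable n 0).aestronglyMeasurable,
    hX.integral_coin hm, hX.integral_coin hn]

lemma IsCoinFlips.integral_one_sub_coin (hX : IsCoinFlips ρ S p X) {n : Coin} (hp : 0 ≤ p n) :
    ∫ ω, (1 - X n 0 ω) ∂ρ = 1 - p n := by
  rw [integral_sub (integrable_const 1) (hX.integrable_coin n), hX.integral_coin hp]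
  simp

lemma IsCoinFlips.integral_one_sub_coin_mul (hX : IsCoinFlips ρ S p X) {m n : Coin} (hmn : m ≠ n)
    (hm : 0 ≤ p m) (hn : 0 ≤ p n) : ∫ ω, (1 - X m 0 ω) * X n 0 ω ∂ρ = (1 - p m) * p n := by
  have h : IndepFun (fun ω => 1 - X m 0 ω) (X n 0) ρ :=
    (hX.indepFun_coin hmn).comp (φ := fun x => 1 - x) (ψ := id) (by fun_prop) measurable_id
  rw [h.integral_fun_mul_eq_mul_integral
    ((hX.measurable m 0).const_sub 1).aestronglyMeasurable (hX.measurable n 0).aestronglyMeasurable,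
    hX.integral_coin hn, hX.integral_one_sub_coin hm]

/-- A flow that is positive in the mean is positive with positive probability in every slot. -/
lemma IsCoinFlips.measure_pos_of_flow (hS : IsFading ρ S) (hX : IsCoinFlips ρ S p X)
    {w : (Coin → ℝ) → ℝ} {f : ℝ × ℝ → ℝ} (hw : IsWeight w) (hf : IsFlow (ρ.map (S 0)) f)
    (hpos : 0 < (∫ ω, w (fun n => X n 0 ω) ∂ρ) * ∫ s, f s ∂(ρ.map (S 0))) (i : ℕ) {A : Set Ω}
    (hA : ∀ᵐ ω ∂ρ, w (fun n => X n i ω) * f (S i ω) ≠ 0 → ω ∈ A) : 0 < ρ A := by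
  rw [pos_iff_ne_zero]
  intro h0
  have hXm : ∀ i, Measurable fun ω n => X n i ω := fun i =>
    measurable_pi_lambda _ fun n => hX.measurable n i
  have hSm : Measurable fun ω i => S i ω := measurable_pi_lambda _ hS.measurable
  have hCm : Measurable fun ω (k : Coin × ℕ) => X k.1 k.2 ω :=
    measurable_pi_lambda _ fun k => hX.measurable _ _
  have hind := hX.indep_channel.integral_fun_comp_mul_comp hCm.aemeasurable hSm.aemeasurable
    (f := fun x => w (fun n => x (n, i))) (g := fun s : ℕ → ℝ × ℝ => f (s i))
    (hw.measurable.comp (by fun_prop)).aestronglyMeasurable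
    (hf.measurable.comp (g := f) (f := fun s : ℕ → ℝ × ℝ => s i)
      (measurable_pi_apply i)).aestronglyMeasurable
  have hzero : ∫ ω, w (fun n => X n i ω) * f (S i ω) ∂ρ = 0 := by
    rw [integral_eq_zero_of_ae]
    filter_upwards [hA, measure_eq_zero_iff_ae_notMem.1 h0] with ω h1 h2
    by_contra hne
    exact h2 (h1 hne)
  have hwi : ∫ ω, w (fun n => X n i ω) ∂ρ = ∫ ω, w (fun n => X n 0 ω) ∂ρ := by
    rw [← integral_map (hXm i).aemeasurable hw.measurable.aestronglyMeasurable, hX.map_slot_eq i,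
      integral_map (hXm 0).aemeasurable hw.measurable.aestronglyMeasurable]
  have hfi : ∫ ω, f (S i ω) ∂ρ = ∫ s, f s ∂(ρ.map (S 0)) := by
    rw [← hS.map_eq i, integral_map (hS.measurable i).aemeasurable
      hf.measurable.aestronglyMeasurable]
  rw [hwi, hfi] at hind
  linarith

/-- If the rates of a slot are products of a weight and a flow, which balance in the mean, and the
selected mode maximizes the Lagrangian, then the policy is optimal. -/
theorem achieves_of_slot_rates (hS : IsFading ρ S) {P : Powers} {d : Params}
    {sel : (Mode → ℝ) → ℝ × ℝ → Mode} {b₁ b₂ : ℝ} (hb₁ : 0 ≤ b₁) (hb₂ : 0 ≤ b₂)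
    (hμ₂ : 0 ≤ d.μ₂) (hμ : d.μ₂ ≤ d.μ₁) (hμ₁ : d.μ₁ ≤ 1) (ht : d.t ∈ Set.Icc (0 : ℝ) 1)
    (hp : ∀ n, d.p n ∈ Set.Icc (0 : ℝ) 1)
    {w₁ w₂ w₃ w₄ : (Coin → ℝ) → ℝ} {f₁ f₂ f₃ f₄ : ℝ × ℝ → ℝ}
    (hw₁ : IsWeight w₁) (hw₂ : IsWeight w₂) (hw₃ : IsWeight w₃) (hw₄ : IsWeight w₄)
    (hf₁ : IsFlow (ρ.map (S 0)) f₁) (hf₂ : IsFlow (ρ.map (S 0)) f₂)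
    (hf₃ : IsFlow (ρ.map (S 0)) f₃) (hf₄ : IsFlow (ρ.map (S 0)) f₄)
    (hrates : ∀ᵐ s ∂(ρ.map (S 0)), ∀ x : Coin → ℝ, (∀ n, x n = 0 ∨ x n = 1) → ∀ m,
      m = sel (d.ind x) s → m ≠ .M1 ∧ m ≠ .M4 ∧
      pick m .M1 * C1r P s + pick m .M3 * C12r P d.t s = w₁ x * f₁ s ∧
      pick m .M2 * C2r P s + pick m .M3 * C21r P d.t s = w₂ x * f₂ s ∧
      (pick m .M5 + pick m .M6) * Cr2 P s = w₃ x * f₃ s ∧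
      (pick m .M4 + pick m .M6) * Cr1 P s = w₄ x * f₄ s ∧
      metric P d.μ₁ d.μ₂ 0 s .M3 ≤ metric P d.μ₁ d.μ₂ d.t s m ∧
      metric P d.μ₁ d.μ₂ 0 s .M6 ≤ metric P d.μ₁ d.μ₂ d.t s m)
    (hmeans : ∀ X : Coin → ℕ → Ω → ℝ, IsCoinFlips ρ S d.p X →
      (∫ ω, w₁ (fun n => X n 0 ω) ∂ρ) * (∫ s, f₁ s ∂(ρ.map (S 0))) =
        (∫ ω, w₃ (fun n => X n 0 ω) ∂ρ) * (∫ s, f₃ s ∂(ρ.map (S 0))) ∧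
      (∫ ω, w₂ (fun n => X n 0 ω) ∂ρ) * (∫ s, f₂ s ∂(ρ.map (S 0))) =
        (∫ ω, w₄ (fun n => X n 0 ω) ∂ρ) * (∫ s, f₄ s ∂(ρ.map (S 0))) ∧
      0 < (∫ ω, w₁ (fun n => X n 0 ω) ∂ρ) * (∫ s, f₁ s ∂(ρ.map (S 0))) ∧
      0 < (∫ ω, w₄ (fun n => X n 0 ω) ∂ρ) * (∫ s, f₄ s ∂(ρ.map (S 0)))) :
    Achieves ρ P S b₁ b₂ d sel := by
  have hν := hS.isGainLaw
  refine ⟨⟨hμ₂.trans hμ, hμ₁⟩, ⟨hμ₂, hμ.trans hμ₁⟩, ht, hp, fun X hX => ?_⟩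
  obtain ⟨e₁, e₂, hpos₁, hpos₄⟩ := hmeans X hX
  have hslot : ∀ᵐ ω ∂ρ, ∀ i, ∀ m, m = selected d sel S X i ω → m ≠ .M1 ∧ m ≠ .M4 ∧
      pick m .M1 * C1r P (S i ω) + pick m .M3 * C12r P d.t (S i ω) =
        w₁ (fun n => X n i ω) * f₁ (S i ω) ∧
      pick m .M2 * C2r P (S i ω) + pick m .M3 * C21r P d.t (S i ω) =
        w₂ (fun n => X n i ω) * f₂ (S i ω) ∧
      (pick m .M5 + pick m .M6) * Cr2 P (S i ω) = w₃ (fun n => X n i ω) * f₃ (S i ω) ∧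
      (pick m .M4 + pick m .M6) * Cr1 P (S i ω) = w₄ (fun n => X n i ω) * f₄ (S i ω) ∧
      metric P d.μ₁ d.μ₂ 0 (S i ω) .M3 ≤ metric P d.μ₁ d.μ₂ d.t (S i ω) m ∧
      metric P d.μ₁ d.μ₂ 0 (S i ω) .M6 ≤ metric P d.μ₁ d.μ₂ d.t (S i ω) m := by
    filter_upwards [hS.ae_of_ae_law hrates, hX.ae_zero_or_one] with ω h1 h2 i
    exact h1 i _ (h2 i)
  refine ⟨⟨(∫ ω, w₁ (fun n => X n 0 ω) ∂ρ) * (∫ s, f₁ s ∂(ρ.map (S 0))),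
    (∫ ω, w₂ (fun n => X n 0 ω) ∂ρ) * (∫ s, f₂ s ∂(ρ.map (S 0))), ?_⟩, fun i => ?_, fun i => ?_⟩
  · filter_upwards [hslot, hS.ae_of_ae_law hν.pos,
      hX.ae_hasMean_mul hS hw₁.measurable hw₁.mem hf₁.measurable hf₁.nonneg hf₁.memLp,
      hX.ae_hasMean_mul hS hw₂.measurable hw₂.mem hf₂.measurable hf₂.nonneg hf₂.memLp,
      hX.ae_hasMean_mul hS hw₃.measurable hw₃.mem hf₃.measurable hf₃.nonneg hf₃.memLp,
      hX.ae_hasMean_mul hS hw₄.measurable hw₄.mem hf₄.measurable hf₄.nonneg hf₄.memLp]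
      with ω hω hpos m₁ m₂ m₃ m₄
    rw [← e₁] at m₃
    rw [← e₂] at m₄
    refine isOptimal_of_balanced (fun i => ⟨(hpos i).1.le, (hpos i).2.le⟩) hb₁ hb₂
      (admissible_pick _ ht) ⟨hμ₂.trans hμ, hμ₁⟩ ⟨hμ₂, hμ.trans hμ₁⟩ ?_ ?_ ?_ ?_ ?_
    · convert! m₁ using 1; exact funext fun i => (hω i _ rfl).2.2.1
    · convert! m₂ using 1; exact funext fun i => (hω i _ rfl).2.2.2.1
    · convert! m₃ using 1; exact funext fun i => (hω i _ rfl).2.2.2.2.1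
    · convert! m₄ using 1; exact funext fun i => (hω i _ rfl).2.2.2.2.2.1
    · intro i k t' ht'
      have hsum : ∑ k', pick (selected d sel S X i ω) k' * metric P d.μ₁ d.μ₂ d.t (S i ω) k' =
          metric P d.μ₁ d.μ₂ d.t (S i ω) (selected d sel S X i ω) := by simp [pick]
      rw [hsum]
      exact (metric_le_max P hμ₂ hμ hμ₁ ht' (hpos i).1.le (hpos i).2.le k).trans
        (max_le (hω i _ rfl).2.2.2.2.2.2.1 (hω i _ rfl).2.2.2.2.2.2.2)
  · refine hX.measure_pos_of_flow hS hw₁ hf₁ hpos₁ i ?_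
    filter_upwards [hslot] with ω hω hne
    -- As M1 is never selected, a positive rate from user 1 reveals M3; likewise, as M4 is never
    -- selected, a positive capacity to user 1 reveals M6.
    obtain ⟨h1, -, h3, -⟩ := hω i _ rfl
    rw [← h3] at hne
    by_contra h
    exact hne (by simp [pick, Ne.symm h1, Ne.symm (show selected d sel S X i ω ≠ .M3 from h)])
  · refine hX.measure_pos_of_flow hS hw₄ hf₄ hpos₄ i ?_
    filter_upwards [hslot] with ω hω hne
    obtain ⟨-, h1, -, -, -, h3, -⟩ := hω i _ rfl
    rw [← h3] at hne
    by_contra h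
    exact hne (by simp [pick, Ne.symm h1, Ne.symm (show selected d sel S X i ω ≠ .M6 from h)])

end Slots

/-! ### The policies of region `R₁` -/

lemma C12r_zero (P : Powers) {s : ℝ × ℝ} (h1 : 0 ≤ s.1) (h2 : 0 ≤ s.2) :
    C12r P 0 s = Cr P s - C2r P s := by rw [C12r_eq 0 h1 h2]; ring

lemma C21r_zero (P : Powers) {s : ℝ × ℝ} (h1 : 0 ≤ s.1) (h2 : 0 ≤ s.2) :
    C21r P 0 s = C2r P s := by rw [C21r_eq 0 h1 h2]; ring

section

variable {Ω : Type*} [MeasurableSpace Ω] {ρ : Measure Ω} [IsProbabilityMeasure ρ]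
  {S : ℕ → Ω → ℝ × ℝ} {P : Powers} {d : Params} {sel : (Mode → ℝ) → ℝ × ℝ → Mode} {b₁ b₂ : ℝ}

/-- Membership in the region carries its own threshold; the rule, and with it the sign of the flow,
is the same for every other balancing threshold. -/
lemma InR1.flow₁_pos {ν : Measure (ℝ × ℝ)} (hν : IsGainLaw ν) (hR : InR1 P ν) (h : P.Pr < P.P₂)
    {μ : ℝ} (h0 : flow₂ P ν 1 μ = 0) : 0 < flow₁ P ν 1 μ := by
  obtain ⟨μ', -, hb, hω⟩ := hR
  have h0' := (hν.R1_balanced_iff_of_gt h μ').1 hb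
  have hω' : R1.ω₁ P ν μ' < 1 := by
    rcases hω with h' | h' | h'
    · exact h'.2
    · exact absurd h'.1 h.not_gt
    · exact absurd h'.1 h.ne'
  rw [hν.R1_ω₁_lt_one_iff h h0'] at hω'
  rwa [flow₁, net_congr (hν.macRule_ae_eq_of_flow₂_eq P (h0.trans h0'.symm))]

lemma InR1.flow₂_neg {ν : Measure (ℝ × ℝ)} (hν : IsGainLaw ν) (hR : InR1 P ν) (h : P.P₂ < P.Pr)
    {μ : ℝ} (h0 : flow₁ P ν μ 0 = 0) : flow₂ P ν μ 0 < 0 := by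
  obtain ⟨μ', -, hb, hω⟩ := hR
  have h0' := (hν.R1_balanced_iff_of_lt h μ').1 hb
  have hω' : R1.ω₂ P ν μ' < 1 := by
    rcases hω with h' | h' | h'
    · exact absurd h'.1 h.not_gt
    · exact h'.2
    · exact absurd h'.1 h.ne
  rw [hν.R1_ω₂_lt_one_iff h h0'] at hω'
  rwa [flow₂, net_congr (hν.macRule_ae_eq_of_flow₁_eq P (h0.trans h0'.symm))]

lemma macRule_of_pos {x y : ℝ} {s : ℝ × ℝ} (h : 0 < gap P x y s) : macRule P x y s = 1 :=
  if_pos h.le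

lemma macRule_of_neg {x y : ℝ} {s : ℝ × ℝ} (h : gap P x y s < 0) : macRule P x y s = 0 :=
  if_neg (not_le.2 h)

/-- At μ₁ = 1 the modes M2 and M3 (with t = 0) have the same metric and the same rate for user 2,
while only M3 brings in data of user 1. The coin thins this inflow by ω₁ and loses nothing in the
Lagrangian. -/
theorem achieves_R1_of_gt (hS : IsFading ρ S) (hb₁ : 0 ≤ b₁) (hb₂ : 0 ≤ b₂) (h : P.Pr < P.P₂)
    (hR : InR1 P (ρ.map (S 0))) (hsel : IsArgmaxRule P d sel) (ht : d.t = 0) (hμ₁ : d.μ₁ = 1)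
    (hμ₂ : d.μ₂ ∈ Set.Icc (0 : ℝ) 1) (hbal : R1.Balanced P (ρ.map (S 0)) d.μ₂)
    (hp : d.p = coinVec (R1.ω₁ P (ρ.map (S 0)) d.μ₂) 0 0 0 0)
    (hind : d.ind = fun x => modeVec 0 (1 - x .X1) (x .X1) 0 0 1) :
    Achieves ρ P S b₁ b₂ d sel := by
  have hν := hS.isGainLaw
  set ν := ρ.map (S 0) with hνdef
  have h0 := (hν.R1_balanced_iff_of_gt h d.μ₂).1 hbal
  have hω0 := hν.R1_ω₁_pos h h0
  have hω1 := (hν.R1_ω₁_lt_one_iff h h0).2 (hR.flow₁_pos hν h h0)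
  have hφ := isRule_macRule P 1 d.μ₂
  have hpos := fun {g : ℝ × ℝ → ℝ} (hg : Integrable g ν) (hg' : ∀ᵐ s ∂ν, 0 < g s) =>
    hν.pos_of_flow₂_eq_zero h0 hg hg'
  have hp1 : d.p .X1 = R1.ω₁ P ν d.μ₂ := by rw [hp]; rfl
  refine achieves_of_slot_rates hS hb₁ hb₂ hμ₂.1 (hμ₁ ▸ hμ₂.2) hμ₁.le (by simp [ht]) ?_
    (.coin .X1) .one .one .one (hφ.isFlow_mul (hν.isFlow_Cr_sub P))
    (hφ.isFlow_mul (hν.isFlow_C2r P)) (hφ.compl.isFlow_mul (hν.isFlow_Cr2 P))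
    (hφ.compl.isFlow_mul (hν.isFlow_Cr1 P)) ?_ ?_
  · rw [hp]
    rintro (_ | _ | _ | _ | _) <;> simp [coinVec, hω0.le, hω1.le]
  · filter_upwards [hν.pos, hν.ae_gap_ne P (x := 1) (y := d.μ₂) (Or.inr (Or.inr h.ne')),
      hν.ae_Cr1_pos P, hν.ae_Cr2_pos P] with s hs hg hr1 hr2 x hx m hm
    have hmax : ∀ k, d.ind x k * metric P d.μ₁ d.μ₂ d.t s k ≤
      d.ind x m * metric P d.μ₁ d.μ₂ d.t s m := by
        rw [hm]; exact hsel.argmax (d.ind x) s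
    have hge := gap_eq P 1 d.μ₂ hs.1.le hs.2.le
    -- A candidate with positive metric rules out every mode with indicator 0, whose product is 0.
    have hu : 0 < Cr2 P s + d.μ₂ * Cr1 P s := by nlinarith [mul_nonneg hμ₂.1 hr1.le]
    have k2 := hmax .M2
    have k3 := hmax .M3
    have k6 := hmax .M6
    rw [hind, hμ₁, ht] at k2 k3 k6
    rw [hμ₁, ht]
    simp only [metric, modeVec, C12r_zero P hs.1.le hs.2.le, C21r_zero P hs.1.le hs.2.le]
      at k2 k3 k6 hge ⊢
    rcases lt_or_gt_of_ne hg with hlt | hlt <;> rcases hx .X1 with hx1 | hx1 <;>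
      rw [hx1] at k2 k3 k6 ⊢ <;> (first | rw [macRule_of_neg hlt] | rw [macRule_of_pos hlt]) <;>
      cases m <;> simp [pick] at k2 k3 k6 ⊢ <;> (try constructor) <;> linarith
  · intro X hX
    have e1 := hX.integral_coin (n := .X1) (by rw [hp1]; exact hω0.le)
    simp only [e1, hp1, integral_const, probReal_univ, smul_eq_mul, one_mul]
    have hd := (hpos (hν.integrable_Cr_sub P) (hν.ae_Cr_sub_pos P)).1
    have hn := (hpos (hν.integrable_Cr2 P) (hν.ae_Cr2_pos P)).2
    have hb := h0
    rw [flow₂, hφ.net_eq (hν.integrable_C2r P) (hν.integrable_Cr1 P), sub_eq_zero] at hb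
    refine ⟨?_, hb, mul_pos hω0 hd, (hpos (hν.integrable_Cr1 P) (hν.ae_Cr1_pos P)).2⟩
    rw [hν.R1_ω₁_eq h, div_mul_cancel₀ _ hd.ne']

/-- At μ₂ = 0 the modes M5 and M6 have the same metric, and only M6 serves user 1. The coin thins
this service by ω₂. -/
theorem achieves_R1_of_lt (hS : IsFading ρ S) (hb₁ : 0 ≤ b₁) (hb₂ : 0 ≤ b₂) (h : P.P₂ < P.Pr)
    (hR : InR1 P (ρ.map (S 0))) (hsel : IsArgmaxRule P d sel) (ht : d.t = 0) (hμ₂ : d.μ₂ = 0)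
    (hμ₁ : d.μ₁ ∈ Set.Icc (0 : ℝ) 1) (hbal : R1.Balanced P (ρ.map (S 0)) d.μ₁)
    (hp : d.p = coinVec 0 (R1.ω₂ P (ρ.map (S 0)) d.μ₁) 0 0 0)
    (hind : d.ind = fun x => modeVec 0 0 1 0 (1 - x .X2) (x .X2)) :
    Achieves ρ P S b₁ b₂ d sel := by
  have hν := hS.isGainLaw
  set ν := ρ.map (S 0) with hνdef
  have h0 := (hν.R1_balanced_iff_of_lt h d.μ₁).1 hbal
  have hω0 := hν.R1_ω₂_pos h h0
  have hω1 := (hν.R1_ω₂_lt_one_iff h h0).2 (hR.flow₂_neg hν h h0)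
  have hφ := isRule_macRule P d.μ₁ 0
  have hpos := fun {g : ℝ × ℝ → ℝ} (hg : Integrable g ν) (hg' : ∀ᵐ s ∂ν, 0 < g s) =>
    hν.pos_of_flow₁_eq_zero h0 hg hg'
  have hp2 : d.p .X2 = R1.ω₂ P ν d.μ₁ := by rw [hp]; rfl
  refine achieves_of_slot_rates hS hb₁ hb₂ hμ₂.ge (hμ₂ ▸ hμ₁.1) hμ₁.2 (by simp [ht]) ?_
    .one .one .one (.coin .X2) (hφ.isFlow_mul (hν.isFlow_Cr_sub P))
    (hφ.isFlow_mul (hν.isFlow_C2r P)) (hφ.compl.isFlow_mul (hν.isFlow_Cr2 P))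
    (hφ.compl.isFlow_mul (hν.isFlow_Cr1 P)) ?_ ?_
  · rw [hp]
    rintro (_ | _ | _ | _ | _) <;> simp [coinVec, hω0.le, hω1.le]
  · filter_upwards [hν.pos, hν.ae_gap_ne P (x := d.μ₁) (y := 0) (Or.inr (Or.inr h.ne)),
      hν.ae_Cr_sub_pos P, hν.ae_C2r_pos P] with s hs hg hr1 hr2 x hx m hm
    have hmax : ∀ k, d.ind x k * metric P d.μ₁ d.μ₂ d.t s k ≤
      d.ind x m * metric P d.μ₁ d.μ₂ d.t s m := by
        rw [hm]; exact hsel.argmax (d.ind x) s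
    have hge := gap_eq P d.μ₁ 0 hs.1.le hs.2.le
    -- The multiple-access metric is positive, so modes with indicator 0 are never selected.
    have hu : 0 < (1 - d.μ₁) * (Cr P s - C2r P s) + C2r P s := by
      nlinarith [mul_nonneg (sub_nonneg.2 hμ₁.2) hr1.le]
    have k3 := hmax .M3
    have k5 := hmax .M5
    have k6 := hmax .M6
    rw [hind, hμ₂, ht] at k3 k5 k6
    rw [hμ₂, ht]
    simp only [metric, modeVec, C12r_zero P hs.1.le hs.2.le, C21r_zero P hs.1.le hs.2.le]
      at k3 k5 k6 hge ⊢
    rcases lt_or_gt_of_ne hg with hlt | hlt <;> rcases hx .X2 with hx1 | hx1 <;>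
      rw [hx1] at k3 k5 k6 ⊢ <;> (first | rw [macRule_of_neg hlt] | rw [macRule_of_pos hlt]) <;>
      cases m <;> simp [pick] at k3 k5 k6 ⊢ <;> (try constructor) <;> linarith
  · intro X hX
    have e1 := hX.integral_coin (n := .X2) (by rw [hp2]; exact hω0.le)
    simp only [e1, hp2, integral_const, probReal_univ, smul_eq_mul, one_mul]
    have hd := (hpos (hν.integrable_Cr1 P) (hν.ae_Cr1_pos P)).2
    have hb := h0
    rw [flow₁, hφ.net_eq (hν.integrable_Cr_sub P) (hν.integrable_Cr2 P), sub_eq_zero] at hb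
    refine ⟨hb, ?_, (hpos (hν.integrable_Cr_sub P) (hν.ae_Cr_sub_pos P)).1, mul_pos hω0 hd⟩
    rw [hν.R1_ω₂_eq h, div_mul_cancel₀ _ hd.ne']

end

/-! ### Region R₁ with equal powers, and region R₀ -/

section

variable {Ω : Type*} [MeasurableSpace Ω] {ρ : Measure Ω} [IsProbabilityMeasure ρ]
  {S : ℕ → Ω → ℝ × ℝ} {P : Powers} {d : Params} {sel : (Mode → ℝ) → ℝ × ℝ → Mode} {b₁ b₂ : ℝ}

/-- At (1,0) with t = 0 the metrics of M2, M3, M5, M6 all equal `C2r = Cr2`, so the coins alone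
decide: X₃ between receiving and sending, X₄ between M2 and M3, X₅ between M5 and M6. The two
balance equations determine p₄ and p₅, and p₄ ≤ 1, p₅ ≤ 1 amount to ω₃l ≤ p₃ ≤ ω₃u. -/
theorem achieves_R1_of_eq (hS : IsFading ρ S) (hb₁ : 0 ≤ b₁) (hb₂ : 0 ≤ b₂) (h : P.P₂ = P.Pr)
    (hsel : IsArgmaxRule P d sel) (ht : d.t = 0) (hμ₁ : d.μ₁ = 1) (hμ₂ : d.μ₂ = 0)
    {p₃ : ℝ} (hp₃ : p₃ ∈ Set.Icc (R1.ω₃l P (ρ.map (S 0))) (R1.ω₃u P (ρ.map (S 0))))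
    (hp : d.p = coinVec 0 0 p₃
      ((1 - p₃) * R1.ω₃l P (ρ.map (S 0)) / (p₃ * (1 - R1.ω₃l P (ρ.map (S 0)))))
      (p₃ * (1 - R1.ω₃u P (ρ.map (S 0))) / ((1 - p₃) * R1.ω₃u P (ρ.map (S 0)))))
    (hind : d.ind = fun x => modeVec 0 (x .X3 * (1 - x .X4)) (x .X3 * x .X4) 0
      ((1 - x .X3) * (1 - x .X5)) ((1 - x .X3) * x .X5)) :
    Achieves ρ P S b₁ b₂ d sel := by
  have hν := hS.isGainLaw
  set ν := ρ.map (S 0) with hνdef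
  have := hν.neZero
  have hl := hν.R1_ω₃l_mem h
  have hu := hν.R1_ω₃u_mem P
  have hA := integral_pos_of_ae_pos (hν.integrable_Cr2 P) (hν.ae_Cr2_pos P)
  have hB := integral_pos_of_ae_pos (hν.integrable_Cr1 P) (hν.ae_Cr1_pos P)
  have hF := integral_pos_of_ae_pos (hν.integrable_Cr_sub P) (hν.ae_Cr_sub_pos P)
  have hC : ∫ s, C2r P s ∂ν = ∫ s, Cr2 P s ∂ν :=
    integral_congr_ae (ae_of_all _ fun s => IsGainLaw.C2r_eq_Cr2 h s)
  have hFeq : ∫ s, (Cr P s - C2r P s) ∂ν = ∫ s, Cr P s ∂ν - ∫ s, Cr2 P s ∂ν := by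
    rw [integral_sub (hν.integrable_Cr P) (hν.integrable_C2r P), hC]
  have hl' : R1.ω₃l P ν * ∫ s, Cr P s ∂ν = ∫ s, Cr2 P s ∂ν :=
    div_mul_cancel₀ _ (by linarith)
  have hu' : R1.ω₃u P ν * (∫ s, Cr1 P s ∂ν + ∫ s, Cr2 P s ∂ν) = ∫ s, Cr1 P s ∂ν := by
    rw [R1.ω₃u, integral_add (hν.integrable_Cr1 P) (hν.integrable_C2r P), hC]
    exact div_mul_cancel₀ _ (by linarith)
  set l := R1.ω₃l P ν
  set u := R1.ω₃u P ν
  have hp0 : 0 < p₃ := hl.1.trans_le hp₃.1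
  have hp1 : 0 < 1 - p₃ := sub_pos.2 (hp₃.2.trans_lt hu.2)
  have hl1 : 0 < 1 - l := sub_pos.2 hl.2
  have hu1 : 0 < 1 - u := sub_pos.2 hu.2
  have hp4 : 0 < (1 - p₃) * l / (p₃ * (1 - l)) := div_pos (mul_pos hp1 hl.1) (mul_pos hp0 hl1)
  have hp5 : 0 < p₃ * (1 - u) / ((1 - p₃) * u) := div_pos (mul_pos hp0 hu1) (mul_pos hp1 hu.1)
  refine achieves_of_slot_rates hS hb₁ hb₂ hμ₂.ge (by rw [hμ₁, hμ₂]; exact zero_le_one) hμ₁.le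
    (by simp [ht]) ?_ ((IsWeight.coin .X3).mul (.coin .X4)) (.coin .X3) (IsWeight.coin .X3).compl
    ((IsWeight.coin .X3).compl.mul (.coin .X5)) (hν.isFlow_Cr_sub P) (hν.isFlow_C2r P)
    (hν.isFlow_Cr2 P) (hν.isFlow_Cr1 P) ?_ ?_
  · rw [hp]
    rintro (_ | _ | _ | _ | _) <;> simp only [coinVec]
    · simp
    · simp
    · exact ⟨hp0.le, by linarith⟩
    · exact ⟨hp4.le, (div_le_one (mul_pos hp0 hl1)).2 (by nlinarith [hp₃.1])⟩
    · exact ⟨hp5.le, (div_le_one (mul_pos hp1 hu.1)).2 (by nlinarith [hp₃.2])⟩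
  · filter_upwards [hν.pos, hν.ae_C2r_pos P] with s hs hr x hx m hm
    have hmax : ∀ k, d.ind x k * metric P d.μ₁ d.μ₂ d.t s k ≤
      d.ind x m * metric P d.μ₁ d.μ₂ d.t s m := by
        rw [hm]; exact hsel.argmax (d.ind x) s
    have k2 := hmax .M2
    have k3 := hmax .M3
    have k5 := hmax .M5
    have k6 := hmax .M6
    rw [hind, hμ₁, hμ₂, ht] at k2 k3 k5 k6
    rw [hμ₁, hμ₂, ht]
    simp only [metric, modeVec, C12r_zero P hs.1.le hs.2.le, C21r_zero P hs.1.le hs.2.le,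
      ← IsGainLaw.C2r_eq_Cr2 h] at k2 k3 k5 k6 ⊢
    rcases hx .X3 with h3 | h3 <;> rcases hx .X4 with h4 | h4 <;> rcases hx .X5 with h5 | h5 <;>
      rw [h3, h4, h5] at k2 k3 k5 k6 <;> rw [h3, h4, h5] <;>
      cases m <;> simp [pick] at k2 k3 k5 k6 ⊢ <;> linarith
  · intro X hX
    have q3 : d.p .X3 = p₃ := by rw [hp]; rfl
    have q4 : d.p .X4 = (1 - p₃) * l / (p₃ * (1 - l)) := by rw [hp]; rfl
    have q5 : d.p .X5 = p₃ * (1 - u) / ((1 - p₃) * u) := by rw [hp]; rfl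
    have n3 : 0 ≤ d.p .X3 := q3 ▸ hp0.le
    have n4 : 0 ≤ d.p .X4 := q4 ▸ hp4.le
    have n5 : 0 ≤ d.p .X5 := q5 ▸ hp5.le
    rw [hX.integral_coin_mul (by decide) n3 n4, hX.integral_coin n3, hX.integral_one_sub_coin n3,
      hX.integral_one_sub_coin_mul (by decide) n3 n5, q3, q4, q5, hC]
    refine ⟨?_, ?_, mul_pos (mul_pos hp0 hp4) hF, mul_pos (mul_pos hp1 hp5) hB⟩
    · rw [hFeq]
      field_simp
      linear_combination hl'
    · have hne := hu.1.ne'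
      field_simp
      linear_combination hu'

/-- In region `R₀` the rule that selects between `M3` and `M6` is optimal if it is balanced. -/
theorem achieves_R0_of_meanBalanced (hS : IsFading ρ S) (hb₁ : 0 ≤ b₁) (hb₂ : 0 ≤ b₂)
    (hsel : IsArgmaxRule P d sel) (hμ₂ : 0 ≤ d.μ₂) (hμ : d.μ₂ ≤ d.μ₁) (hμ₁ : d.μ₁ ≤ 1)
    (ht : d.t ∈ Set.Icc (0 : ℝ) 1) (ht' : d.t = 0 ∨ d.μ₁ = d.μ₂)
    (hp : d.p = coinVec 0 0 0 0 0) (hind : d.ind = fun _ => indR0)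
    (hbal : MeanBalanced P (ρ.map (S 0)) d.t (sel indR0)) :
    Achieves ρ P S b₁ b₂ d sel := by
  have hν := hS.isGainLaw
  set ν := ρ.map (S 0) with hνdef
  have := hν.neZero
  set χ : ℝ × ℝ → ℝ := fun s => if sel indR0 s = .M3 then 1 else 0 with hχdef
  have hχ : IsRule χ := ⟨Measurable.ite (hsel.measurable indR0 .M3) measurable_const
    measurable_const, fun s => by simp only [hχdef]; split_ifs <;> simp⟩
  have hmode : ∀ᵐ s ∂ν, (sel indR0 s = .M3 ∨ sel indR0 s = .M6) ∧
      metric P d.μ₁ d.μ₂ 0 s .M3 ≤ metric P d.μ₁ d.μ₂ d.t s (sel indR0 s) ∧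
      metric P d.μ₁ d.μ₂ 0 s .M6 ≤ metric P d.μ₁ d.μ₂ d.t s (sel indR0 s) := by
    filter_upwards [hν.pos, hν.ae_Cr_sub_pos P, hν.ae_C2r_pos P, hν.ae_Cr1_pos P, hν.ae_Cr2_pos P]
      with s hs c1 c2 c3 c4
    have hmax := hsel.argmax indR0 s
    have k3 := hmax .M3
    have k6 := hmax .M6
    have hM3 : metric P d.μ₁ d.μ₂ d.t s .M3 = metric P d.μ₁ d.μ₂ 0 s .M3 := by
      rcases ht' with h | h
      · rw [h]
      · rw [h]; exact metric_diag_M3 P _ _ hs.1.le hs.2.le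
    -- One candidate has a positive metric, so modes with indicator 0 cannot maximize the product.
    have hpos : 0 < metric P d.μ₁ d.μ₂ 0 s .M3 ∨ 0 < metric P d.μ₁ d.μ₂ 0 s .M6 := by
      rw [metric_M3_zero P _ _ hs.1.le hs.2.le, metric_M6]
      rcases (hμ₂.trans hμ).eq_or_lt with h | h
      · left
        rw [← h] at hμ ⊢
        nlinarith
      · right
        nlinarith [mul_pos h c4, mul_nonneg hμ₂ c3.le]
    have h6 : metric P d.μ₁ d.μ₂ d.t s .M6 = metric P d.μ₁ d.μ₂ 0 s .M6 := rfl
    rw [hM3] at k3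
    rw [h6] at k6
    cases hm : sel indR0 s <;> rw [hm] at k3 k6 <;>
      simp only [indR0, modeVec, one_mul, zero_mul] at k3 k6
    case M3 => exact ⟨Or.inl rfl, hM3.ge, by linarith⟩
    case M6 => exact ⟨Or.inr rfl, by linarith, le_rfl⟩
    all_goals rcases hpos with h | h <;> linarith
  have e1 : ∫ s, χ s * C12r P d.t s ∂ν = ∫ s, (1 - χ s) * Cr2 P s ∂ν := by
    refine (Eq.trans ?_ hbal.1).trans ?_ <;>
    · refine integral_congr_ae (hmode.mono fun s hs => ?_)
      rcases hs.1 with h | h <;> simp [h, hχdef, pick]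
  have e2 : ∫ s, χ s * C21r P d.t s ∂ν = ∫ s, (1 - χ s) * Cr1 P s ∂ν := by
    refine (Eq.trans ?_ hbal.2).trans ?_ <;>
    · refine integral_congr_ae (hmode.mono fun s hs => ?_)
      rcases hs.1 with h | h <;> simp [h, hχdef, pick]
  have hf1 := hν.isFlow_C12r P ht
  have hi1 : Integrable (C12r P d.t) ν := have := hν.prob; hf1.memLp.integrable one_le_two
  have hpos1 : ∀ᵐ s ∂ν, 0 < C12r P d.t s := by
    filter_upwards [hν.pos, hν.ae_Cr_sub_pos P, hν.ae_C1r_pos P] with s hs c1 c2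
    rw [C12r_eq d.t hs.1.le hs.2.le]
    rcases ht.1.eq_or_lt with h | h
    · rw [← h]; linarith
    · nlinarith [mul_pos h c2, mul_nonneg (sub_nonneg.2 ht.2) c1.le]
  have hpos := fun {g : ℝ × ℝ → ℝ} (hg : Integrable g ν) (hg' : ∀ᵐ s ∂ν, 0 < g s) =>
    hχ.pos_of_net_eq_zero hi1 (hν.integrable_Cr2 P) hpos1 (hν.ae_Cr2_pos P)
      (by rw [hχ.net_eq hi1 (hν.integrable_Cr2 P), e1, sub_self]) hg hg'
  refine achieves_of_slot_rates hS hb₁ hb₂ hμ₂ hμ hμ₁ ht ?_ .one .one .one .one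
    (hχ.isFlow_mul hf1) (hχ.isFlow_mul (hν.isFlow_C21r P ht)) (hχ.compl.isFlow_mul (hν.isFlow_Cr2 P))
    (hχ.compl.isFlow_mul (hν.isFlow_Cr1 P)) ?_ ?_
  · rw [hp]
    rintro (_ | _ | _ | _ | _) <;> simp [coinVec]
  · filter_upwards [hmode] with s hs x _ m hm
    rw [hind] at hm
    subst hm
    refine ⟨?_, ?_, ?_, ?_, ?_, ?_, hs.2.1, hs.2.2⟩ <;>
      rcases hs.1 with h | h <;> simp [h, hχdef, pick]
  · intro X _
    simp only [integral_const, probReal_univ, smul_eq_mul, one_mul]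
    exact ⟨e1, e2, (hpos hi1 hpos1).1, (hpos (hν.integrable_Cr1 P) (hν.ae_Cr1_pos P)).2⟩

/-- The time-sharing value of region `R₀` balances both constraints. -/
lemma meanBalanced_of_R0 (hS : IsFading ρ S) {μ : ℝ} (hμ : μ ∈ Set.Ioo (0 : ℝ) 1)
    (hbal : R0.Balanced P (ρ.map (S 0)) μ) (hsel : IsArgmaxRule P d sel) (hμ₁ : d.μ₁ = μ)
    (hμ₂ : d.μ₂ = μ) (ht : d.t = R0.t P (ρ.map (S 0)) μ) :
    MeanBalanced P (ρ.map (S 0)) d.t (sel indR0) := by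
  have hν := hS.isGainLaw
  set ν := ρ.map (S 0) with hνdef
  have h0 := (hν.R0_balanced_iff hμ).1 hbal
  have hφ := isRule_macRule P μ μ
  have hne : μ ≠ 1 ∨ μ ≠ 0 ∨ P.P₂ ≠ P.Pr := Or.inl hμ.2.ne
  have hmode : ∀ᵐ s ∂ν, 0 ≤ s.1 ∧ 0 ≤ s.2 ∧ ((sel indR0 s = .M3 ∧ macRule P μ μ s = 1) ∨
      (sel indR0 s = .M6 ∧ macRule P μ μ s = 0)) := by
    filter_upwards [hν.pos, hν.ae_gap_ne P hne, hν.ae_Cr_pos P, hν.ae_Cr1_pos P, hν.ae_Cr2_pos P]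
      with s hs hg c1 c2 c3
    refine ⟨hs.1.le, hs.2.le, ?_⟩
    have hmax := hsel.argmax indR0 s
    have k3 := hmax .M3
    have k6 := hmax .M6
    have hge := gap_eq P μ μ hs.1.le hs.2.le
    have h3 : metric P d.μ₁ d.μ₂ d.t s .M3 = metric P μ μ 0 s .M3 := by
      rw [hμ₁, hμ₂]; exact metric_diag_M3 P _ _ hs.1.le hs.2.le
    have h6 : metric P d.μ₁ d.μ₂ d.t s .M6 = metric P μ μ 0 s .M6 := by rw [hμ₁, hμ₂]; rfl
    have hp6 : 0 < metric P μ μ 0 s .M6 := by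
      rw [metric_M6]; exact add_pos (mul_pos hμ.1 c3) (mul_pos hμ.1 c2)
    rw [h3] at k3
    rw [h6] at k6
    rcases lt_or_gt_of_ne hg with hlt | hlt
    · rw [macRule_of_neg hlt]
      cases hm : sel indR0 s <;> rw [hm] at k3 k6 <;>
        simp only [indR0, modeVec, one_mul, zero_mul, h3] at k3 k6
      case M6 => simp
      all_goals linarith
    · rw [macRule_of_pos hlt]
      cases hm : sel indR0 s <;> rw [hm] at k3 k6 <;>
        simp only [indR0, modeVec, one_mul, zero_mul, h6] at k3 k6
      case M3 => simp
      all_goals linarith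
  set D := ∫ s, macRule P μ μ s * (Cr P s - C1r P s - C2r P s) ∂ν with hD
  have hDneg : D < 0 := hν.R0_loss_neg h0
  -- Time sharing changes the two net flows to `flow₁ - t D` and `flow₂ + t D`. The first vanishes
  -- by the choice of t, the second because the flows add up to zero.
  have htD : d.t * D = flow₁ P ν μ μ := by
    rw [ht, hν.R0_t_eq hμ, div_mul_cancel₀ _ hDneg.ne]
  have hiD : Integrable (fun s => macRule P μ μ s * (Cr P s - C1r P s - C2r P s)) ν :=
    hφ.integrable_mul (((hν.integrable_Cr P).sub (hν.integrable_C1r P)).sub (hν.integrable_C2r P))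
  have hi1 := hφ.integrable_mul (hν.integrable_Cr_sub P)
  have hi2 := hφ.integrable_mul (hν.integrable_C2r P)
  constructor
  · have e1 : ∫ s, (pick (sel indR0 s) .M1 * C1r P s + pick (sel indR0 s) .M3 * C12r P d.t s) ∂ν =
        ∫ s, (macRule P μ μ s * (Cr P s - C2r P s)
          - d.t * (macRule P μ μ s * (Cr P s - C1r P s - C2r P s))) ∂ν := by
      refine integral_congr_ae (hmode.mono fun s hs => ?_)
      obtain ⟨h1, h2, h | h⟩ := hs
      · simp only [h.1, h.2, pick, C12r_eq d.t h1 h2]; simp; ring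
      · simp [h.1, h.2, pick]
    have e2 : ∫ s, (pick (sel indR0 s) .M5 + pick (sel indR0 s) .M6) * Cr2 P s ∂ν =
        ∫ s, (1 - macRule P μ μ s) * Cr2 P s ∂ν := by
      refine integral_congr_ae (hmode.mono fun s hs => ?_)
      obtain ⟨h1, h2, h | h⟩ := hs <;> simp [h.1, h.2, pick]
    rw [e1, e2, integral_sub hi1 (hiD.const_mul _), integral_const_mul, htD, flow₁,
      hφ.net_eq (hν.integrable_Cr_sub P) (hν.integrable_Cr2 P)]
    ring
  · have e1 : ∫ s, (pick (sel indR0 s) .M2 * C2r P s + pick (sel indR0 s) .M3 * C21r P d.t s) ∂ν =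
        ∫ s, (macRule P μ μ s * C2r P s
          + d.t * (macRule P μ μ s * (Cr P s - C1r P s - C2r P s))) ∂ν := by
      refine integral_congr_ae (hmode.mono fun s hs => ?_)
      obtain ⟨h1, h2, h | h⟩ := hs
      · simp only [h.1, h.2, pick, C21r_eq d.t h1 h2]; simp; ring
      · simp [h.1, h.2, pick]
    have e2 : ∫ s, (pick (sel indR0 s) .M4 + pick (sel indR0 s) .M6) * Cr1 P s ∂ν =
        ∫ s, (1 - macRule P μ μ s) * Cr1 P s ∂ν := by
      refine integral_congr_ae (hmode.mono fun s hs => ?_)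
      obtain ⟨h1, h2, h | h⟩ := hs <;> simp [h.1, h.2, pick]
    rw [e1, e2, integral_add hi2 (hiD.const_mul _), integral_const_mul, htD]
    have h2 := hφ.net_eq (hν.integrable_C2r P) (hν.integrable_Cr1 P)
    rw [← flow₂] at h2
    linarith

end

/-! ### Interchanging the users -/

def Powers.swap (P : Powers) : Powers := ⟨P.P₂, P.P₁, P.Pr, P.P₂_pos, P.P₁_pos, P.Pr_pos⟩

def Mode.swap : Mode → Mode
  | .M1 => .M2 | .M2 => .M1 | .M3 => .M3 | .M4 => .M5 | .M5 => .M4 | .M6 => .M6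

noncomputable def Params.swap (d : Params) : Params :=
  ⟨d.μ₂, d.μ₁, 1 - d.t, d.p, fun x k => d.ind x k.swap⟩

/-- Conjugation by the interchange of users, so that argmax rules correspond to argmax rules of the
interchanged problem. -/
def swapRule (sel : (Mode → ℝ) → ℝ × ℝ → Mode) (I : Mode → ℝ) (s : ℝ × ℝ) : Mode :=
  (sel (fun k => I k.swap) s.swap).swap

lemma Mode.swap_M1 : Mode.M1.swap = .M2 := rfl
lemma Mode.swap_M2 : Mode.M2.swap = .M1 := rfl
lemma Mode.swap_M3 : Mode.M3.swap = .M3 := rfl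
lemma Mode.swap_M4 : Mode.M4.swap = .M5 := rfl
lemma Mode.swap_M5 : Mode.M5.swap = .M4 := rfl
lemma Mode.swap_M6 : Mode.M6.swap = .M6 := rfl

@[simp] lemma Mode.swap_swap (k : Mode) : k.swap.swap = k := by cases k <;> rfl

@[simp] lemma Params.swap_swap (d : Params) : d.swap.swap = d := by
  simp [Params.swap]

lemma pick_swap (m k : Mode) : pick m.swap k = pick m k.swap := by
  cases m <;> cases k <;> simp [pick, Mode.swap]

lemma modeVec_swap (a₁ a₂ a₃ a₄ a₅ a₆ : ℝ) (k : Mode) :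
    modeVec a₁ a₂ a₃ a₄ a₅ a₆ k.swap = modeVec a₂ a₁ a₃ a₅ a₄ a₆ k := by
  cases k <;> rfl

/-! ### Capacities and metrics under interchange -/

section Capacities

variable (P : Powers) (s : ℝ × ℝ)

lemma C1r_swap : C1r P.swap s.swap = C2r P s := rfl
lemma C2r_swap : C2r P.swap s.swap = C1r P s := rfl
lemma Cr1_swap : Cr1 P.swap s.swap = Cr2 P s := rfl
lemma Cr2_swap : Cr2 P.swap s.swap = Cr1 P s := rfl
lemma Cr_swap : Cr P.swap s.swap = Cr P s := by simp [Cr, Powers.swap, add_comm]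
lemma C12r_swap (t : ℝ) : C12r P.swap (1 - t) s.swap = C21r P t s := by
  simp [C12r, C21r, Powers.swap]
lemma C21r_swap (t : ℝ) : C21r P.swap (1 - t) s.swap = C12r P t s := by
  simp [C12r, C21r, Powers.swap]

lemma metric_swap (x y t : ℝ) (k : Mode) :
    metric P.swap y x (1 - t) s.swap k.swap = metric P x y t s k := by
  cases k <;> simp only [metric, modeVec, Mode.swap, C12r_swap, C21r_swap, C1r_swap, C2r_swap,
    Cr1_swap, Cr2_swap] <;> ring

lemma metric_swap_one (x y : ℝ) (k : Mode) :
    metric P.swap y x 0 s.swap k.swap = metric P x y 1 s k := by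
  simpa using metric_swap P s x y 1 k

lemma R1_q_swap (μ : ℝ) : R1.q P.swap μ s.swap = R2.q P μ s := by
  have h3 := fun x y => metric_swap_one P s x y .M3
  have h6 := fun x y => metric_swap_one P s x y .M6
  simp only [Mode.swap] at h3 h6
  simp only [R1.q, R2.q, h3, h6]
  rfl

lemma R0_q_swap (μ : ℝ) : R0.q P.swap μ s.swap = R0.q P μ s := by
  simp only [R0.q, Cr_swap, Cr1_swap, Cr2_swap, add_comm]

end Capacities

lemma integral_map_swap (ν : Measure (ℝ × ℝ)) (f : ℝ × ℝ → ℝ) :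
    ∫ s, f s ∂(ν.map Prod.swap) = ∫ s, f s.swap ∂ν :=
  integral_map_equiv MeasurableEquiv.prodComm f

lemma map_swap_map_swap (ν : Measure (ℝ × ℝ)) : (ν.map Prod.swap).map Prod.swap = ν := by
  rw [Measure.map_map measurable_swap measurable_swap, Prod.swap_swap_eq, Measure.map_id]

/-! ### Regions and prescriptions under interchange -/

section Regions

variable (P : Powers) (ν : Measure (ℝ × ℝ))

lemma R1_balanced_swap (μ : ℝ) :
    R1.Balanced P.swap (ν.map Prod.swap) μ ↔ R2.Balanced P ν μ := by
  simp only [R1.Balanced, R2.Balanced, integral_map_swap, R1_q_swap, C2r_swap, Cr1_swap, Cr2_swap,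
    Cr_swap]
  rfl

lemma R1_ω₁_swap (μ : ℝ) : R1.ω₁ P.swap (ν.map Prod.swap) μ = R2.ω₁ P ν μ := by
  simp only [R1.ω₁, R2.ω₁, integral_map_swap, R1_q_swap, C2r_swap, Cr2_swap, Cr_swap]

lemma R1_ω₂_swap (μ : ℝ) : R1.ω₂ P.swap (ν.map Prod.swap) μ = R2.ω₂ P ν μ := by
  simp only [R1.ω₂, R2.ω₂, integral_map_swap, R1_q_swap, C2r_swap, Cr1_swap]

lemma R1_ω₃l_swap : R1.ω₃l P.swap (ν.map Prod.swap) = R2.ω₃l P ν := by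
  simp only [R1.ω₃l, R2.ω₃l, integral_map_swap, Cr2_swap, Cr_swap]

lemma R1_ω₃u_swap : R1.ω₃u P.swap (ν.map Prod.swap) = R2.ω₃u P ν := by
  simp only [R1.ω₃u, R2.ω₃u, integral_map_swap, Cr1_swap, C2r_swap]

lemma inR1_swap : InR1 P.swap (ν.map Prod.swap) ↔ InR2 P ν := by
  simp only [InR1, InR2, R1_balanced_swap, R1_ω₁_swap, R1_ω₂_swap, R1_ω₃l_swap, R1_ω₃u_swap]
  rfl

lemma inR2_swap : InR2 P.swap (ν.map Prod.swap) ↔ InR1 P ν := by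
  rw [← inR1_swap, map_swap_map_swap]
  rfl

lemma inR0_swap : InR0 P.swap (ν.map Prod.swap) ↔ InR0 P ν := by
  rw [InR0, InR0, inR1_swap, inR2_swap, and_comm]

lemma ind_swap_eq_iff (g h : (Coin → ℝ) → Mode → ℝ) :
    ((fun x k => g x k.swap) = h) ↔ g = fun x k => h x k.swap := by
  constructor
  · rintro rfl
    simp
  · rintro rfl
    simp

lemma prescribedR1_swap (d : Params) :
    PrescribedR1 P.swap (ν.map Prod.swap) d.swap ↔ PrescribedR2 P ν d := by
  have ht : 1 - d.t = 0 ↔ d.t = 1 := by rw [sub_eq_zero, eq_comm]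
  simp only [PrescribedR1, PrescribedR2, R1_balanced_swap, R1_ω₁_swap, R1_ω₂_swap, R1_ω₃l_swap,
    R1_ω₃u_swap, Params.swap, ind_swap_eq_iff, ht]
  have hm : ∀ a₁ a₂ a₃ a₄ a₅ a₆ : (Coin → ℝ) → ℝ,
      (fun x (k : Mode) => modeVec (a₁ x) (a₂ x) (a₃ x) (a₄ x) (a₅ x) (a₆ x) k.swap) =
        fun x => modeVec (a₂ x) (a₁ x) (a₃ x) (a₅ x) (a₄ x) (a₆ x) := fun _ _ _ _ _ _ => by
    funext x k; exact modeVec_swap ..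
  simp only [modeVec_swap]
  simp only [Powers.swap]
  tauto

lemma prescribedR2_swap (d : Params) :
    PrescribedR2 P.swap (ν.map Prod.swap) d.swap ↔ PrescribedR1 P ν d := by
  rw [← prescribedR1_swap, map_swap_map_swap, Params.swap_swap]
  rfl

lemma R0_balanced_swap (μ : ℝ) :
    R0.Balanced P.swap (ν.map Prod.swap) μ ↔ R0.Balanced P ν μ := by
  simp only [R0.Balanced, integral_map_swap, R0_q_swap, Cr_swap, Cr1_swap, Cr2_swap, add_comm]

variable {P ν}

lemma isRule_R0_q (μ : ℝ) : IsRule (R0.q P μ) := by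
  refine ⟨?_, fun s => ?_⟩
  · exact Measurable.ite (measurableSet_le measurable_const (by fun_prop)) measurable_const
      measurable_const
  · unfold R0.q; split_ifs <;> simp

/-- By the balance equation the numerators of t and of its counterpart add up to their common,
nonzero denominator. -/
lemma IsGainLaw.R0_t_swap (hν : IsGainLaw ν) {μ : ℝ} (hμ : μ ∈ Set.Ioo (0 : ℝ) 1)
    (hb : R0.Balanced P ν μ) : R0.t P.swap (ν.map Prod.swap) μ = 1 - R0.t P ν μ := by
  have hq := isRule_R0_q (P := P) μ
  have hD : ∫ s, R0.q P μ s * (Cr P s - C1r P s - C2r P s) ∂ν < 0 := by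
    refine lt_of_eq_of_lt (integral_congr_ae ((hν.R0_q_ae_eq (P := P) hμ).mono fun s hs => ?_))
      (hν.R0_loss_neg ((hν.R0_balanced_iff hμ).1 hb))
    simp only [hs]
  have hCr := hq.integrable_mul (hν.integrable_Cr P)
  have hC1 := hq.integrable_mul (hν.integrable_C1r P)
  have hC2 := hq.integrable_mul (hν.integrable_C2r P)
  have hr1 := hq.compl.integrable_mul (hν.integrable_Cr1 P)
  have hr2 := hq.compl.integrable_mul (hν.integrable_Cr2 P)
  simp only [R0.t, integral_map_swap, R0_q_swap, Cr_swap, Cr2_swap, C1r_swap, C2r_swap]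
  rw [R0.Balanced] at hb
  simp only [mul_sub, mul_add] at hb hD ⊢
  have e3 : ∫ s, (R0.q P μ s * Cr P s - R0.q P μ s * C2r P s - R0.q P μ s * C1r P s) ∂ν =
      ∫ s, (R0.q P μ s * Cr P s - R0.q P μ s * C1r P s - R0.q P μ s * C2r P s) ∂ν :=
    integral_congr_ae (ae_of_all _ fun s => by ring)
  rw [integral_add hr1 hr2] at hb
  rw [e3, eq_sub_iff_add_eq, ← add_div, div_eq_one_iff_eq hD.ne,
    integral_sub (f := fun s => R0.q P μ s * Cr P s - R0.q P μ s * C1r P s) (hCr.sub hC1) hC2,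
    integral_sub hCr hC1, integral_sub hCr hC2]
  linarith

lemma MeanBalanced.swap {t : ℝ} {κ : ℝ × ℝ → Mode} (h : MeanBalanced P ν t κ) :
    MeanBalanced P.swap (ν.map Prod.swap) (1 - t) (fun s => (κ s.swap).swap) := by
  simpa only [MeanBalanced, integral_map_swap, Prod.swap_swap, pick_swap, Mode.swap_M1, Mode.swap_M2,
    Mode.swap_M3, Mode.swap_M4, Mode.swap_M5, Mode.swap_M6, C1r_swap,
    C2r_swap, C12r_swap, C21r_swap, Cr1_swap, Cr2_swap] using h.symm

lemma IsArgmaxRule.swap {d : Params} {sel : (Mode → ℝ) → ℝ × ℝ → Mode}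
    (h : IsArgmaxRule P d sel) : IsArgmaxRule P.swap d.swap (swapRule sel) := by
  refine ⟨fun I k => ?_, fun I s k => ?_⟩
  · have : {s | swapRule sel I s = k} = Prod.swap ⁻¹' {s | sel (fun k => I k.swap) s = k.swap} := by
      ext s
      change (sel (fun k => I k.swap) s.swap).swap = k ↔ sel (fun k => I k.swap) s.swap = k.swap
      constructor
      · rintro rfl; simp
      · intro h; simp [h]
    rw [this]
    exact measurable_swap (h.measurable _ _)
  · have := h.argmax (fun k => I k.swap) s.swap k.swap
    simp only [Mode.swap_swap, ← metric_swap P s.swap, Prod.swap_swap] at this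
    exact this

lemma Prescribed.swap (hν : IsGainLaw ν) {d : Params} {sel : (Mode → ℝ) → ℝ × ℝ → Mode}
    (h : Prescribed P ν d sel) : Prescribed P.swap (ν.map Prod.swap) d.swap (swapRule sel) := by
  refine ⟨h.1.swap, ?_⟩
  rw [inR1_swap, inR2_swap, inR0_swap, prescribedR1_swap, prescribedR2_swap]
  rcases h.2 with h1 | h2 | ⟨h0, hp, hind, μ, hμ, hb, ht⟩
  · exact Or.inr (Or.inl h1)
  · exact Or.inl h2
  · refine Or.inr (Or.inr ⟨h0, hp, ?_, μ, hμ, (R0_balanced_swap P ν μ).2 hb, ?_⟩)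
    · simp only [Params.swap, hind, indR0]
      funext x k
      exact modeVec_swap ..
    · have hI : (fun k : Mode => indR0 k.swap) = indR0 := by
        funext k; exact modeVec_swap ..
      have hκ : swapRule sel indR0 = fun s => (sel indR0 s.swap).swap := by
        funext s; simp only [swapRule, hI]
      rw [hν.R0_t_swap hμ hb, hκ]
      simp only [Params.swap]
      rcases ht with ⟨h1, h2, h3, h4, h5⟩ | ⟨h1, h2, h3, h4, h5, h6⟩ | ⟨h1, h2, h3, h4, h5, h6⟩
      · exact Or.inl ⟨by linarith, by linarith, by rw [h3], h5, h4⟩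
      · exact Or.inr (Or.inr ⟨by linarith, by rw [h2, sub_zero], h3, h4, h5, h6.swap⟩)
      · exact Or.inr (Or.inl ⟨by linarith, by rw [h2, sub_self], h3, h4, h5, h6.swap⟩)

end Regions

/-! ### Policies and rates under interchange -/

section Policies

variable {P : Powers} {s : ℕ → ℝ × ℝ} {q : ℕ → Mode → ℝ} {t : ℕ → ℝ}

lemma in₁_swap : in₁ P.swap (fun i => (s i).swap) (fun i k => q i k.swap) (fun i => 1 - t i) =
    in₂ P s q t := by
  funext i
  simp only [in₁, in₂, Mode.swap_M1, Mode.swap_M3, C1r_swap, C12r_swap]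

lemma in₂_swap : in₂ P.swap (fun i => (s i).swap) (fun i k => q i k.swap) (fun i => 1 - t i) =
    in₁ P s q t := by
  funext i
  simp only [in₁, in₂, Mode.swap_M2, Mode.swap_M3, C2r_swap, C21r_swap]

lemma queue₁_swap (b : ℝ) : queue₁ P.swap (fun i => (s i).swap) (fun i k => q i k.swap)
    (fun i => 1 - t i) b = queue₂ P s q t b := by
  funext i
  induction i with
  | zero => rfl
  | succ i ih => simp only [queue₁, queue₂, ih, in₁_swap, Mode.swap_M5, Mode.swap_M6, Cr2_swap]

lemma queue₂_swap (b : ℝ) : queue₂ P.swap (fun i => (s i).swap) (fun i k => q i k.swap)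
    (fun i => 1 - t i) b = queue₁ P s q t b := by
  funext i
  induction i with
  | zero => rfl
  | succ i ih => simp only [queue₁, queue₂, ih, in₂_swap, Mode.swap_M4, Mode.swap_M6, Cr1_swap]

lemma out₁_swap (b : ℝ) : out₁ P.swap (fun i => (s i).swap) (fun i k => q i k.swap)
    (fun i => 1 - t i) b = out₂ P s q t b := by
  funext i
  simp only [out₁, out₂, queue₂_swap, Mode.swap_M4, Mode.swap_M6, Cr1_swap]

lemma out₂_swap (b : ℝ) : out₂ P.swap (fun i => (s i).swap) (fun i k => q i k.swap)
    (fun i => 1 - t i) b = out₁ P s q t b := by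
  funext i
  simp only [out₁, out₂, queue₁_swap, Mode.swap_M5, Mode.swap_M6, Cr2_swap]

lemma cout₁_swap : cout₁ P.swap (fun i => (s i).swap) (fun i k => q i k.swap) = cout₂ P s q := by
  funext i
  simp only [cout₁, cout₂, Mode.swap_M4, Mode.swap_M6, Cr1_swap]

lemma cout₂_swap : cout₂ P.swap (fun i => (s i).swap) (fun i k => q i k.swap) = cout₁ P s q := by
  funext i
  simp only [cout₁, cout₂, Mode.swap_M5, Mode.swap_M6, Cr2_swap]

lemma one_sub_mem_Icc {x : ℝ} (h : x ∈ Set.Icc (0 : ℝ) 1) : 1 - x ∈ Set.Icc (0 : ℝ) 1 :=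
  ⟨sub_nonneg.2 h.2, sub_le_self _ h.1⟩

lemma sum_swap (f : Mode → ℝ) : ∑ k : Mode, f k.swap = ∑ k, f k := by
  simp only [sum_mode, Mode.swap]
  ring

lemma Admissible.swap (h : Admissible q t) :
    Admissible (fun i k => q i k.swap) (fun i => 1 - t i) := fun i =>
  ⟨(sum_swap (q i)).trans (h i).1, fun k => (h i).2.1 k.swap, one_sub_mem_Icc (h i).2.2⟩

lemma RelaxedAdmissible.swap (h : RelaxedAdmissible q t) :
    RelaxedAdmissible (fun i k => q i k.swap) (fun i => 1 - t i) := fun i =>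
  ⟨(sum_swap (q i)).trans (h i).1, fun k => (h i).2.1 k.swap, one_sub_mem_Icc (h i).2.2⟩

lemma IsOptimal.swap {b₁ b₂ R₁ R₂ : ℝ} (h : IsOptimal P.swap (fun i => (s i).swap) b₂ b₁
    (fun i k => q i k.swap) (fun i => 1 - t i) R₂ R₁) : IsOptimal P s b₁ b₂ q t R₁ R₂ := by
  refine ⟨?_, ?_, ?_, ?_, ?_, ?_, ?_, fun q' t' h' R hR => ?_, fun q' t' h' R₁' R₂' h1 h2 h3 h4 => ?_⟩
  · simpa using h.admissible.swap
  · simpa only [in₂_swap] using h.mean_in₂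
  · simpa only [in₁_swap] using h.mean_in₁
  · simpa only [out₁_swap] using h.mean_out₁
  · simpa only [out₂_swap] using h.mean_out₂
  · simpa only [cout₁_swap] using h.mean_cout₁
  · simpa only [cout₂_swap] using h.mean_cout₂
  · rw [add_comm R₁]
    refine h.maximal _ _ h'.swap R ?_
    simp only [out₁_swap, out₂_swap]
    simpa only [add_comm] using hR
  · rw [add_comm R₁', add_comm R₁]
    refine h.maximal_relaxed _ _ h'.swap R₂' R₁' ?_ ?_ ?_ ?_
    · rwa [in₁_swap]
    · rwa [in₂_swap]
    · rwa [cout₂_swap]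
    · rwa [cout₁_swap]

end Policies

/-! ### Channel and coins under interchange; optimality of prescribed policies -/

section Channel

variable {Ω : Type*} [MeasurableSpace Ω] {ρ : Measure Ω} {S : ℕ → Ω → ℝ × ℝ}

/-- Interchanging coordinates commutes with the shift, so ergodicity passes to the image law;
Lebesgue measure on the plane is invariant. -/
lemma IsFading.swap (hS : IsFading ρ S) : IsFading ρ (fun i ω => (S i ω).swap) := by
  refine ⟨fun i => measurable_swap.comp (hS.measurable i), fun i => (hS.nonneg i).mono fun _ h => h.symm,
    hS.integrable₂, hS.integrable₁, ?_, ?_⟩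
  · have hg : Measurable fun (x : ℕ → ℝ × ℝ) i => (x i).swap := by fun_prop
    have hSm : Measurable fun ω i => S i ω := measurable_pi_lambda _ hS.measurable
    have hmp : MeasurePreserving (fun (x : ℕ → ℝ × ℝ) i => (x i).swap)
        (ρ.map fun ω i => S i ω) (ρ.map fun ω i => (S i ω).swap) :=
      ⟨hg, by rw [Measure.map_map hg hSm]; rfl⟩
    exact hmp.ergodic_of_ergodic_semiconj hS.ergodic (by fun_prop) fun x => rfl
  · have h := hS.continuous_law.map (f := Prod.swap) measurable_swap
    rw [Measure.map_map measurable_swap (hS.measurable 0)] at h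
    refine h.trans (Eq.absolutelyContinuous ?_)
    rw [Measure.volume_eq_prod]
    exact Measure.prod_swap

lemma IsFading.map_swap (hS : IsFading ρ S) :
    ρ.map (fun ω => (S 0 ω).swap) = (ρ.map (S 0)).map Prod.swap :=
  (Measure.map_map measurable_swap (hS.measurable 0)).symm

lemma IsCoinFlips.swap {p : Coin → ℝ} {X : Coin → ℕ → Ω → ℝ} (hX : IsCoinFlips ρ S p X) :
    IsCoinFlips ρ (fun i ω => (S i ω).swap) p X :=
  ⟨hX.measurable, hX.prob_one, hX.prob_zero, hX.indep,
    hX.indep_channel.comp (φ := id) (ψ := fun (x : ℕ → ℝ × ℝ) i => (x i).swap) measurable_id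
      (by fun_prop)⟩

omit [MeasurableSpace Ω] in
lemma selected_swap (d : Params) (sel : (Mode → ℝ) → ℝ × ℝ → Mode) (X : Coin → ℕ → Ω → ℝ) (i : ℕ)
    (ω : Ω) : selected d.swap (swapRule sel) (fun i ω => (S i ω).swap) X i ω =
      (selected d sel S X i ω).swap := by
  simp [selected, swapRule, Params.swap]

lemma Achieves.swap {P : Powers} {d : Params} {sel : (Mode → ℝ) → ℝ × ℝ → Mode} {b₁ b₂ : ℝ}
    (h : Achieves ρ P.swap (fun i ω => (S i ω).swap) b₂ b₁ d.swap (swapRule sel)) :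
    Achieves ρ P S b₁ b₂ d sel := by
  obtain ⟨h1, h2, h3, h4, h5⟩ := h
  refine ⟨h2, h1, ?_, h4, fun X hX => ?_⟩
  · simpa [Params.swap] using one_sub_mem_Icc h3
  obtain ⟨⟨R₁, R₂, hR⟩, hM3, hM6⟩ := h5 X hX.swap
  simp only [selected_swap] at hR hM3 hM6
  refine ⟨⟨R₂, R₁, hR.mono fun ω hω => IsOptimal.swap ?_⟩, fun i => ?_, fun i => ?_⟩
  · convert! hω using 1
    funext i k
    exact (pick_swap _ _).symm
  · refine (hM3 i).trans_eq (congrArg ρ (Set.ext fun ω => ?_))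
    change (selected d sel S X i ω).swap = .M3 ↔ selected d sel S X i ω = .M3
    cases selected d sel S X i ω <;> simp [Mode.swap]
  · refine (hM6 i).trans_eq (congrArg ρ (Set.ext fun ω => ?_))
    change (selected d sel S X i ω).swap = .M6 ↔ selected d sel S X i ω = .M6
    cases selected d sel S X i ω <;> simp [Mode.swap]

variable [IsProbabilityMeasure ρ] {P : Powers} {d : Params} {sel : (Mode → ℝ) → ℝ × ℝ → Mode}
  {b₁ b₂ : ℝ}

/-- Every policy that is prescribed in region `R₁` is optimal. -/
lemma achieves_R1 (hS : IsFading ρ S) (hb₁ : 0 ≤ b₁) (hb₂ : 0 ≤ b₂)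
    (hsel : IsArgmaxRule P d sel) (hR : InR1 P (ρ.map (S 0)))
    (hd : PrescribedR1 P (ρ.map (S 0)) d) : Achieves ρ P S b₁ b₂ d sel := by
  obtain ⟨ht, ⟨h, h1, h2, hb, hp, hi⟩ | ⟨h, h1, hb, h2, hp, hi⟩ | ⟨h, h1, h2, ⟨p₃, hp₃, hp⟩, hi⟩⟩ := hd
  · exact achieves_R1_of_gt hS hb₁ hb₂ h hR hsel ht h1 h2 hb hp hi
  · exact achieves_R1_of_lt hS hb₁ hb₂ h hR hsel ht h2 h1 hb hp hi
  · exact achieves_R1_of_eq hS hb₁ hb₂ h hsel ht h1 h2 hp₃ hp hi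

/-- Every prescribed policy is optimal. -/
theorem Prescribed.achieves (hS : IsFading ρ S) (hb₁ : 0 ≤ b₁) (hb₂ : 0 ≤ b₂)
    (h : Prescribed P (ρ.map (S 0)) d sel) : Achieves ρ P S b₁ b₂ d sel := by
  have hν := hS.isGainLaw
  have hswap := h.swap hν
  rw [← hS.map_swap] at hswap
  rcases h with ⟨hsel, ⟨hR, hd⟩ | ⟨hR, hd⟩ | ⟨hR, hp, hi, μ, hμ, hb, hd⟩⟩
  · exact achieves_R1 hS hb₁ hb₂ hsel hR hd
  · refine Achieves.swap (achieves_R1 hS.swap hb₂ hb₁ hswap.1 ?_ ?_)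
    · rwa [hS.map_swap, inR1_swap]
    · rwa [hS.map_swap, prescribedR1_swap]
  · rcases hd with ⟨h1, h2, h3, h4, h5⟩ | ⟨h1, h2, h3, h4, h5, h6⟩ | ⟨h1, h2, h3, h4, h5, h6⟩
    · exact achieves_R0_of_meanBalanced hS hb₁ hb₂ hsel (h5 ▸ hμ.1.le) (h4.trans h5.symm).ge
        (h4 ▸ hμ.2.le) (by rw [h3]; exact ⟨h1.le, h2.le⟩) (Or.inr (h4.trans h5.symm)) hp hi
        (meanBalanced_of_R0 hS hμ hb hsel h4 h5 h3)
    · exact achieves_R0_of_meanBalanced hS hb₁ hb₂ hsel h3 h4 h5 (by simp [h2]) (Or.inl h2) hp hi h6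
    · have hI : (fun k : Mode => indR0 k.swap) = indR0 := by
        funext k; exact modeVec_swap ..
      have hκ : swapRule sel indR0 = fun s => (sel indR0 s.swap).swap := by
        funext s; simp only [swapRule, hI]
      have ht : d.swap.t = 0 := by simp [Params.swap, h2]
      refine Achieves.swap (achieves_R0_of_meanBalanced hS.swap hb₂ hb₁ hswap.1 h3 h4 h5
        (by simp [ht]) (Or.inl ht) hp ?_ ?_)
      · simp only [Params.swap, hi]
        exact funext fun _ => hI
      · rw [hS.map_swap, hκ]
        exact h6.swap

lemma exists_R2_balanced (hS : IsFading ρ S) (P : Powers) :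
    ∃ μ ∈ Set.Icc (0 : ℝ) 1, R2.Balanced P (ρ.map (S 0)) μ := by
  obtain ⟨μ, hμ, hb⟩ := hS.swap.isGainLaw.exists_R1_balanced P.swap
  rw [hS.map_swap, R1_balanced_swap] at hb
  exact ⟨μ, hμ, hb⟩

end Channel

/-! ### Minimizing the mean of the positive part of an affine function of two multipliers -/

section AffineMean

variable {ν : Measure (ℝ × ℝ)} {a b c : ℝ × ℝ → ℝ} {l₁ l₂ : ℝ}

def affine (a b c : ℝ × ℝ → ℝ) (m s : ℝ × ℝ) : ℝ := m.1 * a s + m.2 * b s + c s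

/-- The mean of the positive part of `m₁ a + m₂ b + c` minus `m₁ l₁ + m₂ l₂`. -/
noncomputable def posMean (ν : Measure (ℝ × ℝ)) (a b c : ℝ × ℝ → ℝ) (l₁ l₂ : ℝ) (m : ℝ × ℝ) : ℝ :=
  ∫ s, max (affine a b c m s) 0 ∂ν - (m.1 * l₁ + m.2 * l₂)

/-- The selector of the positive part: multiplied by `a` and `b` and integrated, it gives a
subgradient of the mean. -/
noncomputable def posRule (a b c : ℝ × ℝ → ℝ) (m s : ℝ × ℝ) : ℝ :=
  if 0 ≤ affine a b c m s then 1 else 0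

lemma isRule_posRule (ha : Measurable a) (hb : Measurable b) (hc : Measurable c) (m : ℝ × ℝ) :
    IsRule (posRule a b c m) := by
  refine ⟨?_, fun s => ?_⟩
  · exact Measurable.ite (measurableSet_le measurable_const (by unfold affine; fun_prop))
      measurable_const measurable_const
  · unfold posRule; split_ifs <;> simp

lemma integrable_affine (ha : Integrable a ν) (hb : Integrable b ν) (hc : Integrable c ν)
    (m : ℝ × ℝ) : Integrable (affine a b c m) ν :=
  ((ha.const_mul _).add (hb.const_mul _)).add hc

lemma continuous_posMean (ha : Integrable a ν) (hb : Integrable b ν) (hc : Integrable c ν) :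
    Continuous (posMean ν a b c l₁ l₂) := by
  refine Continuous.sub ?_ (by fun_prop)
  rw [continuous_iff_continuousAt]
  intro m
  refine continuousAt_of_dominated (bound := fun s => (‖m‖ + 1) * (|a s| + |b s|) + |c s|)
    (Eventually.of_forall fun m' => (integrable_affine ha hb hc m').pos_part.aestronglyMeasurable)
    ?_ (((ha.abs.add hb.abs).const_mul _).add hc.abs) (ae_of_all _ fun s => ?_)
  · have h := (continuous_norm (E := ℝ × ℝ)).continuousAt.eventually
      (gt_mem_nhds (show ‖m‖ < ‖m‖ + 1 by linarith))
    filter_upwards [h] with m' hm'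
    refine ae_of_all _ fun s => ?_
    have h1 : |m'.1| ≤ ‖m'‖ := norm_fst_le m'
    have h2 : |m'.2| ≤ ‖m'‖ := norm_snd_le m'
    rw [Real.norm_of_nonneg (le_max_right _ _)]
    refine max_le ?_ (by positivity)
    have h3 : m'.1 * a s ≤ (‖m‖ + 1) * |a s| := by
      refine (le_abs_self _).trans ?_
      rw [abs_mul]
      exact mul_le_mul_of_nonneg_right (h1.trans hm'.le) (abs_nonneg _)
    have h4 : m'.2 * b s ≤ (‖m‖ + 1) * |b s| := by
      refine (le_abs_self _).trans ?_
      rw [abs_mul]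
      exact mul_le_mul_of_nonneg_right (h2.trans hm'.le) (abs_nonneg _)
    have := le_abs_self (c s)
    unfold affine
    linarith
  · unfold affine
    fun_prop

/-- The subgradient inequality. -/
lemma posMean_le (ham : Measurable a) (hbm : Measurable b) (hcm : Measurable c)
    (ha : Integrable a ν) (hb : Integrable b ν) (hc : Integrable c ν) (m m' : ℝ × ℝ) :
    posMean ν a b c l₁ l₂ m + ((m'.1 - m.1) * (∫ s, posRule a b c m s * a s ∂ν - l₁) +
      (m'.2 - m.2) * (∫ s, posRule a b c m s * b s ∂ν - l₂)) ≤ posMean ν a b c l₁ l₂ m' := by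
  have hφ := isRule_posRule ham hbm hcm m
  have hi := (integrable_affine ha hb hc m).pos_part
  have hi' := (integrable_affine ha hb hc m').pos_part
  have h1 := (hφ.integrable_mul ha).const_mul (m'.1 - m.1)
  have h2 := (hφ.integrable_mul hb).const_mul (m'.2 - m.2)
  have h : ∫ s, (max (affine a b c m s) 0 + ((m'.1 - m.1) * (posRule a b c m s * a s) +
      (m'.2 - m.2) * (posRule a b c m s * b s))) ∂ν ≤ ∫ s, max (affine a b c m' s) 0 ∂ν := by
    refine integral_mono (hi.add (h1.add h2)) hi' fun s => ?_
    simp only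
    unfold posRule
    split_ifs with h0
    · rw [max_eq_left h0]
      refine le_max_of_le_left (le_of_eq ?_)
      unfold affine; ring
    · rw [max_eq_right (not_le.1 h0).le]
      simp
  have h3 : Integrable (fun s => (m'.1 - m.1) * (posRule a b c m s * a s) +
      (m'.2 - m.2) * (posRule a b c m s * b s)) ν := h1.add h2
  rw [integral_add hi h3, integral_add h1 h2, integral_const_mul, integral_const_mul] at h
  unfold posMean
  linarith

/-- Without a tie the rule is locally constant in m; dominated convergence does the rest. -/
lemma continuousAt_integral_posRule (ham : Measurable a) (hbm : Measurable b) (hcm : Measurable c)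
    {m : ℝ × ℝ} (hne : ∀ᵐ s ∂ν, affine a b c m s ≠ 0) {f : ℝ × ℝ → ℝ} (hf : Integrable f ν) :
    ContinuousAt (fun m => ∫ s, posRule a b c m s * f s ∂ν) m := by
  refine continuousAt_of_dominated (bound := fun s => |f s|)
    (Eventually.of_forall fun m' =>
      ((isRule_posRule ham hbm hcm m').integrable_mul hf).aestronglyMeasurable)
    (Eventually.of_forall fun m' => ae_of_all _ fun s => ?_) hf.abs ?_
  · unfold posRule
    split_ifs <;> simp
  · filter_upwards [hne] with s hs
    have hc : Continuous fun m => affine a b c m s := by unfold affine; fun_prop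
    refine ContinuousAt.mul ?_ continuousAt_const
    rcases lt_or_gt_of_ne hs with hlt | hgt
    · refine (continuousAt_const (y := (0 : ℝ))).congr ?_
      filter_upwards [hc.continuousAt.eventually (gt_mem_nhds hlt)] with m' hm'
      simp [posRule, not_le.2 hm']
    · refine (continuousAt_const (y := (1 : ℝ))).congr ?_
      filter_upwards [hc.continuousAt.eventually (lt_mem_nhds hgt)] with m' hm'
      simp [posRule, hm'.le]

/-- The first-order condition at a minimizer where ties are negligible. -/
lemma posMean_first_order (ham : Measurable a) (hbm : Measurable b) (hcm : Measurable c)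
    (ha : Integrable a ν) (hb : Integrable b ν) (hc : Integrable c ν) {K : Set (ℝ × ℝ)}
    (hK : Convex ℝ K) {m : ℝ × ℝ} (hm : m ∈ K)
    (hmin : ∀ m' ∈ K, posMean ν a b c l₁ l₂ m ≤ posMean ν a b c l₁ l₂ m')
    (hne : ∀ᵐ s ∂ν, affine a b c m s ≠ 0) {m' : ℝ × ℝ} (hm' : m' ∈ K) :
    0 ≤ (m'.1 - m.1) * (∫ s, posRule a b c m s * a s ∂ν - l₁) +
      (m'.2 - m.2) * (∫ s, posRule a b c m s * b s ∂ν - l₂) := by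
  have hc1 := continuousAt_integral_posRule ham hbm hcm hne ha
  have hc2 := continuousAt_integral_posRule ham hbm hcm hne hb
  have hcont : ContinuousAt (fun x => (m'.1 - m.1) * (∫ s, posRule a b c x s * a s ∂ν - l₁) +
      (m'.2 - m.2) * (∫ s, posRule a b c x s * b s ∂ν - l₂)) m :=
    (continuousAt_const.mul (hc1.sub continuousAt_const)).add
      (continuousAt_const.mul (hc2.sub continuousAt_const))
  have hpath : Tendsto (fun ε : ℝ => m + ε • (m' - m)) (𝓝[>] 0) (𝓝 m) := by
    have : Tendsto (fun ε : ℝ => m + ε • (m' - m)) (𝓝 0) (𝓝 (m + (0 : ℝ) • (m' - m))) :=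
      Continuous.tendsto (by fun_prop) 0
    simpa using this.mono_left nhdsWithin_le_nhds
  refine ge_of_tendsto (hcont.tendsto.comp hpath) ?_
  filter_upwards [Ioo_mem_nhdsGT (show (0 : ℝ) < 1 from one_pos)] with ε hε
  have hmem : m + ε • (m' - m) ∈ K := hK.add_smul_sub_mem hm hm' ⟨hε.1.le, hε.2.le⟩
  have h1 := hmin _ hmem
  -- The subgradient inequality is taken at the displaced point and tested against the minimizer.
  -- Minimality then makes ε times the directional expression nonnegative at the displaced point,
  -- and continuity at m permits ε → 0.
  have h2 := posMean_le (l₁ := l₁) (l₂ := l₂) ham hbm hcm ha hb hc (m + ε • (m' - m)) m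
  have e1 : m.1 - (m + ε • (m' - m)).1 = -ε * (m'.1 - m.1) := by simp
  have e2 : m.2 - (m + ε • (m' - m)).2 = -ε * (m'.2 - m.2) := by simp
  rw [e1, e2] at h2
  simp only [Function.comp]
  refine nonneg_of_mul_nonneg_right (a := ε) ?_ hε.1
  linarith

lemma posMean_smul {r : ℝ} (hr : 0 ≤ r) (m : ℝ × ℝ) :
    posMean ν a b (fun _ => 0) l₁ l₂ (r • m) = r * posMean ν a b (fun _ => 0) l₁ l₂ m := by
  have h1 : ∀ s, max (affine a b (fun _ => 0) (r • m) s) 0 =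
      r * max (affine a b (fun _ => 0) m s) 0 := fun s => by
    rw [mul_max_of_nonneg _ _ hr, mul_zero]
    congr 1
    simp only [affine, Prod.smul_fst, Prod.smul_snd, smul_eq_mul]
    ring
  unfold posMean
  simp only [h1, integral_const_mul, Prod.smul_fst, Prod.smul_snd, smul_eq_mul]
  ring

/-- A constant selection θ is a competitor: θ u ≤ max u 0 for θ ∈ [0,1]. -/
lemma le_posMean (ha : Integrable a ν) (hb : Integrable b ν) {θ : ℝ} (hθ : θ ∈ Set.Icc (0 : ℝ) 1)
    (m : ℝ × ℝ) : θ * (m.1 * ∫ s, a s ∂ν + m.2 * ∫ s, b s ∂ν) - (m.1 * l₁ + m.2 * l₂) ≤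
      posMean ν a b (fun _ => 0) l₁ l₂ m := by
  refine sub_le_sub_right ?_ _
  have hi := integrable_affine ha hb (integrable_zero _ ℝ ν) m
  rw [← integral_const_mul, ← integral_const_mul, ← integral_add (ha.const_mul _) (hb.const_mul _),
    ← integral_const_mul]
  refine integral_mono (((ha.const_mul _).add (hb.const_mul _)).const_mul θ) hi.pos_part fun s => ?_
  simp only [affine, add_zero]
  rcases le_total 0 (m.1 * a s + m.2 * b s) with h | h
  · exact le_max_of_le_left (mul_le_of_le_one_left h hθ.2)
  · exact le_max_of_le_right (mul_nonpos_of_nonneg_of_nonpos hθ.1 h)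

/-- If `(l₁, l₂)` satisfies all support inequalities of the range of `A ↦ (∫_A f, ∫_A g)` and
ties are negligible, then it belongs to the range. -/
lemma exists_set_of_support [IsProbabilityMeasure ν] {f g : ℝ × ℝ → ℝ} (hfm : Measurable f)
    (hgm : Measurable g) (hf : Integrable f ν) (hg : Integrable g ν)
    (hsupp : ∀ m, 0 ≤ posMean ν f g (fun _ => 0) l₁ l₂ m)
    (hne₀ : ∀ m, m ≠ 0 → ∀ᵐ s ∂ν, affine f g (fun _ => 0) m s ≠ 0)
    (hne₁ : ∀ m, ∀ᵐ s ∂ν, affine f g (fun _ => 1) m s ≠ 0) :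
    ∃ A : Set (ℝ × ℝ), MeasurableSet A ∧ ∫ s, A.indicator 1 s * f s ∂ν = l₁ ∧
      ∫ s, A.indicator 1 s * g s ∂ν = l₂ := by
  -- At an unconstrained minimizer without ties, the first-order conditions in the four coordinate
  -- directions say that the superlevel set of the affine function has exactly the integrals l₁ and
  -- l₂.
  have key : ∀ k : ℝ, ∀ m, (∀ m', posMean ν f g (fun _ => k) l₁ l₂ m ≤
      posMean ν f g (fun _ => k) l₁ l₂ m') → (∀ᵐ s ∂ν, affine f g (fun _ => k) m s ≠ 0) →
      ∃ A : Set (ℝ × ℝ), MeasurableSet A ∧ ∫ s, A.indicator 1 s * f s ∂ν = l₁ ∧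
        ∫ s, A.indicator 1 s * g s ∂ν = l₂ := by
    intro k m hmin hne
    have hfo := fun m' => posMean_first_order hfm hgm measurable_const hf hg (integrable_const k)
      convex_univ (Set.mem_univ m) (fun m' _ => hmin m') hne (Set.mem_univ m')
    have hA : ∀ s, {s | 0 ≤ affine f g (fun _ => k) m s}.indicator (1 : ℝ × ℝ → ℝ) s =
        posRule f g (fun _ => k) m s := fun s => by
      simp [Set.indicator, posRule]
    refine ⟨{s | 0 ≤ affine f g (fun _ => k) m s},
      measurableSet_le measurable_const (by unfold affine; fun_prop), ?_, ?_⟩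
    · simp only [hA]
      have h1 := hfo (m.1 + 1, m.2)
      have h2 := hfo (m.1 - 1, m.2)
      simp only [add_sub_cancel_left, sub_self, zero_mul, add_zero, one_mul] at h1 h2
      linarith
    · simp only [hA]
      have h1 := hfo (m.1, m.2 + 1)
      have h2 := hfo (m.1, m.2 - 1)
      simp only [add_sub_cancel_left, sub_self, zero_mul, zero_add, one_mul] at h1 h2
      linarith
  -- If the support inequality is tight at some m ≠ 0, this m minimizes the homogeneous function and
  -- ties there are negligible.
  by_cases h : ∃ m, m ≠ 0 ∧ posMean ν f g (fun _ => 0) l₁ l₂ m = 0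
  · obtain ⟨m, hm, h0⟩ := h
    exact key 0 m (fun m' => h0.trans_le (hsupp m')) (hne₀ m hm)
  push Not at h
  have hc₀ : Continuous (posMean ν f g (fun _ => 0) l₁ l₂) :=
    continuous_posMean hf hg (integrable_const 0)
  have hc₁ : Continuous (posMean ν f g (fun _ => 1) l₁ l₂) :=
    continuous_posMean hf hg (integrable_const 1)
  -- Otherwise 0 is the only minimizer of the homogeneous function, and there everything ties.
  -- Replacing the constant 0 by 1 removes these ties; positivity on the compact unit sphere and
  -- homogeneity make the new function coercive, so it has a minimizer.
  have hsph : (Metric.sphere (0 : ℝ × ℝ) 1).Nonempty := ⟨(1, 0), by simp [Prod.norm_def]⟩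
  obtain ⟨e, he, hemin⟩ := (isCompact_sphere (0 : ℝ × ℝ) 1).exists_isMinOn hsph hc₀.continuousOn
  have he0 : e ≠ 0 := by
    rintro rfl
    simp at he
  have hδ : 0 < posMean ν f g (fun _ => 0) l₁ l₂ e := lt_of_le_of_ne (hsupp e) (h e he0).symm
  set δ := posMean ν f g (fun _ => 0) l₁ l₂ e
  have hle : ∀ m, posMean ν f g (fun _ => 0) l₁ l₂ m ≤ posMean ν f g (fun _ => 1) l₁ l₂ m := by
    intro m
    refine sub_le_sub_right (integral_mono
      (integrable_affine hf hg (integrable_const 0) m).pos_part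
      (integrable_affine hf hg (integrable_const 1) m).pos_part fun s => ?_) _
    exact max_le_max (by unfold affine; linarith) le_rfl
  obtain ⟨m, hm⟩ := hc₁.exists_forall_le' 0 (by
    filter_upwards [(tendsto_norm_cocompact_atTop (E := ℝ × ℝ)).eventually_ge_atTop
      (posMean ν f g (fun _ => 1) l₁ l₂ 0 / δ + 1)] with m hm
    have h0 : posMean ν f g (fun _ => 1) l₁ l₂ 0 = 1 := by
      simp [posMean, affine]
    have hpos : 0 < ‖m‖ := lt_of_lt_of_le (by rw [h0]; positivity) hm
    have h1 : ‖m‖⁻¹ • m ∈ Metric.sphere (0 : ℝ × ℝ) 1 := by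
      rw [mem_sphere_zero_iff_norm, norm_smul, norm_inv, norm_norm, inv_mul_cancel₀ hpos.ne']
    have h2 : δ ≤ posMean ν f g (fun _ => 0) l₁ l₂ (‖m‖⁻¹ • m) := hemin h1
    have h3 := posMean_smul (ν := ν) (a := f) (b := g) (l₁ := l₁) (l₂ := l₂) hpos.le (‖m‖⁻¹ • m)
    rw [smul_inv_smul₀ hpos.ne'] at h3
    have h4 : posMean ν f g (fun _ => 1) l₁ l₂ 0 ≤ ‖m‖ * δ := by
      rw [← div_le_iff₀ hδ]; linarith
    exact (h4.trans (mul_le_mul_of_nonneg_left h2 hpos.le)).trans (h3 ▸ hle m))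
  exact key 1 m hm (hne₁ m)

end AffineMean

/-! ### Argmax rules -/

/-- The mode in the list, or the initial mode `a`, at which `v` is largest; ties are broken in
favour of the earlier mode. -/
noncomputable def firstMax (v : Mode → ℝ) : List Mode → Mode → Mode
  | [], a => a
  | b :: l, a => firstMax v l (if v a < v b then b else a)

lemma le_firstMax (v : Mode → ℝ) (l : List Mode) (a : Mode) :
    v a ≤ v (firstMax v l a) ∧ ∀ b ∈ l, v b ≤ v (firstMax v l a) := by
  induction l generalizing a with
  | nil => simp [firstMax]
  | cons b l ih =>
    have h := ih (if v a < v b then b else a)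
    have hab : v a ≤ v (if v a < v b then b else a) ∧ v b ≤ v (if v a < v b then b else a) := by
      split_ifs with h'
      · exact ⟨h'.le, le_rfl⟩
      · exact ⟨le_rfl, not_lt.1 h'⟩
    refine ⟨hab.1.trans h.1, fun c hc => ?_⟩
    rcases List.mem_cons.1 hc with rfl | hc
    · exact hab.2.trans h.1
    · exact h.2 c hc

lemma firstMax_of_max (v : Mode → ℝ) (l : List Mode) {a : Mode} (h : ∀ b, v b ≤ v a) :
    firstMax v l a = a := by
  induction l with
  | nil => rfl
  | cons b l ih => rwa [firstMax, if_neg (not_lt.2 (h b))]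

lemma measurableSet_firstMax {v : ℝ × ℝ → Mode → ℝ} (hv : ∀ k, Measurable fun s => v s k)
    (l : List Mode) (a k : Mode) : MeasurableSet {s | firstMax (v s) l a = k} := by
  induction l generalizing a with
  | nil => exact MeasurableSet.const (a = k)
  | cons b l ih =>
    have h : {s | firstMax (v s) (b :: l) a = k} =
        Set.ite {s | v s a < v s b} {s | firstMax (v s) l b = k} {s | firstMax (v s) l a = k} := by
      ext s
      by_cases hs : v s a < v s b <;> simp [firstMax, Set.ite, hs]
    rw [h]
    exact (measurableSet_lt (hv a) (hv b)).ite (ih b) (ih a)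

lemma measurable_metric (P : Powers) (x y t : ℝ) (k : Mode) :
    Measurable fun s => metric P x y t s k := by
  cases k <;> simp only [metric, modeVec] <;> fun_prop

/-- An argmax rule that prefers `M3` on `A` and `M6` outside `A`. -/
lemma exists_isArgmaxRule (P : Powers) (d : Params) {A : Set (ℝ × ℝ)} (hA : MeasurableSet A) :
    ∃ sel, IsArgmaxRule P d sel ∧ ∀ I s,
      (s ∈ A → (∀ k, I k * metric P d.μ₁ d.μ₂ d.t s k ≤ I .M3 * metric P d.μ₁ d.μ₂ d.t s .M3) →
        sel I s = .M3) ∧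
      (s ∉ A → (∀ k, I k * metric P d.μ₁ d.μ₂ d.t s k ≤ I .M6 * metric P d.μ₁ d.μ₂ d.t s .M6) →
        sel I s = .M6) := by
  classical
  set v : (Mode → ℝ) → ℝ × ℝ → Mode → ℝ := fun I s k => I k * metric P d.μ₁ d.μ₂ d.t s k with hv
  -- Starting the scan at the preferred mode makes that mode win all ties.
  refine ⟨fun I s => firstMax (v I s) [.M1, .M2, .M3, .M4, .M5, .M6] (if s ∈ A then .M3 else .M6),
    ⟨fun I k => ?_, fun I s k => ?_⟩, fun I s => ⟨fun hs h => ?_, fun hs h => ?_⟩⟩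
  · have hm : ∀ k, Measurable fun s => v I s k := fun k =>
      (measurable_metric P d.μ₁ d.μ₂ d.t k).const_mul _
    have h : {s | firstMax (v I s) [.M1, .M2, .M3, .M4, .M5, .M6] (if s ∈ A then .M3 else .M6) = k}
        = Set.ite A {s | firstMax (v I s) [.M1, .M2, .M3, .M4, .M5, .M6] .M3 = k}
          {s | firstMax (v I s) [.M1, .M2, .M3, .M4, .M5, .M6] .M6 = k} := by
      ext s
      by_cases hs : s ∈ A <;> simp [Set.ite, hs]
    rw [h]
    exact hA.ite (measurableSet_firstMax hm _ _ _) (measurableSet_firstMax hm _ _ _)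
  · exact (le_firstMax (v I s) _ _).2 k (by cases k <;> simp)
  · simp only [if_pos hs]
    exact firstMax_of_max _ _ h
  · simp only [if_neg hs]
    exact firstMax_of_max _ _ h

/-! ### Region `R₀` without time sharing -/

/-- The pairs of thresholds of which user 1's is not the smaller one. -/
def thresholds : Set (ℝ × ℝ) := {m | 0 ≤ m.2 ∧ m.2 ≤ m.1 ∧ m.1 ≤ 1}

lemma mem_thresholds {x y : ℝ} : (x, y) ∈ thresholds ↔ 0 ≤ y ∧ y ≤ x ∧ x ≤ 1 := Iff.rfl

lemma convex_thresholds : Convex ℝ thresholds := by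
  rintro ⟨x, y⟩ ⟨h1, h2, h3⟩ ⟨x', y'⟩ ⟨h1', h2', h3'⟩ a b ha hb hab
  simp only at h1 h2 h3 h1' h2' h3'
  refine ⟨?_, ?_, ?_⟩ <;> simp only [Prod.snd_add, Prod.fst_add, Prod.smul_fst, Prod.smul_snd,
    smul_eq_mul]
  · positivity
  · gcongr
  · calc a * x + b * x' ≤ a * 1 + b * 1 := by gcongr
      _ = 1 := by linarith

lemma isCompact_thresholds : IsCompact thresholds := by
  refine ((isCompact_Icc (a := (0 : ℝ)) (b := 1)).prod (isCompact_Icc (a := (0 : ℝ)) (b := 1))).of_isClosed_subset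
    ?_ ?_
  · exact ((isClosed_le continuous_const continuous_snd).inter
      ((isClosed_le continuous_snd continuous_fst).inter
        (isClosed_le continuous_fst continuous_const)))
  · rintro ⟨x, y⟩ ⟨h1, h2, h3⟩
    exact ⟨⟨h1.trans h2, h3⟩, ⟨h1, h2.trans h3⟩⟩

/-- The dual function, up to an additive constant. -/
noncomputable def dual (P : Powers) (ν : Measure (ℝ × ℝ)) : ℝ × ℝ → ℝ :=
  posMean ν (fun s => -(Cr P s - C2r P s + Cr2 P s)) (fun s => -(C2r P s + Cr1 P s)) (Cr P)
    (-∫ s, Cr2 P s ∂ν) (-∫ s, Cr1 P s ∂ν)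

lemma affine_eq_gap (P : Powers) (m s : ℝ × ℝ) :
    affine (fun s => -(Cr P s - C2r P s + Cr2 P s)) (fun s => -(C2r P s + Cr1 P s)) (Cr P) m s =
      gap P m.1 m.2 s := by
  unfold affine gap
  ring

lemma posRule_eq_macRule (P : Powers) (m : ℝ × ℝ) :
    posRule (fun s => -(Cr P s - C2r P s + Cr2 P s)) (fun s => -(C2r P s + Cr1 P s)) (Cr P) m =
      macRule P m.1 m.2 := by
  funext s
  rw [posRule, affine_eq_gap, macRule]

lemma IsRule.net_eq_integral_mul {ν : Measure (ℝ × ℝ)} {φ f h : ℝ × ℝ → ℝ} (hφ : IsRule φ)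
    (hf : Integrable f ν) (hh : Integrable h ν) :
    net ν φ f h = ∫ s, φ s * (f s + h s) ∂ν - ∫ s, h s ∂ν := by
  have hs : Integrable (fun s => f s + h s) ν := hf.add hh
  rw [← integral_sub (hφ.integrable_mul hs) hh]
  exact integral_congr_ae (ae_of_all _ fun s => by simp only; ring)

namespace IsGainLaw

variable {ν : Measure (ℝ × ℝ)} (hν : IsGainLaw ν) {P : Powers}
include hν

lemma exists_dual_min (P : Powers) : ∃ m ∈ thresholds, ∀ m' ∈ thresholds, dual P ν m ≤ dual P ν m' :=
  isCompact_thresholds.exists_isMinOn ⟨(0, 0), by simp [mem_thresholds]⟩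
    (continuous_posMean ((hν.integrable_Cr_sub P).add (hν.integrable_Cr2 P)).neg
      ((hν.integrable_C2r P).add (hν.integrable_Cr1 P)).neg (hν.integrable_Cr P)).continuousOn

/-- The gradient of the dual function is (-flow₁, -flow₂); this is the variational inequality at a
minimizer over the triangle. -/
lemma dual_first_order {x y : ℝ} (hm : (x, y) ∈ thresholds)
    (hmin : ∀ m' ∈ thresholds, dual P ν (x, y) ≤ dual P ν m') (h : x ≠ 1 ∨ y ≠ 0 ∨ P.P₂ ≠ P.Pr)
    {x' y' : ℝ} (hm' : (x', y') ∈ thresholds) :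
    (x' - x) * flow₁ P ν x y + (y' - y) * flow₂ P ν x y ≤ 0 := by
  have hφ := isRule_macRule P x y
  have hfo := posMean_first_order (by fun_prop) (by fun_prop) (by fun_prop)
    ((hν.integrable_Cr_sub P).add (hν.integrable_Cr2 P)).neg
    ((hν.integrable_C2r P).add (hν.integrable_Cr1 P)).neg (hν.integrable_Cr P)
    convex_thresholds hm hmin (by
      filter_upwards [hν.ae_gap_ne P h] with s hs
      have := affine_eq_gap P (x, y) s
      exact this.trans_ne hs) hm'
  have hr := posRule_eq_macRule P (x, y)
  have e1 : ∫ s, macRule P x y s * -(Cr P s - C2r P s + Cr2 P s) ∂ν - -∫ s, Cr2 P s ∂ν =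
      -flow₁ P ν x y := by
    rw [flow₁, hφ.net_eq_integral_mul (hν.integrable_Cr_sub P) (hν.integrable_Cr2 P)]
    simp only [mul_neg, integral_neg]
    ring
  have e2 : ∫ s, macRule P x y s * -(C2r P s + Cr1 P s) ∂ν - -∫ s, Cr1 P s ∂ν =
      -flow₂ P ν x y := by
    rw [flow₂, hφ.net_eq_integral_mul (hν.integrable_C2r P) (hν.integrable_Cr1 P)]
    simp only [mul_neg, integral_neg]
    ring
  change 0 ≤ (x' - x) * (∫ s, posRule (fun s => -(Cr P s - C2r P s + Cr2 P s))
    (fun s => -(C2r P s + Cr1 P s)) (Cr P) (x, y) s * -(Cr P s - C2r P s + Cr2 P s) ∂ν -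
      -∫ s, Cr2 P s ∂ν) + (y' - y) * (∫ s, posRule (fun s => -(Cr P s - C2r P s + Cr2 P s))
    (fun s => -(C2r P s + Cr1 P s)) (Cr P) (x, y) s * -(C2r P s + Cr1 P s) ∂ν -
      -∫ s, Cr1 P s ∂ν) at hfo
  rw [hr] at hfo
  simp only [e1, e2] at hfo
  linarith

lemma inR1_of_gt (h : P.Pr < P.P₂) {y : ℝ} (hy : y ∈ Set.Icc (0 : ℝ) 1) (h2 : flow₂ P ν 1 y = 0)
    (h1 : 0 < flow₁ P ν 1 y) : InR1 P ν :=
  ⟨y, hy, (hν.R1_balanced_iff_of_gt h y).2 h2, Or.inl ⟨h, (hν.R1_ω₁_lt_one_iff h h2).2 h1⟩⟩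

lemma inR1_of_lt (h : P.P₂ < P.Pr) {x : ℝ} (hx : x ∈ Set.Icc (0 : ℝ) 1) (h1 : flow₁ P ν x 0 = 0)
    (h2 : flow₂ P ν x 0 < 0) : InR1 P ν :=
  ⟨x, hx, (hν.R1_balanced_iff_of_lt h x).2 h1, Or.inr (Or.inl ⟨h, (hν.R1_ω₂_lt_one_iff h h1).2 h2⟩)⟩

/-- Outside region `R₁`, both flows vanish at a minimizer of the dual function, unless it is the
corner at which all modes tie. -/
lemma flow_eq_zero_of_dual_min (hR : ¬ InR1 P ν) {μ : ℝ} (h0 : flow₁ P ν μ μ + flow₂ P ν μ μ = 0)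
    (hμ : 0 ≤ flow₁ P ν μ μ) {x y : ℝ} (hm : (x, y) ∈ thresholds)
    (hmin : ∀ m' ∈ thresholds, dual P ν (x, y) ≤ dual P ν m')
    (h : x ≠ 1 ∨ y ≠ 0 ∨ P.P₂ ≠ P.Pr) : flow₁ P ν x y = 0 ∧ flow₂ P ν x y = 0 := by
  obtain ⟨hy, hyx, hx⟩ := mem_thresholds.1 hm
  -- Testing against the three vertices of the triangle suffices.
  have v00 := hν.dual_first_order hm hmin h (x' := 0) (y' := 0) (by simp [mem_thresholds])
  have v10 := hν.dual_first_order hm hmin h (x' := 1) (y' := 0) (by simp [mem_thresholds])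
  have v11 := hν.dual_first_order hm hmin h (x' := 1) (y' := 1) (by simp [mem_thresholds])
  rcases hyx.eq_or_lt with rfl | hlt
  · rcases hy.eq_or_lt with rfl | hy
    · have := hν.flow_pos P (hν.gap_zero_zero_pos P)
      linarith
    rcases hx.eq_or_lt with rfl | hx
    · have := hν.flow_neg P (hν.gap_one_one_neg P)
      linarith
    -- Inside the diagonal the total flow vanishes, so the rule is that of μ. The vertex (1,0) gives
    -- `flow₁ ≤ 0`, and `hμ` gives the opposite inequality.
    have hs : flow₁ P ν y y + flow₂ P ν y y = 0 := by nlinarith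
    have he := hν.macRule_ae_eq_of_flow_add_eq P (hs.trans h0.symm)
    have h1 : flow₁ P ν y y = flow₁ P ν μ μ := net_congr he
    have h2 : flow₁ P ν y y ≤ 0 := by nlinarith
    constructor <;> linarith
  rcases hx.eq_or_lt with rfl | hx <;> rcases hy.eq_or_lt with rfl | hy
  · rcases lt_trichotomy P.P₂ P.Pr with hP | hP | hP
    · have := hν.flow_neg P (hν.gap_corner_neg hP)
      linarith
    · tauto
    · have := hν.flow_pos P (hν.gap_corner_pos hP)
      linarith
  -- On the edge x = 1 the second flow vanishes; a positive first flow would put the channel in R₁,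
  -- and the vertex (0,0) excludes a negative one.
  · have h2 : flow₂ P ν 1 y = 0 := le_antisymm (by nlinarith) (by nlinarith)
    rcases lt_or_ge P.Pr P.P₂ with hP | hP
    · refine ⟨le_antisymm (not_lt.1 fun h1 => hR (hν.inR1_of_gt hP ⟨hy.le, hlt.le⟩ h2 h1)) ?_, h2⟩
      rw [h2] at v00
      linarith
    · have := hν.flow_neg P (hν.gap_one_neg hP hy)
      linarith
  · have h1 : flow₁ P ν x 0 = 0 := le_antisymm (by nlinarith) (by nlinarith)
    rcases lt_or_ge P.P₂ P.Pr with hP | hP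
    · refine ⟨h1, le_antisymm ?_ (not_lt.1 fun h2 => hR (hν.inR1_of_lt hP ⟨hlt.le, hx.le⟩ h1 h2))⟩
      rw [h1] at v11
      linarith
    · have := hν.flow_pos P (hν.gap_zero_pos hP hlt.le hx)
      linarith
  -- The barycentric weights 1 - x, x - y, y of an interior point are positive, and the vertex
  -- inequalities cancel under them; hence all three are equalities.
  · have e : x * flow₁ P ν x y + y * flow₂ P ν x y = 0 := by
      refine le_antisymm (not_lt.1 fun hc => ?_) (by linarith)
      have := mul_pos (sub_pos.2 hx) hc
      have := mul_le_mul_of_nonneg_left v10 (sub_nonneg.2 hlt.le)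
      have := mul_le_mul_of_nonneg_left v11 hy.le
      nlinarith
    have e1 : (1 - x) * flow₁ P ν x y - y * flow₂ P ν x y ≤ 0 := by linarith
    have e2 : flow₁ P ν x y ≤ 0 := by linarith
    have e3 : flow₁ P ν x y + flow₂ P ν x y ≤ 0 := by linarith
    have e4 : flow₂ P ν x y = -(x / y) * flow₁ P ν x y := by field_simp; linarith
    have h1 : flow₁ P ν x y = 0 := by
      refine le_antisymm e2 (not_lt.1 fun hc => ?_)
      have : 0 ≤ flow₂ P ν x y := by
        rw [e4]; nlinarith [div_pos (hy.trans hlt) hy]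
      have h3 : 0 < (y - x) * flow₁ P ν x y := mul_pos_of_neg_of_neg (sub_neg.2 hlt) hc
      nlinarith
    refine ⟨h1, ?_⟩
    rw [e4, h1, mul_zero]

end IsGainLaw

/-! ### The prescription can be met -/

namespace IsGainLaw

variable {ν : Measure (ℝ × ℝ)} (hν : IsGainLaw ν) {P : Powers}
include hν

/-- If the corner at which all modes tie minimizes the dual function outside region `R₁`, then some
way of breaking the ties balances the flows. -/
lemma exists_tie_breaking (h : P.P₂ = P.Pr) (hω : R1.ω₃u P ν ≤ R1.ω₃l P ν)
    (hmin : ∀ m' ∈ thresholds, dual P ν (1, 0) ≤ dual P ν m') :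
    ∃ A : Set (ℝ × ℝ), MeasurableSet A ∧
      net ν (A.indicator 1) (fun s => Cr P s - C2r P s) (Cr2 P) = 0 ∧
      net ν (A.indicator 1) (C2r P) (Cr1 P) = 0 := by
  have := hν.prob
  have hC := C2r_eq_Cr2 h
  have hg : Integrable (fun s => C2r P s + Cr1 P s) ν :=
    (hν.integrable_C2r P).add (hν.integrable_Cr1 P)
  have hne : ∀ (k : ℝ) (m : ℝ × ℝ), m ≠ 0 →
      ∀ᵐ s ∂ν, affine (Cr P) (fun s => C2r P s + Cr1 P s) (fun _ => k) m s ≠ 0 := by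
    intro k m hm
    have had : m.1 ≠ 0 ∨ -m.2 ≠ 0 := by
      by_contra hc
      push Not at hc
      exact hm (Prod.ext hc.1 (neg_eq_zero.1 hc.2))
    have hk : Measurable fun u : ℝ => m.2 * cap (P.P₂ * u) + k :=
      ((measurable_cap.comp (by fun_prop)).const_mul _).add_const _
    filter_upwards [hν.ae_tie_ne P had hk] with s hs h0
    apply hs
    simp only [affine, C2r] at h0
    linarith
  -- With equal powers, vanishing flows mean ∫ φ Cr = ∫ Cr2 and ∫ φ (C2r + Cr1) = ∫ Cr1. The support
  -- inequalities for these targets are proved by quadrants: the constant selections 1, 0 and ω₃l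
  -- settle three of them, and optimality of the corner the fourth.
  have hsupp : ∀ m, 0 ≤ posMean ν (Cr P) (fun s => C2r P s + Cr1 P s) (fun _ => 0)
      (∫ s, Cr2 P s ∂ν) (∫ s, Cr1 P s ∂ν) m := by
    have hnz := hν.neZero
    have p1 := integral_pos_of_ae_pos (hν.integrable_Cr P) (hν.ae_Cr_pos P)
    have p2 := integral_pos_of_ae_pos (hν.integrable_Cr1 P) (hν.ae_Cr1_pos P)
    have p3 := integral_pos_of_ae_pos (hν.integrable_Cr2 P) (hν.ae_Cr2_pos P)
    have hG : ∫ s, (C2r P s + Cr1 P s) ∂ν = ∫ s, Cr1 P s ∂ν + ∫ s, Cr2 P s ∂ν := by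
      rw [integral_add (hν.integrable_C2r P) (hν.integrable_Cr1 P), add_comm]
      simp only [hC]
    have hl := hν.R1_ω₃l_mem h
    have hl' : R1.ω₃l P ν * ∫ s, Cr P s ∂ν = ∫ s, Cr2 P s ∂ν := div_mul_cancel₀ _ p1.ne'
    have hu' : R1.ω₃u P ν * (∫ s, Cr1 P s ∂ν + ∫ s, Cr2 P s ∂ν) = ∫ s, Cr1 P s ∂ν := by
      rw [R1.ω₃u, integral_add (hν.integrable_Cr1 P) (hν.integrable_C2r P)]
      simp only [hC]
      exact div_mul_cancel₀ _ (by linarith)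
    intro m
    have hle := fun (θ : ℝ) (hθ : θ ∈ Set.Icc (0 : ℝ) 1) => le_posMean (l₁ := ∫ s, Cr2 P s ∂ν)
      (l₂ := ∫ s, Cr1 P s ∂ν) (hν.integrable_Cr P) hg hθ m
    rw [hG] at hle
    rcases le_total 0 m.1 with h1 | h1 <;> rcases le_total 0 m.2 with h2 | h2
    · refine le_trans ?_ (hle 1 (by simp))
      have : ∫ s, Cr2 P s ∂ν ≤ ∫ s, Cr P s ∂ν := by nlinarith [hl.2]
      nlinarith [mul_le_mul_of_nonneg_left this h1, mul_nonneg h2 p3.le]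
    -- The scaling puts (1,0) - r m inside the triangle. As the gap vanishes at the corner, the
    -- increase of the dual function is exactly the support function at r m, and homogeneity removes
    -- r.
    · set r := (m.1 - m.2 + 1)⁻¹ with hr
      have hden : 0 < m.1 - m.2 + 1 := by linarith
      have hr0 : 0 < r := inv_pos.2 hden
      have hrr : r * (m.1 - m.2 + 1) = 1 := inv_mul_cancel₀ hden.ne'
      refine nonneg_of_mul_nonneg_right (a := r) ?_ hr0
      rw [← posMean_smul hr0.le]
      have hm' : (1 - r * m.1, -(r * m.2)) ∈ thresholds := by
        rw [mem_thresholds]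
        refine ⟨?_, ?_, ?_⟩ <;> nlinarith [mul_nonneg hr0.le h1, mul_nonneg hr0.le (neg_nonneg.2 h2)]
      have hd := hmin _ hm'
      have e1 : dual P ν (1, 0) = ∫ s, Cr2 P s ∂ν := by
        have : ∀ s, max (gap P 1 0 s) 0 = 0 := fun s => by
          simp [gap, hC]
        simp only [dual, posMean, affine_eq_gap, this]
        simp
      have e2 : dual P ν (1 - r * m.1, -(r * m.2)) = ∫ s, Cr2 P s ∂ν +
          posMean ν (Cr P) (fun s => C2r P s + Cr1 P s) (fun _ => 0)
            (∫ s, Cr2 P s ∂ν) (∫ s, Cr1 P s ∂ν) (r • m) := by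
        have : ∀ s, gap P (1 - r * m.1) (-(r * m.2)) s =
            affine (Cr P) (fun s => C2r P s + Cr1 P s) (fun _ => 0) (r • m) s := fun s => by
          simp only [gap, affine, hC, Prod.smul_fst, Prod.smul_snd, smul_eq_mul]
          ring
        simp only [dual, posMean, affine_eq_gap, this, Prod.smul_fst, Prod.smul_snd, smul_eq_mul]
        ring
      linarith
    -- The selection ω₃l makes the first coordinate exact; `hω` gives the correct sign in the
    -- second.
    · refine le_trans ?_ (hle _ ⟨hl.1.le, hl.2.le⟩)
      have h3 := mul_le_mul_of_nonneg_right hω (add_pos p2 p3).le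
      rw [hu'] at h3
      have h4 := mul_le_mul_of_nonneg_left h3 h2
      rw [← hl'] at h4 ⊢
      linarith
    · refine le_trans ?_ (hle 0 (by simp))
      nlinarith [mul_nonneg (neg_nonneg.2 h1) p3.le, mul_nonneg (neg_nonneg.2 h2) p2.le]
  obtain ⟨A, hA, h1, h2⟩ := exists_set_of_support (by fun_prop) (by fun_prop) (hν.integrable_Cr P) hg
    hsupp (hne 0) (fun m => by
      by_cases hm : m = 0
      · refine ae_of_all _ fun s => ?_
        simp [hm, affine]
      · exact hne 1 m hm)
  have hφ : IsRule (A.indicator (1 : ℝ × ℝ → ℝ)) :=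
    ⟨measurable_one.indicator hA, fun s => by by_cases hs : s ∈ A <;> simp [hs]⟩
  refine ⟨A, hA, ?_, ?_⟩
  · rw [hφ.net_eq_integral_mul (hν.integrable_Cr_sub P) (hν.integrable_Cr2 P), sub_eq_zero, ← h1]
    refine integral_congr_ae (ae_of_all _ fun s => ?_)
    simp only [hC]
    ring
  · rw [hφ.net_eq_integral_mul (hν.integrable_C2r P) (hν.integrable_Cr1 P), h2, sub_self]

/-- A rule without net flows is balanced in the mean. -/
lemma meanBalanced_zero {κ : ℝ × ℝ → Mode} {φ : ℝ × ℝ → ℝ} (hφ : IsRule φ)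
    (h : ∀ᵐ s ∂ν, (κ s = .M3 ∧ φ s = 1) ∨ (κ s = .M6 ∧ φ s = 0))
    (h1 : net ν φ (fun s => Cr P s - C2r P s) (Cr2 P) = 0) (h2 : net ν φ (C2r P) (Cr1 P) = 0) :
    MeanBalanced P ν 0 κ := by
  rw [hφ.net_eq (hν.integrable_Cr_sub P) (hν.integrable_Cr2 P), sub_eq_zero] at h1
  rw [hφ.net_eq (hν.integrable_C2r P) (hν.integrable_Cr1 P), sub_eq_zero] at h2
  constructor
  · refine Eq.trans ?_ (h1.trans ?_) <;> refine integral_congr_ae ?_ <;>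
      filter_upwards [h, hν.pos] with s hs hp <;> rcases hs with hs | hs <;>
      simp [hs.1, hs.2, pick, C12r_zero P hp.1.le hp.2.le]
  · refine Eq.trans ?_ (h2.trans ?_) <;> refine integral_congr_ae ?_ <;>
      filter_upwards [h, hν.pos] with s hs hp <;> rcases hs with hs | hs <;>
      simp [hs.1, hs.2, pick, C21r_zero P hp.1.le hp.2.le]

/-- A minimizer of the dual function over the triangle has vanishing flows, and preferring M3 at
ties reproduces `macRule`. Only the corner (1,0) with equal powers requires a separate tie-breaking
set. -/
lemma exists_R0_meanBalanced (hR : ¬ InR1 P ν) {μ : ℝ} (h0 : flow₁ P ν μ μ + flow₂ P ν μ μ = 0)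
    (hμ : 0 ≤ flow₁ P ν μ μ) (p : Coin → ℝ) (ind : (Coin → ℝ) → Mode → ℝ) :
    ∃ x y sel, 0 ≤ y ∧ y ≤ x ∧ x ≤ 1 ∧ IsArgmaxRule P ⟨x, y, 0, p, ind⟩ sel ∧
      MeanBalanced P ν 0 (sel indR0) := by
  obtain ⟨⟨x, y⟩, hm, hmin⟩ := hν.exists_dual_min P
  obtain ⟨hy, hyx, hx⟩ := mem_thresholds.1 hm
  by_cases htie : x ≠ 1 ∨ y ≠ 0 ∨ P.P₂ ≠ P.Pr
  · obtain ⟨hf1, hf2⟩ := hν.flow_eq_zero_of_dual_min hR h0 hμ hm hmin htie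
    obtain ⟨sel, hsel, hpref⟩ := exists_isArgmaxRule P ⟨x, y, 0, p, ind⟩
      (measurableSet_le measurable_const (measurable_gap P x y) : MeasurableSet {s | 0 ≤ gap P x y s})
    refine ⟨x, y, sel, hy, hyx, hx, hsel, hν.meanBalanced_zero (isRule_macRule P x y) ?_ hf1 hf2⟩
    filter_upwards [hν.pos] with s hs
    have hge := gap_eq P x y hs.1.le hs.2.le
    have h3 : 0 ≤ metric P x y 0 s .M3 := by
      rw [metric_M3_zero P x y hs.1.le hs.2.le]
      have := C2r_lt_Cr (P := P) hs.1 hs.2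
      have := C2r_pos (P := P) hs.2
      have : 0 ≤ 1 - x := by linarith
      have : 0 ≤ 1 - y := by linarith
      have : 0 ≤ Cr P s - C2r P s := by linarith
      positivity
    have h6 : 0 ≤ metric P x y 0 s .M6 := by
      rw [metric_M6]
      have := Cr1_pos (P := P) hs.1
      have := Cr2_pos (P := P) hs.2
      have : 0 ≤ x := hy.trans hyx
      positivity
    by_cases hA : 0 ≤ gap P x y s
    · refine Or.inl ⟨(hpref indR0 s).1 hA fun k => ?_, if_pos hA⟩
      cases k <;> simp [indR0, modeVec] <;> linarith
    · refine Or.inr ⟨(hpref indR0 s).2 hA fun k => ?_, if_neg hA⟩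
      cases k <;> simp [indR0, modeVec] <;> linarith
  · push Not at htie
    obtain ⟨rfl, rfl, hP⟩ := htie
    have hω : R1.ω₃u P ν ≤ R1.ω₃l P ν := not_lt.1 fun h => hR
      ⟨0, by simp, ⟨fun h' => absurd hP h'.ne', fun h' => absurd hP h'.ne⟩, Or.inr (Or.inr ⟨hP, h⟩)⟩
    obtain ⟨A, hA, hf1, hf2⟩ := hν.exists_tie_breaking hP hω hmin
    obtain ⟨sel, hsel, hpref⟩ := exists_isArgmaxRule P ⟨1, 0, 0, p, ind⟩ hA
    have hφ : IsRule (A.indicator (1 : ℝ × ℝ → ℝ)) :=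
      ⟨measurable_one.indicator hA, fun s => by by_cases hs : s ∈ A <;> simp [hs]⟩
    refine ⟨1, 0, sel, hy, hyx, hx, hsel, hν.meanBalanced_zero hφ ?_ hf1 hf2⟩
    filter_upwards [hν.pos] with s hs
    have h3 : metric P 1 0 0 s .M3 = Cr2 P s := by
      rw [metric_M3_zero P 1 0 hs.1.le hs.2.le, C2r_eq_Cr2 hP]; ring
    have h6 : metric P 1 0 0 s .M6 = Cr2 P s := by rw [metric_M6]; ring
    have hr := Cr2_nonneg (P := P) hs.2.le
    by_cases hsA : s ∈ A
    · refine Or.inl ⟨(hpref indR0 s).1 hsA fun k => ?_, by simp [hsA]⟩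
      cases k <;> simp [indR0, modeVec, h3, h6, hr]
    · refine Or.inr ⟨(hpref indR0 s).2 hsA fun k => ?_, by simp [hsA]⟩
      cases k <;> simp [indR0, modeVec, h3, h6, hr]

omit hν in
lemma exists_prescribed_of_inR1 (hR : InR1 P ν) : ∃ d sel, Prescribed P ν d sel := by
  have hR' := hR
  have key : ∀ d, PrescribedR1 P ν d → ∃ d sel, Prescribed P ν d sel := fun d hd => by
    obtain ⟨sel, hsel, -⟩ := exists_isArgmaxRule P d MeasurableSet.univ
    exact ⟨d, sel, hsel, Or.inl ⟨hR', hd⟩⟩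
  obtain ⟨μ, hμ, hb, ⟨h, -⟩ | ⟨h, -⟩ | ⟨h, hω⟩⟩ := hR
  · exact key ⟨1, μ, 0, coinVec (R1.ω₁ P ν μ) 0 0 0 0, _⟩ ⟨rfl, Or.inl ⟨h, rfl, hμ, hb, rfl, rfl⟩⟩
  · exact key ⟨μ, 0, 0, coinVec 0 (R1.ω₂ P ν μ) 0 0 0, _⟩ ⟨rfl, Or.inr (Or.inl ⟨h, hμ, hb, rfl, rfl, rfl⟩)⟩
  · exact key ⟨1, 0, 0, _, _⟩
      ⟨rfl, Or.inr (Or.inr ⟨h, rfl, rfl, ⟨R1.ω₃l P ν, ⟨le_rfl, hω.le⟩, rfl⟩, rfl⟩)⟩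

lemma exists_prescribed_of_inR0 (hR : InR0 P ν) {μ : ℝ} (hμ : μ ∈ Set.Ioo (0 : ℝ) 1)
    (hb : R0.Balanced P ν μ) (ht : R0.t P ν μ < 1) : ∃ d sel, Prescribed P ν d sel := by
  rcases lt_or_ge 0 (R0.t P ν μ) with h | h
  · obtain ⟨sel, hsel, -⟩ := exists_isArgmaxRule P
      ⟨μ, μ, R0.t P ν μ, coinVec 0 0 0 0 0, fun _ => indR0⟩ MeasurableSet.univ
    exact ⟨_, sel, hsel, Or.inr (Or.inr ⟨hR, rfl, rfl, μ, hμ, hb, Or.inl ⟨h, ht, rfl, rfl, rfl⟩⟩)⟩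
  · have h0 := (hν.R0_balanced_iff hμ).1 hb
    -- The denominator of t is negative, so t ≤ 0 means a nonnegative first flow.
    have hf : 0 ≤ flow₁ P ν μ μ := by
      have hD := hν.R0_loss_neg h0
      rw [hν.R0_t_eq hμ] at h
      by_contra hc
      exact absurd h (not_le.2 (div_pos_of_neg_of_neg (not_le.1 hc) hD))
    obtain ⟨x, y, sel, hy, hyx, hx, hsel, hmb⟩ := hν.exists_R0_meanBalanced hR.1 h0 hf
      (coinVec 0 0 0 0 0) (fun _ => indR0)
    exact ⟨_, sel, hsel, Or.inr (Or.inr ⟨hR, rfl, rfl, μ, hμ, hb,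
      Or.inr (Or.inl ⟨h, rfl, hy, hyx, hx, hmb⟩)⟩)⟩

end IsGainLaw

/-- In the region that applies, the prescribed choices are possible. -/
theorem exists_prescribed {Ω : Type*} [MeasurableSpace Ω] {ρ : Measure Ω} [IsProbabilityMeasure ρ]
    {S : ℕ → Ω → ℝ × ℝ} (hS : IsFading ρ S) (P : Powers) :
    ∃ d sel, Prescribed P (ρ.map (S 0)) d sel := by
  have hν := hS.isGainLaw
  have hν' := hS.swap.isGainLaw
  rw [hS.map_swap] at hν'
  -- Interchanging the users reduces R₂ to R₁, and the case t ≥ 1 of R₀ to t ≤ 0.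
  have back : (∃ d sel, Prescribed P.swap ((ρ.map (S 0)).map Prod.swap) d sel) →
      ∃ d sel, Prescribed P (ρ.map (S 0)) d sel := by
    rintro ⟨d, sel, h⟩
    have := h.swap hν'
    rw [map_swap_map_swap] at this
    exact ⟨d.swap, swapRule sel, this⟩
  by_cases h1 : InR1 P (ρ.map (S 0))
  · exact IsGainLaw.exists_prescribed_of_inR1 h1
  by_cases h2 : InR2 P (ρ.map (S 0))
  · exact back (IsGainLaw.exists_prescribed_of_inR1 ((inR1_swap _ _).2 h2))
  obtain ⟨μ, hμ, hb⟩ := hν.exists_R0_balanced P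
  rcases lt_or_ge (R0.t P (ρ.map (S 0)) μ) 1 with ht | ht
  · exact hν.exists_prescribed_of_inR0 ⟨h1, h2⟩ hμ hb ht
  · refine back (hν'.exists_prescribed_of_inR0 ((inR0_swap _ _).2 ⟨h1, h2⟩) hμ
      ((R0_balanced_swap _ _ μ).2 hb) ?_)
    rw [hν.R0_t_swap hμ hb]
    linarith

/-! ### The regions `R₁` and `R₂` are mutually exclusive -/

/-- The mean of the larger one of the metrics of the multiple-access and the broadcast mode. -/
noncomputable def meanMax (P : Powers) (ν : Measure (ℝ × ℝ)) (t x y : ℝ) : ℝ :=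
  ∫ s, max (metric P x y t s .M3) (metric P x y t s .M6) ∂ν

lemma meanMax_swap (P : Powers) (ν : Measure (ℝ × ℝ)) (t x y : ℝ) :
    meanMax P.swap (ν.map Prod.swap) (1 - t) y x = meanMax P ν t x y := by
  have h3 := fun s => metric_swap P s x y t .M3
  have h6 := fun s => metric_swap P s x y t .M6
  simp only [Mode.swap_M3, Mode.swap_M6] at h3 h6
  simp only [meanMax, integral_map_swap, h3, h6]

namespace IsGainLaw

variable {ν : Measure (ℝ × ℝ)} (hν : IsGainLaw ν) {P : Powers}
include hν

lemma integrable_metric_max {t : ℝ} (ht : t ∈ Set.Icc (0 : ℝ) 1) (x y : ℝ) :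
    Integrable (fun s => max (metric P x y t s .M3) (metric P x y t s .M6)) ν := by
  have := hν.prob
  have h1 : Integrable (C12r P t) ν := (hν.isFlow_C12r P ht).memLp.integrable one_le_two
  have h2 : Integrable (C21r P t) ν := (hν.isFlow_C21r P ht).memLp.integrable one_le_two
  exact ((h1.const_mul _).add (h2.const_mul _)).sup
    (((hν.integrable_Cr2 P).const_mul _).add ((hν.integrable_Cr1 P).const_mul _))

lemma meanMax_zero_eq (x y : ℝ) : meanMax P ν 0 x y =
    (1 - x) * ∫ s, macRule P x y s * (Cr P s - C2r P s) ∂ν +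
      (1 - y) * ∫ s, macRule P x y s * C2r P s ∂ν +
      (x * ∫ s, (1 - macRule P x y s) * Cr2 P s ∂ν +
        y * ∫ s, (1 - macRule P x y s) * Cr1 P s ∂ν) := by
  have hφ := isRule_macRule P x y
  have i1 := (hφ.integrable_mul (hν.integrable_Cr_sub P)).const_mul (1 - x)
  have i2 := (hφ.integrable_mul (hν.integrable_C2r P)).const_mul (1 - y)
  have i3 := (hφ.compl.integrable_mul (hν.integrable_Cr2 P)).const_mul x
  have i4 := (hφ.compl.integrable_mul (hν.integrable_Cr1 P)).const_mul y
  simp only [← integral_const_mul]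
  rw [← integral_add' i1 i2, ← integral_add' i3 i4, ← integral_add' (i1.add i2) (i3.add i4)]
  refine integral_congr_ae ?_
  filter_upwards [hν.pos] with s hs
  have hge := gap_eq P x y hs.1.le hs.2.le
  by_cases h : 0 ≤ gap P x y s
  · rw [max_eq_left (by linarith), metric_M3_zero P x y hs.1.le hs.2.le]
    simp only [Pi.add_apply, macRule, if_pos h]
    ring
  · rw [max_eq_right (by linarith), metric_M6]
    simp only [Pi.add_apply, macRule, if_neg h]
    ring

/-- Weak duality: the sum rate of a balanced policy without time sharing is less than every value
of the dual function at thresholds that favour full time sharing. -/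
lemma lt_meanMax_one {φ : ℝ × ℝ → ℝ} (hφ : IsRule φ) {p p' : ℝ} (hp : 0 < p) (hp1 : p ≤ 1)
    (hp' : p' ∈ Set.Icc (0 : ℝ) 1)
    (hpos : 0 < ∫ s, φ s * (C1r P s + C2r P s - Cr P s) ∂ν)
    (h1 : p * ∫ s, φ s * (Cr P s - C2r P s) ∂ν = ∫ s, (1 - φ s) * Cr2 P s ∂ν)
    (h2 : ∫ s, φ s * C2r P s ∂ν = p' * ∫ s, (1 - φ s) * Cr1 P s ∂ν)
    {x y : ℝ} (hx : 0 ≤ x) (hxy : x < y) (hy : y ≤ 1) :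
    ∫ s, (1 - φ s) * Cr2 P s ∂ν + ∫ s, φ s * C2r P s ∂ν < meanMax P ν 1 x y := by
  have i1 := (hφ.integrable_mul (hν.integrable_Cr_sub P)).const_mul (p * (1 - x))
  have i2 := (hφ.integrable_mul (hν.integrable_C2r P)).const_mul (1 - y)
  have i3 := (hφ.compl.integrable_mul (hν.integrable_Cr2 P)).const_mul x
  have i4 := (hφ.compl.integrable_mul (hν.integrable_Cr1 P)).const_mul (p' * y)
  have hloss : Integrable (fun s => C1r P s + C2r P s - Cr P s) ν :=
    ((hν.integrable_C1r P).add (hν.integrable_C2r P)).sub (hν.integrable_Cr P)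
  have i5 := (hφ.integrable_mul hloss).const_mul (p * (y - x))
  -- Pointwise the maximum dominates the φ-mixture of p M3 + (1 - p) M2 and of a broadcast whose
  -- service to user 1 is thinned by p'. Replacing t = 1 by t = 0 in M3 releases the surplus p (y -
  -- x) (C1r + C2r - Cr), the source of strictness.
  have hle : p * (1 - x) * ∫ s, φ s * (Cr P s - C2r P s) ∂ν + (1 - y) * ∫ s, φ s * C2r P s ∂ν +
      (x * ∫ s, (1 - φ s) * Cr2 P s ∂ν + p' * y * ∫ s, (1 - φ s) * Cr1 P s ∂ν) +
      p * (y - x) * ∫ s, φ s * (C1r P s + C2r P s - Cr P s) ∂ν ≤ meanMax P ν 1 x y := by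
    simp only [← integral_const_mul]
    rw [← integral_add' i1 i2, ← integral_add' i3 i4, ← integral_add' (i1.add i2) (i3.add i4),
      ← integral_add' ((i1.add i2).add (i3.add i4)) i5]
    refine integral_mono_ae (((i1.add i2).add (i3.add i4)).add i5)
      (hν.integrable_metric_max (by simp) x y) ?_
    filter_upwards [hν.pos, hν.ae_C1r_pos P, hν.ae_C2r_pos P, hν.ae_Cr1_pos P, hν.ae_Cr2_pos P]
      with s hs c1 c2 c3 c4
    have l1 := C1r_le_Cr (P := P) hs.1.le hs.2.le
    have l2 := C2r_le_Cr (P := P) hs.1.le hs.2.le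
    set M := max (metric P x y 1 s .M3) (metric P x y 1 s .M6) with hM
    have m3 : (1 - x) * C1r P s + (1 - y) * (Cr P s - C1r P s) ≤ M := by
      refine le_trans (le_of_eq ?_) (le_max_left _ _)
      simp only [metric, modeVec, C12r_eq 1 hs.1.le hs.2.le, C21r_eq 1 hs.1.le hs.2.le]
      ring
    have m6 : x * Cr2 P s + y * Cr1 P s ≤ M := le_max_right _ _
    have m2 : (1 - y) * C2r P s ≤ M := by
      nlinarith [mul_nonneg (sub_nonneg.2 hxy.le) c1.le, mul_nonneg (sub_nonneg.2 hy)
        (sub_nonneg.2 l2)]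
    have m5 : x * Cr2 P s + p' * (y * Cr1 P s) ≤ M := by
      nlinarith [mul_nonneg (sub_nonneg.2 hp'.2) (mul_nonneg (hx.trans hxy.le) c3.le)]
    have hφ0 := (hφ.mem s).1
    have hφ1 := sub_nonneg.2 (hφ.mem s).2
    have a1 := mul_le_mul_of_nonneg_left m3 hp.le
    have a2 := mul_le_mul_of_nonneg_left m2 (sub_nonneg.2 hp1)
    have a3 := mul_le_mul_of_nonneg_left (add_le_add a1 a2) hφ0
    have a4 := mul_le_mul_of_nonneg_left m5 hφ1
    simp only [Pi.add_apply]
    nlinarith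
  have hgain := mul_pos (mul_pos hp (sub_pos.2 hxy)) hpos
  rw [← h1] at hle ⊢
  have e : p' * y * ∫ s, (1 - φ s) * Cr1 P s ∂ν = y * ∫ s, φ s * C2r P s ∂ν := by rw [h2]; ring
  rw [e] at hle
  linarith

/-- At the multipliers of region R₁ the dual value equals the sum rate of a balanced policy without
time sharing; that rate is strictly below every dual value with x' < y' and t = 1. -/
lemma exists_meanMax_lt (hR : InR1 P ν) : ∃ x y : ℝ, 0 ≤ y ∧ y < x ∧ x ≤ 1 ∧
    ∀ x' y', 0 ≤ x' → x' < y' → y' ≤ 1 → meanMax P ν 0 x y < meanMax P ν 1 x' y' := by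
  have hnz := hν.neZero
  have hloss : Integrable (fun s => C1r P s + C2r P s - Cr P s) ν :=
    ((hν.integrable_C1r P).add (hν.integrable_C2r P)).sub (hν.integrable_Cr P)
  have hloss' : ∀ᵐ s ∂ν, 0 < C1r P s + C2r P s - Cr P s :=
    hν.pos.mono fun s hs => sub_pos.2 (Cr_lt_add hs.1 hs.2)
  obtain ⟨μ, hμ, hb, ⟨h, hω⟩ | ⟨h, hω⟩ | ⟨h, hω⟩⟩ := hR
  · have h0 := (hν.R1_balanced_iff_of_gt h μ).1 hb
    have hφ := isRule_macRule P 1 μ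
    have hd := (hν.pos_of_flow₂_eq_zero h0 (hν.integrable_Cr_sub P) (hν.ae_Cr_sub_pos P)).1
    have h2 := h0
    rw [flow₂, hφ.net_eq (hν.integrable_C2r P) (hν.integrable_Cr1 P), sub_eq_zero] at h2
    refine ⟨1, μ, hμ.1, lt_of_le_of_ne hμ.2 ?_, le_rfl, fun x' y' hx hxy hy => ?_⟩
    · rintro rfl
      exact (hν.flow_neg P (hν.gap_one_one_neg P)).2.ne h0
    · refine lt_of_eq_of_lt ?_ (hν.lt_meanMax_one hφ (hν.R1_ω₁_pos h h0) hω.le (p' := 1) (by simp)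
        (hν.pos_of_flow₂_eq_zero h0 hloss hloss').1 ?_ (by rw [h2, one_mul]) hx hxy hy)
      · rw [hν.meanMax_zero_eq, ← h2]; ring
      · rw [hν.R1_ω₁_eq h, div_mul_cancel₀ _ hd.ne']
  · have h0 := (hν.R1_balanced_iff_of_lt h μ).1 hb
    have hφ := isRule_macRule P μ 0
    have hd := (hν.pos_of_flow₁_eq_zero h0 (hν.integrable_Cr1 P) (hν.ae_Cr1_pos P)).2
    have h1 := h0
    rw [flow₁, hφ.net_eq (hν.integrable_Cr_sub P) (hν.integrable_Cr2 P), sub_eq_zero] at h1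
    refine ⟨μ, 0, le_rfl, lt_of_le_of_ne hμ.1 ?_, hμ.2, fun x' y' hx hxy hy => ?_⟩
    · rintro rfl
      exact (hν.flow_pos P (hν.gap_zero_zero_pos P)).1.ne' h0
    · refine lt_of_eq_of_lt ?_ (hν.lt_meanMax_one hφ one_pos le_rfl
        ⟨(hν.R1_ω₂_pos h h0).le, hω.le⟩ (hν.pos_of_flow₁_eq_zero h0 hloss hloss').1
        (by rw [h1, one_mul]) ?_ hx hxy hy)
      · rw [hν.meanMax_zero_eq, h1]; ring
      · rw [hν.R1_ω₂_eq h, div_mul_cancel₀ _ hd.ne']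
  · have hC := C2r_eq_Cr2 h
    have p1 := integral_pos_of_ae_pos (hν.integrable_Cr P) (hν.ae_Cr_pos P)
    have p2 := integral_pos_of_ae_pos (hν.integrable_Cr1 P) (hν.ae_Cr1_pos P)
    have p3 := integral_pos_of_ae_pos (hν.integrable_Cr2 P) (hν.ae_Cr2_pos P)
    have hl := hν.R1_ω₃l_mem h
    have hl' : R1.ω₃l P ν * ∫ s, Cr P s ∂ν = ∫ s, Cr2 P s ∂ν := div_mul_cancel₀ _ p1.ne'
    have hu' : R1.ω₃u P ν * (∫ s, Cr1 P s ∂ν + ∫ s, Cr2 P s ∂ν) = ∫ s, Cr1 P s ∂ν := by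
      rw [R1.ω₃u, integral_add (hν.integrable_Cr1 P) (hν.integrable_C2r P)]
      simp only [hC]
      exact div_mul_cancel₀ _ (by linarith)
    set l := R1.ω₃l P ν with hldef
    have hl1 : 0 < 1 - l := sub_pos.2 hl.2
    -- With equal powers a constant selection l = ω₃l balances user 1's data without thinning. The
    -- factor p' below balances user 2's data, and p' ≤ 1 follows from ω₃l < ω₃u.
    have hφ : IsRule fun _ => l := ⟨measurable_const, fun _ => ⟨hl.1.le, hl.2.le⟩⟩
    refine ⟨1, 0, le_rfl, one_pos, le_rfl, fun x' y' hx hxy hy => ?_⟩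
    refine lt_of_eq_of_lt ?_ (hν.lt_meanMax_one hφ one_pos le_rfl
      (p' := l * (∫ s, Cr2 P s ∂ν) / ((1 - l) * ∫ s, Cr1 P s ∂ν)) ⟨?_, ?_⟩ ?_ ?_ ?_ hx hxy hy)
    · have e : meanMax P ν 0 1 0 = ∫ s, Cr2 P s ∂ν := by
        refine integral_congr_ae ?_
        filter_upwards [hν.pos] with s hs
        rw [metric_M3_zero P 1 0 hs.1.le hs.2.le, metric_M6, hC]
        simp
      rw [e, integral_const_mul, integral_const_mul]
      simp only [hC]
      ring
    · have := hl.1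
      positivity
    · rw [div_le_one (mul_pos hl1 p2)]
      nlinarith [mul_lt_mul_of_pos_right hω (add_pos p2 p3)]
    · rw [integral_const_mul]
      exact mul_pos hl.1 (integral_pos_of_ae_pos hloss hloss')
    · rw [integral_const_mul, integral_const_mul, integral_sub (hν.integrable_Cr P)
        (hν.integrable_C2r P)]
      simp only [hC]
      linarith
    · rw [integral_const_mul, integral_const_mul]
      simp only [hC]
      field_simp

end IsGainLaw

/-- Membership in both regions would make each of two dual values strictly smaller than the other.
-/
theorem not_inR1_and_inR2 {Ω : Type*} [MeasurableSpace Ω] {ρ : Measure Ω} [IsProbabilityMeasure ρ]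
    {S : ℕ → Ω → ℝ × ℝ} (hS : IsFading ρ S) (P : Powers) :
    ¬ (InR1 P (ρ.map (S 0)) ∧ InR2 P (ρ.map (S 0))) := by
  rintro ⟨h1, h2⟩
  have hν := hS.isGainLaw
  have hν' := hS.swap.isGainLaw
  rw [hS.map_swap] at hν'
  obtain ⟨x, y, hy, hyx, hx, hlt⟩ := hν.exists_meanMax_lt h1
  obtain ⟨x', y', hy', hyx', hx', hlt'⟩ := hν'.exists_meanMax_lt ((inR1_swap _ _).2 h2)
  have a := hlt y' x' hy' hyx' hx'
  have b := hlt' y x hy hyx hx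
  have e1 := meanMax_swap P (ρ.map (S 0)) 1 y' x'
  have e2 := meanMax_swap P (ρ.map (S 0)) 0 x y
  rw [sub_self] at e1
  rw [sub_zero] at e2
  rw [e1, e2] at b
  exact lt_asymm a b

end TwoWayRelay

theorem theorem2 {Ω : Type*} [MeasurableSpace Ω] (ρ : Measure Ω) [IsProbabilityMeasure ρ]
    (P : Powers) (S : ℕ → Ω → ℝ × ℝ) (hS : IsFading ρ S) (ν : Measure (ℝ × ℝ))
    (hν : ν = ρ.map (S 0)) (b₁ b₂ : ℝ) (hb₁ : 0 ≤ b₁) (hb₂ : 0 ≤ b₂) :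
    -- the thresholds in the definitions of the regions exist
    (∃ μ ∈ Set.Icc (0 : ℝ) 1, R1.Balanced P ν μ) ∧
    (∃ μ ∈ Set.Icc (0 : ℝ) 1, R2.Balanced P ν μ) ∧
    (∃ μ ∈ Set.Ioo (0 : ℝ) 1, R0.Balanced P ν μ) ∧
    -- the regions `R₁` and `R₂` are mutually exclusive (`R₀` is the remaining case)
    ¬ (InR1 P ν ∧ InR2 P ν) ∧
    -- the prescription for the region that applies can be met
    (∃ d sel, Prescribed P ν d sel) ∧
    -- and every policy that meets it is optimal
    ∀ d sel, Prescribed P ν d sel →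
      d.μ₁ ∈ Set.Icc (0 : ℝ) 1 ∧ d.μ₂ ∈ Set.Icc (0 : ℝ) 1 ∧ d.t ∈ Set.Icc (0 : ℝ) 1 ∧
      (∀ n, d.p n ∈ Set.Icc (0 : ℝ) 1) ∧
      ∀ X : Coin → ℕ → Ω → ℝ, IsCoinFlips ρ S d.p X →
        (∃ R₁ R₂ : ℝ, ∀ᵐ ω ∂ρ, IsOptimal P (fun i => S i ω) b₁ b₂
          (fun i => pick (selected d sel S X i ω)) (fun _ => d.t) R₁ R₂) ∧
        (∀ i, 0 < ρ {ω | selected d sel S X i ω = .M3}) ∧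
        (∀ i, 0 < ρ {ω | selected d sel S X i ω = .M6}) := by
  subst hν
  have hν := hS.isGainLaw
  exact ⟨hν.exists_R1_balanced P, exists_R2_balanced hS P, hν.exists_R0_balanced P,
    not_inR1_and_inR2 hS P, exists_prescribed hS P, fun _ _ h => h.achieves hS hb₁ hb₂⟩
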